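/- Let $n\ge 2$, let $\Omega\subset\mathbb{R}^n$ be a bounded domain, $T\in(0,\infty)$ and $\Omega_T=\Omega\times(0,T)$. Let $\mathbf p=(p_1,\dots,p_n)$, put $\bar p=\big(\frac1n\sum_{i=1}^n\frac1{p_i}\big)^{-1}$ and $P=\max\{2,p_1,\dots,p_n\}$, and assume $$1<p_i<\bar p\Big(1+\frac2n\Big)\ \text{ for all } i,\qquad \frac{2n}{n+2}<\bar p<n .$$ Let $\delta_1,\dots,\delta_n\ge0$ and $\mathcal C>0$. For $\rho>0$ and $(x_0,t_0)\in\mathbb{R}^{n+1}$ let $$K_\rho(x_0)=\prod_{i=1}^n\big(x_{0,i}-\rho^{1/p_i},\,x_{0,i}+\rho^{1/p_i}\big),\qquad Q_\rho(x_0,t_0)=K_\rho(x_0)\times(t_0-\rho,t_0).$$ A cut-off function for $Q_\rho(x_0,t_0)$ is a function $\zeta\in C^\infty(\mathbb{R}^{n+1})$ of the form $\zeta(x,t)=\psi(t)\prod_{i=1}^n\zeta_i(x_i)^{p_i}$, where $\psi\in C^\infty(\mathbb{R};[0,1])$ is non-decreasing with $\psi=0$ on $(-\infty,t_0-\rho+\frac\epsilon2]$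 and $\psi=1$ on $[t_0-\rho+\epsilon,\infty)$ for some $\epsilon\in(0,\rho)$, and $\zeta_i\in C_0^\infty(\mathbb{R};[0,1])$ has support in $(x_{0,i}-\rho^{1/p_i},x_{0,i}+\rho^{1/p_i})$. The class $\mathcal{DG}(\mathbf p,\{\delta_i\},\Omega_T,\mathcal C)$ consists of the measurable functions $u:\Omega_T\to\mathbb{R}$ such that $u\in L^P_{loc}(\Omega_T)\cap L^1_{loc}(0,T;W^{1,1}_{loc}(\Omega))$, $\partial_{x_i}u\in L^{p_i}_{loc}(\Omega_T)$ for all $i$, and such that for every cylinder $Q_\rho(x_0,t_0)\Subset\Omega_T$, every cut-off function $\zeta$ for it and every $k\in\mathbb{R}$, $$\operatorname*{ess\,sup}_{t_0-\rho<\tau<t_0}\int_{K_\rho(x_0)}(u-k)_\pm^2\,\zeta(x,\tau)\,dx+\sum_{i=1}^n\iint_{Q_\rho(x_0,t_0)\cap A_k^\pm}(|\partial_{x_i}u|-\delta_i)_+^{p_i}\,\zeta\,dx\,dt$$ $$\le\ \mathcal C\iint_{Q_\rho(x_0,t_0)}(u-k)_\pm^2\,\partial_t\zeta\,dx\,dt+\mathcal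 C\sum_{i=1}^n\iint_{Q_\rho(x_0,t_0)}(u-k)_\pm^{p_i}\,\big|\partial_{x_i}\zeta^{1/p_i}\big|^{p_i}\,dx\,dt$$ holds with both signs, where $A_k^+=\{u>k\}$ and $A_k^-=\{u<k\}$. Let $\omega=P-2+n\left(\frac{P}{\bar p}-1\right)$ and $\nu\in(\omega,P]$. Then there is a constant $C>0$, depending only on $n$, $\mathcal C$, $\mathbf p$, $\nu$ and $\max\{\delta_1,\dots,\delta_n\}$, such that for every $u\in\mathcal{DG}(\mathbf p,\{\delta_i\},\Omega_T,\mathcal C)$ and every cylinder $Q_{2\rho}(x_0,t_0)\Subset\Omega_T$, $$\operatorname*{ess\,sup}_{Q_\rho(x_0,t_0)}|u|\ \le\ C\left[\left(\frac1{|Q_{2\rho}(x_0,t_0)|}\iint_{Q_{2\rho}(x_0,t_0)}|u|^\nu\,dx\,dt\right)^{\frac1{\nu-\omega}}+1+\rho^{1/P}\right].$$ -/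

import Mathlib

namespace AnisoDG

open Set MeasureTheory
open scoped ContDiff ENNReal

noncomputable section

/- Points of space are functions `Fin n → ℝ`, with Lebesgue measure; points of space-time are
pairs `(x, t)`. Only the topology, the bounded sets and the measure of this space are used, and
these are the same as for the Euclidean norm. -/

/-- The harmonic mean of the exponents. -/
def pbar {n : ℕ} (p : Fin n → ℝ) : ℝ :=
  ((1 / (n : ℝ)) * ∑ i, 1 / p i)⁻¹

/-- The number `max {2, p₁, …, pₙ}`. -/
def bigP {n : ℕ} (p : Fin n → ℝ) : ℝ :=
  max 2 (⨆ i, p i)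

/-- The critical exponent `P - 2 + n (P / p̄ - 1)`. -/
def omega {n : ℕ} (p : Fin n → ℝ) : ℝ :=
  bigP p - 2 + n * (bigP p / pbar p - 1)

/-- The anisotropic box with centre `x₀` and half-sides `ρ ^ (1 / pᵢ)`. -/
def box {n : ℕ} (p : Fin n → ℝ) (x₀ : Fin n → ℝ) (ρ : ℝ) : Set (Fin n → ℝ) :=
  Set.univ.pi fun i => Ioo (x₀ i - ρ ^ (1 / p i)) (x₀ i + ρ ^ (1 / p i))

/-- The space-time cylinder over the box, with time interval `(t₀ - ρ, t₀)`. -/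
def cyl {n : ℕ} (p : Fin n → ℝ) (x₀ : Fin n → ℝ) (t₀ ρ : ℝ) : Set ((Fin n → ℝ) × ℝ) :=
  box p x₀ ρ ×ˢ Ioo (t₀ - ρ) t₀

/-- The space-time domain `Ω × (0, T)`. -/
def spaceTime {n : ℕ} (Ω : Set (Fin n → ℝ)) (T : ℝ) : Set ((Fin n → ℝ) × ℝ) :=
  Ω ×ˢ Ioo 0 T

/-- `A` is compactly contained in `B`. -/
def CompactlyContained {X : Type*} [TopologicalSpace X] (A B : Set X) : Prop :=
  IsCompact (closure A) ∧ closure A ⊆ B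

/-- `f` is in `L^q` on every compact subset of `U`. -/
def MemLpLoc {X : Type*} [TopologicalSpace X] [MeasureSpace X] (q : ℝ) (U : Set X)
    (f : X → ℝ) : Prop :=
  ∀ K : Set X, IsCompact K → K ⊆ U → MemLp f (ENNReal.ofReal q) (volume.restrict K)

/-- `v` is in `W^{1,1}_loc(Ω)`, and `g i` is its weak `i`-th partial derivative. -/
structure HasWeakGradient {n : ℕ} (Ω : Set (Fin n → ℝ)) (v : (Fin n → ℝ) → ℝ)
    (g : Fin n → (Fin n → ℝ) → ℝ) : Prop where
  memLpLoc : MemLpLoc 1 Ω v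
  memLpLoc_grad : ∀ i, MemLpLoc 1 Ω (g i)
  integral_eq : ∀ i, ∀ φ : (Fin n → ℝ) → ℝ, ContDiff ℝ ∞ φ → HasCompactSupport φ →
    tsupport φ ⊆ Ω →
      ∫ x in Ω, v x * fderiv ℝ φ x (Pi.single i 1) = - ∫ x in Ω, g i x * φ x

/-- `u` is in `L^𝐩_loc(0, T; W^{1,𝐩}_loc(Ω))`, with weak spatial derivatives `g i`:
almost every time slice is in `W^{1,1}_loc(Ω)`, the function and its spatial derivatives are
locally integrable in space-time, and the `i`-th derivative is locally `p i`-integrable. -/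
structure IsSobolevLoc {n : ℕ} (p : Fin n → ℝ) (Ω : Set (Fin n → ℝ)) (T : ℝ)
    (u : (Fin n → ℝ) × ℝ → ℝ) (g : Fin n → (Fin n → ℝ) × ℝ → ℝ) : Prop where
  slice : ∀ᵐ t ∂(volume.restrict (Ioo 0 T)),
    HasWeakGradient Ω (fun x => u (x, t)) (fun i x => g i (x, t))
  memLpLoc : MemLpLoc 1 (spaceTime Ω T) u
  memLpLoc_grad : ∀ i, MemLpLoc 1 (spaceTime Ω T) (g i)
  memLpLoc_grad_p : ∀ i, MemLpLoc (p i) (spaceTime Ω T) (g i)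

/-- The smooth cut-off functions `ζ(x, t) = ψ(t) ∏ᵢ ζᵢ(xᵢ) ^ pᵢ` for the cylinder
`cyl p x₀ t₀ ρ`, which vanish near its parabolic boundary. -/
def IsCutoff {n : ℕ} (p : Fin n → ℝ) (x₀ : Fin n → ℝ) (t₀ ρ : ℝ)
    (ζ : (Fin n → ℝ) × ℝ → ℝ) : Prop :=
  ContDiff ℝ ∞ ζ ∧
  ∃ (ψ : ℝ → ℝ) (η : Fin n → ℝ → ℝ),
    (ContDiff ℝ ∞ ψ ∧ Monotone ψ ∧ (∀ t, ψ t ∈ Icc (0 : ℝ) 1) ∧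
      ∃ ε ∈ Ioo 0 ρ, (∀ t ≤ t₀ - ρ + ε / 2, ψ t = 0) ∧ (∀ t ≥ t₀ - ρ + ε, ψ t = 1)) ∧
    (∀ i, ContDiff ℝ ∞ (η i) ∧ HasCompactSupport (η i) ∧ (∀ s, η i s ∈ Icc (0 : ℝ) 1) ∧
      tsupport (η i) ⊆ Ioo (x₀ i - ρ ^ (1 / p i)) (x₀ i + ρ ^ (1 / p i))) ∧
    ∀ x t, ζ (x, t) = ψ t * ∏ i, η i (x i) ^ p i

/-- The energy `w² ζ` of the truncation `w`, over the box at time `τ`. -/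
def sliceEnergy {n : ℕ} (p : Fin n → ℝ) (x₀ : Fin n → ℝ) (ρ : ℝ)
    (w ζ : (Fin n → ℝ) × ℝ → ℝ) (τ : ℝ) : ℝ≥0∞ :=
  ∫⁻ x in box p x₀ ρ, ENNReal.ofReal (w (x, τ) ^ 2 * ζ (x, τ))

/-- The sum over `i` of the integrals of `(|gᵢ| - δᵢ)₊ ^ pᵢ ζ` over the part of the cylinder
that lies in `A`. -/
def gradEnergy {n : ℕ} (p δ : Fin n → ℝ) (x₀ : Fin n → ℝ) (t₀ ρ : ℝ)
    (g : Fin n → (Fin n → ℝ) × ℝ → ℝ) (A : Set ((Fin n → ℝ) × ℝ))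
    (ζ : (Fin n → ℝ) × ℝ → ℝ) : ℝ≥0∞ :=
  ∑ i, ∫⁻ z in cyl p x₀ t₀ ρ,
    A.indicator (fun z => ENNReal.ofReal (max (|g i z| - δ i) 0 ^ p i * ζ z)) z

/-- The integral of `w² ∂ₜζ` over the cylinder, plus the sum over `i` of the integrals of
`w ^ pᵢ |∂ᵢ(ζ ^ (1 / pᵢ))| ^ pᵢ`. All integrands are non-negative for the cut-off functions
above. -/
def cutoffEnergy {n : ℕ} (p : Fin n → ℝ) (x₀ : Fin n → ℝ) (t₀ ρ : ℝ)
    (w ζ : (Fin n → ℝ) × ℝ → ℝ) : ℝ≥0∞ :=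
  (∫⁻ z in cyl p x₀ t₀ ρ, ENNReal.ofReal (w z ^ 2 * deriv (fun s => ζ (z.1, s)) z.2)) +
  ∑ i, ∫⁻ z in cyl p x₀ t₀ ρ, ENNReal.ofReal (w z ^ p i *
    |deriv (fun s => ζ (Function.update z.1 i s, z.2) ^ (1 / p i)) (z.1 i)| ^ p i)

/-- The energy inequality for the truncation `w`, with `A` the set where `w > 0`. The supremum
over time is the essential one, since `u` is determined only almost everywhere. -/
def EnergyIneq {n : ℕ} (p δ : Fin n → ℝ) (C₀ : ℝ) (x₀ : Fin n → ℝ) (t₀ ρ : ℝ)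
    (w : (Fin n → ℝ) × ℝ → ℝ) (A : Set ((Fin n → ℝ) × ℝ))
    (g : Fin n → (Fin n → ℝ) × ℝ → ℝ) (ζ : (Fin n → ℝ) × ℝ → ℝ) : Prop :=
  essSup (sliceEnergy p x₀ ρ w ζ) (volume.restrict (Ioo (t₀ - ρ) t₀)) +
      gradEnergy p δ x₀ t₀ ρ g A ζ
    ≤ ENNReal.ofReal C₀ * cutoffEnergy p x₀ t₀ ρ w ζ

/-- The De Giorgi class `DG(𝐩, {δᵢ}, Ω_T, C₀)`: the functions in
`L^𝐩_loc(0, T; W^{1,𝐩}_loc(Ω)) ∩ L^P_loc(Ω_T)` whose truncations `(u - k)₊` and `(u - k)₋`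
satisfy the energy inequality for all levels `k`, all cylinders compactly contained in `Ω_T` and
all cut-off functions. The values of `u` outside `Ω_T` play no role. -/
def DeGiorgiClass {n : ℕ} (p δ : Fin n → ℝ) (Ω : Set (Fin n → ℝ)) (T C₀ : ℝ)
    (u : (Fin n → ℝ) × ℝ → ℝ) : Prop :=
  AEMeasurable u (volume.restrict (spaceTime Ω T)) ∧
  MemLpLoc (bigP p) (spaceTime Ω T) u ∧
  ∃ g : Fin n → (Fin n → ℝ) × ℝ → ℝ,
    IsSobolevLoc p Ω T u g ∧
    ∀ (x₀ : Fin n → ℝ) (t₀ ρ : ℝ), 0 < ρ →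
      CompactlyContained (cyl p x₀ t₀ ρ) (spaceTime Ω T) →
      ∀ (k : ℝ) (ζ : (Fin n → ℝ) × ℝ → ℝ), IsCutoff p x₀ t₀ ρ ζ →
        EnergyIneq p δ C₀ x₀ t₀ ρ (fun z => max (u z - k) 0) {z | k < u z} g ζ ∧
        EnergyIneq p δ C₀ x₀ t₀ ρ (fun z => max (-(u z - k)) 0) {z | u z < k} g ζ

end

end AnisoDG

namespace AnisoDG

open Set MeasureTheory
open scoped ContDiff ENNReal

/-! ### Troisi's anisotropic Sobolev inequality -/

section Troisi

open Function Filter Topology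

/-! Put σ = ∑ 1/pᵢ = n/p̄. Besides 1 < pᵢ, the hypotheses on the exponents amount to σ > 1 and P σ <
n + 2. The second says that P lies strictly below the parabolic Sobolev exponent q = (n + 2)/σ, and
this gap drives a De Giorgi iteration in L^P.

Gain of integrability. Troisi's inequality (`troisi`) bounds the norm with exponent n/(σ - 1) by a
product of directional norms of the gradient. It follows from the one-dimensional bound along each
coordinate line, a Loomis–Whitney inequality, Hölder, and absorption of a power of the left side.
`slice_sobolev` carries it over to truncated, cut-off Sobolev functions by mollification.
Interpolating on each time slice with the L² bound, then using Hölder in time, gives an L^q bound on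
the cylinder (`spaceTime_sobolev`).

One step. The energy inequality at level h bounds everything in that estimate by the integral of (u
- h + a)₊^P over a slightly larger cylinder: on {u > h} the quantity u - h + a exceeds a, so lower
powers can be raised to P, and the measure of {u > h}, which multiplies the δᵢ, is controlled by
Chebyshev. Since P < q, Hölder gives a recursive inequality with total power 1 + P/(n + 2) > 1
(`deGiorgi_step`). With shrinking radii and levels rising to k it yields u ≤ k once the L^P integral
is small compared with k^(n+2-Pσ) (`le_of_lintegral_le`). The step needs k ≥ 1 and k^P ≥ ρ, which is
where the terms 1 and ρ^(1/P) come from. The bound from below is the same statement for -u.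

From P to ν. Since P - ω = n + 2 - P σ, writing |u|^P ≤ (sup |u|)^(P-ν) |u|^ν bounds the supremum on
one cylinder by the supremum on a larger one to the power (P - ν)/(P - ω), which is less than 1
because ν > ω. Such a sublinear recursion forgets its starting value (`absorb_sublinear`), and
`abs_le_average` results. -/

theorem ennreal_rpow_sum {ι : Type*} (t : Finset ι) (x : ℝ≥0∞) {a : ι → ℝ}
    (ha : ∀ i ∈ t, 0 ≤ a i) : x ^ (∑ i ∈ t, a i) = ∏ i ∈ t, x ^ a i := by
  classical
  induction t using Finset.induction with
  | empty => simp
  | insert i t hi ih =>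
    have h : ∀ j ∈ t, 0 ≤ a j := fun j hj => ha j (Finset.mem_insert_of_mem hj)
    rw [Finset.sum_insert hi, Finset.prod_insert hi, ← ih h, ENNReal.rpow_add_of_nonneg]
    · exact ha i (Finset.mem_insert_self _ _)
    · exact Finset.sum_nonneg h

/-- The Loomis–Whitney form of the grid-lines lemma: a different function in each direction. -/
theorem lintegral_prod_lintegral_pow_le_prod {n : ℕ} (hn : 2 ≤ n)
    {f : Fin n → (Fin n → ℝ) → ℝ≥0∞} (hf : ∀ i, Measurable (f i))
    (hfin : ∀ i, ∫⁻ x, f i x ≠ ⊤) :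
    ∫⁻ x, ∏ i, (∫⁻ s, f i (update x i s)) ^ ((1 : ℝ) / (n - 1 : ℝ))
      ≤ (n : ℝ≥0∞) ^ ((n : ℝ) / (n - 1 : ℝ)) *
        ∏ i, (∫⁻ x, f i x) ^ ((1 : ℝ) / (n - 1 : ℝ)) := by
  classical
  have hn1 : (1 : ℝ) < n := by exact_mod_cast hn
  have hc : (0 : ℝ) < 1 / (n - 1 : ℝ) := by
    apply one_div_pos.2; linarith
  set c : ℝ := 1 / (n - 1 : ℝ) with hcdef
  have hconj : Real.HolderConjugate (Fintype.card (Fin n)) ((n : ℝ) / (n - 1)) := by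
    rw [Fintype.card_fin]
    exact Real.HolderConjugate.conjExponent hn1
  -- The ε allows division by the total integrals even when one of them is zero; it is sent to 0 at
  -- the end.
  have key : ∀ ε : ℝ≥0∞, ε ≠ 0 → ε ≠ ⊤ →
      ∫⁻ x, ∏ i, (∫⁻ s, f i (update x i s)) ^ c
      ≤ (n : ℝ≥0∞) ^ ((n : ℝ) / (n - 1 : ℝ)) * ∏ i, ((∫⁻ x, f i x) + ε) ^ c := by
    intro ε h0 hε
    set J : Fin n → ℝ≥0∞ := fun i => (∫⁻ x, f i x) + ε with hJ
    have hJfin : ∀ i, J i ≠ ⊤ := fun i => ENNReal.add_ne_top.2 ⟨hfin i, hε⟩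
    have hJ0 : ∀ i, J i ≠ 0 := fun i => by simp [hJ, h0]
    -- A single function with f i ≤ J i * F for every i and integral at most n, so that the
    -- grid-lines lemma for one function suffices.
    set F : (Fin n → ℝ) → ℝ≥0∞ := fun x => ∑ i, (J i)⁻¹ * f i x with hF
    have hFm : Measurable F := by
      apply Finset.measurable_fun_sum; intro i _; exact (hf i).const_mul _
    have hFint : ∫⁻ x, F x ≤ n := by
      rw [hF, lintegral_finsetSum]
      · calc ∑ i, ∫⁻ x, (J i)⁻¹ * f i x ≤ ∑ i : Fin n, 1 := by
              apply Finset.sum_le_sum; intro i _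
              rw [lintegral_const_mul _ (hf i)]
              calc (J i)⁻¹ * ∫⁻ x, f i x ≤ (J i)⁻¹ * J i := by gcongr; simp [hJ]
                _ = 1 := ENNReal.inv_mul_cancel (hJ0 i) (hJfin i)
          _ = n := by simp
      · intro i _; exact (hf i).const_mul _
    have h1 : ∀ x i, (∫⁻ s, f i (update x i s)) ≤ J i * ∫⁻ s, F (update x i s) := by
      intro x i
      rw [← lintegral_const_mul _ (show Measurable fun s : ℝ => F (update x i s) from
        hFm.comp (measurable_update x))]
      apply lintegral_mono; intro s
      calc f i (update x i s) = J i * ((J i)⁻¹ * f i (update x i s)) := by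
            rw [← mul_assoc, ENNReal.mul_inv_cancel (hJ0 i) (hJfin i), one_mul]
        _ ≤ _ := by
            simp only
            gcongr
            exact Finset.single_le_sum (f := fun i' => (J i')⁻¹ * f i' (update x i s))
              (fun _ _ => zero_le) (Finset.mem_univ i)
    have hgrid := lintegral_prod_lintegral_pow_le (fun _ : Fin n => (volume : Measure ℝ)) hconj hFm
    rw [Fintype.card_fin, ← hcdef, ← volume_pi] at hgrid
    calc ∫⁻ x, ∏ i, (∫⁻ s, f i (update x i s)) ^ c
        ≤ ∫⁻ x, (∏ i, J i ^ c) * ∏ i, (∫⁻ s, F (update x i s)) ^ c := by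
          apply lintegral_mono; intro x
          simp only
          rw [← Finset.prod_mul_distrib]
          apply Finset.prod_le_prod' ; intro i _
          rw [← ENNReal.mul_rpow_of_nonneg _ _ hc.le]
          exact ENNReal.rpow_le_rpow (h1 x i) hc.le
      _ = (∏ i, J i ^ c) * ∫⁻ x, ∏ i, (∫⁻ s, F (update x i s)) ^ c := by
          rw [lintegral_const_mul']
          exact ENNReal.prod_ne_top fun i _ => ENNReal.rpow_ne_top_of_nonneg hc.le (hJfin i)
      _ ≤ (∏ i, J i ^ c) * (n : ℝ≥0∞) ^ ((n : ℝ) / (n - 1 : ℝ)) := by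
          gcongr
          refine hgrid.trans (ENNReal.rpow_le_rpow hFint ?_)
          apply div_nonneg <;> linarith
      _ = _ := mul_comm _ _
  have hlim : Tendsto (fun ε : ℝ≥0∞ => (n : ℝ≥0∞) ^ ((n : ℝ) / (n - 1 : ℝ)) *
      ∏ i, ((∫⁻ x, f i x) + ε) ^ c) (𝓝[>] 0)
      (𝓝 ((n : ℝ≥0∞) ^ ((n : ℝ) / (n - 1 : ℝ)) * ∏ i, (∫⁻ x, f i x) ^ c)) := by
    apply Tendsto.mono_left _ nhdsWithin_le_nhds
    have : (fun ε : ℝ≥0∞ => (n : ℝ≥0∞) ^ ((n : ℝ) / (n - 1 : ℝ)) * ∏ i, ((∫⁻ x, f i x) + ε) ^ c) 0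
      = (n : ℝ≥0∞) ^ ((n : ℝ) / (n - 1 : ℝ)) * ∏ i, (∫⁻ x, f i x) ^ c := by simp
    rw [← this]
    apply ENNReal.Tendsto.const_mul
    · apply ENNReal.tendsto_finsetProd_of_ne_top
      · intro i _
        apply (ENNReal.continuous_rpow_const.tendsto _).comp
        exact (continuous_const.add continuous_id).tendsto _
      · intro i _
        exact ENNReal.rpow_ne_top_of_nonneg hc.le (by simpa using hfin i)
    · right
      apply ENNReal.rpow_ne_top_of_nonneg (by apply div_nonneg <;> linarith) (by simp)
  refine ge_of_tendsto hlim ?_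
  have : ∀ᶠ ε : ℝ≥0∞ in 𝓝[>] 0, ε < 1 := nhdsWithin_le_nhds (Iio_mem_nhds (by simp))
  filter_upwards [self_mem_nhdsWithin, this] with ε h0 h1
  exact key ε (ne_of_gt h0) (ne_top_of_lt h1)

/-- One-dimensional bound for a power of a compactly supported function along a coordinate line. -/
theorem enorm_rpow_le_lintegral_line {n : ℕ} {V : (Fin n → ℝ) → ℝ} (hV : ContDiff ℝ 1 V)
    (hc : HasCompactSupport V) {γ : ℝ} (hγ : 1 < γ) (i : Fin n) (x : Fin n → ℝ) :
    ‖V x‖ₑ ^ γ ≤ ∫⁻ s, ENNReal.ofReal γ *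
      (‖V (update x i s)‖ₑ ^ (γ - 1) * ‖fderiv ℝ V (update x i s) (Pi.single i 1)‖ₑ) := by
  have hupd : ContDiff ℝ 1 (fun s : ℝ => update x i s) := contDiff_update 1 x i
  set φ : ℝ → ℝ := fun s => ‖V (update x i s)‖ ^ γ with hφ
  have hVu : ContDiff ℝ 1 (fun s : ℝ => V (update x i s)) := hV.comp hupd
  have h1 : ContDiff ℝ 1 φ := hVu.norm_rpow hγ
  have h2' : HasCompactSupport (fun s : ℝ => V (update x i s)) :=
    hc.comp_isClosedEmbedding (isClosedEmbedding_update x i)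
  have h2 : HasCompactSupport φ := by
    refine h2'.mono ?_
    intro s hs
    simp only [mem_support, hφ] at hs ⊢
    intro h0; apply hs; rw [h0, norm_zero, Real.zero_rpow (by linarith)]
  have h3 := HasCompactSupport.enorm_le_lintegral_Ici_deriv h1 h2 (x i)
  have h4 : ‖φ (x i)‖ₑ = ‖V x‖ₑ ^ γ := by
    simp only [hφ, update_eq_self]
    rw [Real.enorm_rpow_of_nonneg (norm_nonneg _) (by linarith), enorm_norm]
  rw [← h4]
  refine h3.trans ((setLIntegral_le_lintegral _ _).trans ?_)
  apply lintegral_mono; intro s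
  have hd : HasDerivAt (fun s : ℝ => V (update x i s))
      (fderiv ℝ V (update x i s) (Pi.single i 1)) s := by
    have := (hV.differentiable one_ne_zero (update x i s)).hasFDerivAt
    exact this.comp_hasDerivAt s (hasDerivAt_update x i s)
  have hd2 : HasDerivAt φ (γ * |V (update x i s)| ^ (γ - 2) * V (update x i s) *
      fderiv ℝ V (update x i s) (Pi.single i 1)) s :=
    HasDerivAt.comp (h₂ := fun y : ℝ => |y| ^ γ) s
      (hasDerivAt_abs_rpow (V (update x i s)) hγ) hd
  simp only
  rw [hd2.deriv]
  rw [enorm_mul, ← mul_assoc]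
  gcongr
  rw [enorm_mul, enorm_mul, mul_assoc, Real.enorm_of_nonneg (by linarith : 0 ≤ γ)]
  gcongr
  by_cases h0 : V (update x i s) = 0
  · simp [h0]
  · have hpos : 0 < |V (update x i s)| := abs_pos.2 h0
    rw [← enorm_norm (V (update x i s)), Real.norm_eq_abs, ← enorm_mul,
      ← Real.enorm_rpow_of_nonneg hpos.le (by linarith)]
    apply le_of_eq; congr 1
    rw [show γ - 1 = (γ - 2) + 1 by ring, Real.rpow_add hpos, Real.rpow_one]

/-- Troisi's anisotropic Sobolev inequality for `C¹` functions with compact support. -/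
theorem troisi {n : ℕ} (hn : 2 ≤ n) {p : Fin n → ℝ} (hp : ∀ i, 1 < p i)
    (hσ : 1 < ∑ i, 1 / p i) :
    ∃ C : ℝ≥0∞, C ≠ ⊤ ∧ ∀ V : (Fin n → ℝ) → ℝ, ContDiff ℝ 1 V → HasCompactSupport V →
      ∫⁻ x, ‖V x‖ₑ ^ (n / (∑ i, 1 / p i - 1)) ≤
        C * ∏ i, (∫⁻ x, ‖fderiv ℝ V x (Pi.single i 1)‖ₑ ^ p i) ^
          (1 / ((∑ i, 1 / p i - 1) * p i)) := by
  set σ := ∑ i, 1 / p i with hσdef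
  have hn1 : (1 : ℝ) < n := by exact_mod_cast hn
  have hn1' : (0 : ℝ) < n - 1 := by linarith
  have hσ1 : 0 < σ - 1 := by linarith
  set s : ℝ := n / (σ - 1) with hs
  have hs0 : 0 < s := by positivity
  set c : ℝ := 1 / (n - 1 : ℝ) with hcdef
  have hc0 : 0 < c := by positivity
  -- Two requirements meet here: γ i - 1 = s (1 - 1 / p i) makes Hölder return exactly the integral
  -- of |V|^s, and ∑ γ i / (n - 1) = s makes the product of the line bounds reproduce |V|^s. The
  -- value of s is the one for which both hold.
  set γ : Fin n → ℝ := fun i => 1 + s * (1 - 1 / p i) with hγdef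
  have hp1 : ∀ i, 0 < 1 - 1 / p i := fun i => by
    have := hp i
    rw [sub_pos, div_lt_one] <;> linarith
  have hγ : ∀ i, 1 < γ i := fun i => by
    have := mul_pos hs0 (hp1 i)
    simp only [hγdef]; linarith
  have hsum1 : ∑ i, (1 - 1 / p i) = n - σ := by
    rw [Finset.sum_sub_distrib]; simp [hσdef]
  have hsumγ : ∑ i, γ i * c = s := by
    rw [← Finset.sum_mul]
    simp only [hγdef]
    rw [Finset.sum_add_distrib, ← Finset.mul_sum, hsum1]
    simp only [Finset.sum_const, Finset.card_univ, Fintype.card_fin, nsmul_eq_mul, mul_one]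
    rw [hcdef, hs]
    field_simp
    ring
  have hσn : σ < n := by
    have : 0 < ∑ i, (1 - 1 / p i) := Finset.sum_pos (fun i _ => hp1 i)
      ⟨⟨0, by omega⟩, Finset.mem_univ _⟩
    linarith
  -- The total power of J that Hölder puts on the right. It is below 1 because σ > 1, so it can be
  -- absorbed on the left.
  set e : ℝ := (n - σ) * c with he
  have he0 : 0 < e := mul_pos (by linarith) hc0
  have he1 : 1 - e = (σ - 1) * c := by
    rw [he, hcdef]; field_simp; ring
  set K : ℝ≥0∞ := (n : ℝ≥0∞) ^ ((n : ℝ) / (n - 1 : ℝ)) * ∏ i, ENNReal.ofReal (γ i) ^ c with hK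
  have hKfin : K ≠ ⊤ := by
    apply ENNReal.mul_ne_top
    · exact ENNReal.rpow_ne_top_of_nonneg (by positivity) (by simp)
    · exact ENNReal.prod_ne_top fun i _ => ENNReal.rpow_ne_top_of_nonneg hc0.le (by simp)
  refine ⟨K ^ (1 / ((σ - 1) * c)), ENNReal.rpow_ne_top_of_nonneg (by positivity) hKfin, ?_⟩
  intro V hV hVc
  set J := ∫⁻ x, ‖V x‖ₑ ^ s with hJ
  set B : Fin n → ℝ≥0∞ := fun i => ∫⁻ x, ‖fderiv ℝ V x (Pi.single i 1)‖ₑ ^ p i with hB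
  have hVm : Measurable V := hV.continuous.measurable
  have hdcont : ∀ i : Fin n, Continuous fun x => fderiv ℝ V x (Pi.single i 1) := fun i =>
    (hV.continuous_fderiv one_ne_zero).clm_apply continuous_const
  have hdcs : ∀ i : Fin n, HasCompactSupport fun x => fderiv ℝ V x (Pi.single i 1) := fun i =>
    hVc.fderiv_apply (𝕜 := ℝ) _
  have hfinite : ∀ (W : (Fin n → ℝ) → ℝ) (r : ℝ), 0 < r → Continuous W → HasCompactSupport W →
      ∫⁻ x, ‖W x‖ₑ ^ r ≠ ⊤ := by
    intro W r hr hW hWc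
    have h := (hW.memLp_of_hasCompactSupport (p := ENNReal.ofReal r) (μ := volume) hWc)
    have h' := lintegral_rpow_enorm_lt_top_of_eLpNorm_lt_top (p := ENNReal.ofReal r)
      (by simpa using hr) (by simp) h.2
    rw [ENNReal.toReal_ofReal hr.le] at h'
    exact h'.ne
  have hJfin : J ≠ ⊤ := hfinite V s hs0 hV.continuous hVc
  have hBfin : ∀ i, B i ≠ ⊤ := fun i => hfinite _ (p i) (by linarith [hp i]) (hdcont i) (hdcs i)
  have hI : ∀ i, ∫⁻ x, ENNReal.ofReal (γ i) *
      (‖V x‖ₑ ^ (γ i - 1) * ‖fderiv ℝ V x (Pi.single i 1)‖ₑ) ≤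
      ENNReal.ofReal (γ i) * (J ^ (1 - 1 / p i) * B i ^ (1 / p i)) := by
    intro i
    have hpi : 0 < p i := by linarith [hp i]
    rw [lintegral_const_mul' _ _ (by simp)]
    gcongr
    have := ENNReal.lintegral_mul_norm_pow_le (μ := volume) (f := fun x => ‖V x‖ₑ ^ s)
      (g := fun x => ‖fderiv ℝ V x (Pi.single i 1)‖ₑ ^ p i)
      (hVm.enorm.pow_const s).aemeasurable
      ((hdcont i).measurable.enorm.pow_const _).aemeasurable
      (hp1 i).le (by positivity : 0 ≤ 1 / p i) (by ring)
    refine le_trans (le_of_eq ?_) this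
    apply lintegral_congr; intro x
    rw [← ENNReal.rpow_mul, ← ENNReal.rpow_mul, mul_one_div_cancel hpi.ne', ENNReal.rpow_one]
    congr 2
    simp [hγdef]
  have hIfin : ∀ i, ∫⁻ x, ENNReal.ofReal (γ i) *
      (‖V x‖ₑ ^ (γ i - 1) * ‖fderiv ℝ V x (Pi.single i 1)‖ₑ) ≠ ⊤ := by
    intro i
    refine ne_top_of_le_ne_top ?_ (hI i)
    refine ENNReal.mul_ne_top (by simp) (ENNReal.mul_ne_top ?_ ?_)
    · exact ENNReal.rpow_ne_top_of_nonneg (hp1 i).le hJfin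
    · exact ENNReal.rpow_ne_top_of_nonneg (by have := hp i; positivity) (hBfin i)
  have hgrid := lintegral_prod_lintegral_pow_le_prod hn (f := fun i x => ENNReal.ofReal (γ i) *
      (‖V x‖ₑ ^ (γ i - 1) * ‖fderiv ℝ V x (Pi.single i 1)‖ₑ)) (fun i =>
      ((hVm.enorm.pow_const _).mul (hdcont i).measurable.enorm).const_mul _) hIfin
  have hmain : J ≤ K * (∏ i, B i ^ (c / p i)) * J ^ e := by
    calc J ≤ ∫⁻ x, ∏ i, (∫⁻ t, ENNReal.ofReal (γ i) * (‖V (update x i t)‖ₑ ^ (γ i - 1) *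
            ‖fderiv ℝ V (update x i t) (Pi.single i 1)‖ₑ)) ^ c := by
          apply lintegral_mono; intro x
          have : ‖V x‖ₑ ^ s = ∏ i, (‖V x‖ₑ ^ γ i) ^ c := by
            simp_rw [← ENNReal.rpow_mul]
            rw [← ennreal_rpow_sum, hsumγ]
            intro i _; have := hγ i; positivity
          simp only
          rw [this]
          apply Finset.prod_le_prod'; intro i _
          exact ENNReal.rpow_le_rpow (enorm_rpow_le_lintegral_line hV hVc (hγ i) i x) hc0.le
      _ ≤ _ := hgrid
      _ ≤ (n : ℝ≥0∞) ^ ((n : ℝ) / (n - 1 : ℝ)) *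
          ∏ i, (ENNReal.ofReal (γ i) * (J ^ (1 - 1 / p i) * B i ^ (1 / p i))) ^ c := by
          gcongr with i _
          exact hI i
      _ = K * (∏ i, B i ^ (c / p i)) * J ^ e := by
          simp_rw [ENNReal.mul_rpow_of_nonneg _ _ hc0.le, Finset.prod_mul_distrib,
            ← ENNReal.rpow_mul]
          rw [← ennreal_rpow_sum _ _ (fun i _ => mul_nonneg (hp1 i).le hc0.le),
            ← Finset.sum_mul, hsum1, hK]
          simp_rw [div_mul_eq_mul_div, one_mul]
          ring
  have hgoal : K ^ (1 / ((σ - 1) * c)) * ∏ i, B i ^ (1 / ((σ - 1) * p i)) =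
      (K * ∏ i, B i ^ (c / p i)) ^ (1 / ((σ - 1) * c)) := by
    rw [ENNReal.mul_rpow_of_nonneg K _ (by positivity),
      ← ENNReal.prod_rpow_of_nonneg (f := fun i => B i ^ (c / p i)) (by positivity)]
    congr 1
    apply Finset.prod_congr rfl; intro i _
    rw [← ENNReal.rpow_mul]
    congr 1
    have := hp i
    have : p i ≠ 0 := by linarith
    field_simp
  rw [hgoal]
  rcases eq_or_ne J 0 with h0 | h0
  · rw [h0]; exact zero_le
  -- The division by J ^ e is legitimate because J is finite, by compact support, and nonzero.
  have hJe : J ^ (1 - e) ≤ K * ∏ i, B i ^ (c / p i) := by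
    rw [ENNReal.rpow_sub _ _ h0 hJfin, ENNReal.rpow_one]
    apply ENNReal.div_le_of_le_mul hmain
  calc J = (J ^ (1 - e)) ^ (1 / ((σ - 1) * c)) := by
        rw [← ENNReal.rpow_mul, he1, mul_one_div_cancel (by positivity), ENNReal.rpow_one]
    _ ≤ _ := ENNReal.rpow_le_rpow hJe (by positivity)

end Troisi
end AnisoDG

namespace AnisoDG

open Set MeasureTheory
open scoped ContDiff ENNReal

/-! ### Mollification and upper limits of integrals -/

section Mollify

open Function Filter Topology ContinuousLinearMap
open scoped Convolution

/-- Jensen's inequality for convolutions with a probability density. -/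
theorem lintegral_enorm_convolution_rpow_le {n : ℕ} {φ g : (Fin n → ℝ) → ℝ} (hφ : Measurable φ)
    (hφ1 : ∫⁻ x, ‖φ x‖ₑ = 1) (hg : Measurable g) {p : ℝ} (hp : 1 ≤ p) :
    ∫⁻ x, ‖(φ ⋆[lsmul ℝ ℝ, volume] g) x‖ₑ ^ p ≤ ∫⁻ x, ‖g x‖ₑ ^ p := by
  have hp0 : 0 < p := by linarith
  have h1 : ∀ x, ‖(φ ⋆[lsmul ℝ ℝ, volume] g) x‖ₑ ^ p ≤ ∫⁻ t, ‖φ t‖ₑ * ‖g (x - t)‖ₑ ^ p := by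
    intro x
    have hgx : Measurable fun t => g (x - t) := hg.comp (measurable_const.sub measurable_id)
    have h2 : ‖(φ ⋆[lsmul ℝ ℝ, volume] g) x‖ₑ ≤ ∫⁻ t, ‖φ t‖ₑ * ‖g (x - t)‖ₑ := by
      refine (enorm_integral_le_lintegral_enorm _).trans (le_of_eq ?_)
      apply lintegral_congr; intro t
      simp [enorm_mul]
    -- Jensen in the form of Hölder, after splitting φ = φ^(1 - 1/p) · φ^(1/p); the first factor
    -- integrates to 1.
    have h3 := ENNReal.lintegral_mul_norm_pow_le (μ := volume) (f := fun t => ‖φ t‖ₑ)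
      (g := fun t => ‖φ t‖ₑ * ‖g (x - t)‖ₑ ^ p) (p := 1 - 1 / p) (q := 1 / p)
      hφ.enorm.aemeasurable (hφ.enorm.mul (hgx.enorm.pow_const p)).aemeasurable
      (by rw [sub_nonneg, div_le_one hp0]; exact hp) (by positivity) (by ring)
    rw [hφ1, ENNReal.one_rpow, one_mul] at h3
    have h4 : ∀ t, ‖φ t‖ₑ ^ (1 - 1 / p) * (‖φ t‖ₑ * ‖g (x - t)‖ₑ ^ p) ^ (1 / p) =
        ‖φ t‖ₑ * ‖g (x - t)‖ₑ := by
      intro t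
      rw [ENNReal.mul_rpow_of_nonneg _ _ (by positivity), ← mul_assoc,
        ← ENNReal.rpow_add_of_nonneg _ _ (by rw [sub_nonneg, div_le_one hp0]; exact hp)
          (by positivity), ← ENNReal.rpow_mul, mul_one_div_cancel hp0.ne']
      simp
    simp_rw [h4] at h3
    calc _ ≤ ((∫⁻ t, ‖φ t‖ₑ * ‖g (x - t)‖ₑ ^ p) ^ (1 / p)) ^ p :=
          ENNReal.rpow_le_rpow (h2.trans h3) hp0.le
      _ = _ := by rw [← ENNReal.rpow_mul, one_div_mul_cancel hp0.ne', ENNReal.rpow_one]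
  calc _ ≤ ∫⁻ x, ∫⁻ t, ‖φ t‖ₑ * ‖g (x - t)‖ₑ ^ p := lintegral_mono h1
    _ = ∫⁻ t, ∫⁻ x, ‖φ t‖ₑ * ‖g (x - t)‖ₑ ^ p := by
        rw [lintegral_lintegral_swap]
        apply Measurable.aemeasurable
        exact (hφ.comp measurable_snd).enorm.mul
          ((hg.comp (measurable_fst.sub measurable_snd)).enorm.pow_const p)
    _ = ∫⁻ t, ‖φ t‖ₑ * ∫⁻ x, ‖g x‖ₑ ^ p := by
        apply lintegral_congr; intro t
        rw [lintegral_const_mul' _ _ (by simp)]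
        congr 1
        exact lintegral_sub_right_eq_self (fun x => ‖g x‖ₑ ^ p) t
    _ = _ := by rw [lintegral_mul_const _ hφ.enorm, hφ1, one_mul]

/-- If `aₘ → a` boundedly and `bₘ → b` without gain of mass, then `∫ aₘ bₘ` is eventually not much
larger than `∫ a b`. -/
theorem eventually_lintegral_mul_le {α : Type*} [MeasurableSpace α] {μ : Measure α}
    {a b : ℕ → α → ℝ≥0∞} {a' b' : α → ℝ≥0∞} {M : ℝ≥0∞} (hM : M ≠ ⊤)
    (ha : ∀ m, Measurable (a m)) (hb : ∀ m, Measurable (b m)) (ha' : Measurable a')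
    (hb' : Measurable b')
    (haM : ∀ m x, a m x ≤ M) (haM' : ∀ x, a' x ≤ M)
    (hal : ∀ᵐ x ∂μ, Tendsto (fun m => a m x) atTop (𝓝 (a' x)))
    (hbl : ∀ᵐ x ∂μ, Tendsto (fun m => b m x) atTop (𝓝 (b' x)))
    (hbb : ∀ m, ∫⁻ x, b m x ∂μ ≤ ∫⁻ x, b' x ∂μ) (hfin : ∫⁻ x, b' x ∂μ ≠ ⊤)
    {ε : ℝ≥0∞} (hε : ε ≠ 0) :
    ∀ᶠ m in atTop, ∫⁻ x, a m x * b m x ∂μ ≤ ∫⁻ x, a' x * b' x ∂μ + ε := by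
  set I := ∫⁻ x, b' x ∂μ with hI
  have hMI : M * I ≠ ⊤ := ENNReal.mul_ne_top hM hfin
  -- Fatou is applied to the complementary product (M - a m) * b m. Since ∫ M b m never exceeds ∫ M
  -- b', a lower bound there is an upper bound for ∫ a m b m. Strong convergence of the mollified
  -- gradients is thereby avoided.
  have hF : ∫⁻ x, (M - a' x) * b' x ∂μ ≤
      liminf (fun m => ∫⁻ x, (M - a m x) * b m x ∂μ) atTop := by
    refine le_trans ?_ (lintegral_liminf_le fun m => (measurable_const.sub (ha m)).mul (hb m))
    apply lintegral_mono_ae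
    filter_upwards [hal, hbl, ae_lt_top hb' hfin] with x h1 h2 h3
    apply le_of_eq
    symm
    apply Tendsto.liminf_eq
    apply ENNReal.Tendsto.mul _ (Or.inr h3.ne) h2
    · right; exact ne_top_of_le_ne_top hM tsub_le_self
    · exact ENNReal.Tendsto.sub tendsto_const_nhds h1 (Or.inl hM)
  have hx : ∀ m, ∫⁻ x, a m x * b m x ∂μ + ∫⁻ x, (M - a m x) * b m x ∂μ ≤ M * I := by
    intro m
    rw [← lintegral_add_left (f := fun x => a m x * b m x) ((ha m).mul (hb m))]
    calc _ = ∫⁻ x, M * b m x ∂μ := by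
          apply lintegral_congr; intro x
          rw [← add_mul, add_tsub_cancel_of_le (haM m x)]
      _ = M * ∫⁻ x, b m x ∂μ := lintegral_const_mul' _ _ hM
      _ ≤ _ := by gcongr; exact hbb m
  have hx' : ∫⁻ x, a' x * b' x ∂μ + ∫⁻ x, (M - a' x) * b' x ∂μ = M * I := by
    rw [← lintegral_add_left (f := fun x => a' x * b' x) (ha'.mul hb')]
    calc _ = ∫⁻ x, M * b' x ∂μ := by
          apply lintegral_congr; intro x
          rw [← add_mul, add_tsub_cancel_of_le (haM' x)]
      _ = M * I := lintegral_const_mul' _ _ hM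
  set L := ∫⁻ x, (M - a' x) * b' x ∂μ with hL
  have hLfin : L ≠ ⊤ := ne_top_of_le_ne_top hMI (by rw [← hx']; exact le_add_self)
  rcases eq_or_ne L 0 with hL0 | hL0
  · refine Eventually.of_forall fun m => ?_
    rw [hL0, add_zero] at hx'
    rw [hx']
    exact (le_self_add.trans (hx m)).trans le_self_add
  · by_cases hεt : ε = ⊤
    · simp [hεt]
    have hlt : L - ε < liminf (fun m => ∫⁻ x, (M - a m x) * b m x ∂μ) atTop :=
      lt_of_lt_of_le (ENNReal.sub_lt_self hLfin hL0 hε) hF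
    filter_upwards [eventually_lt_of_lt_liminf hlt] with m hm
    have h1 := hx m
    rw [← hx'] at h1
    have h2 : L ≤ ∫⁻ x, (M - a m x) * b m x ∂μ + ε := tsub_le_iff_right.1 hm.le
    have h3 : ∫⁻ x, a m x * b m x ∂μ + L ≤ ∫⁻ x, a' x * b' x ∂μ + ε + L := by
      calc _ ≤ ∫⁻ x, a m x * b m x ∂μ + (∫⁻ x, (M - a m x) * b m x ∂μ + ε) := by gcongr
        _ ≤ ∫⁻ x, a' x * b' x ∂μ + L + ε := by rw [← add_assoc]; gcongr
        _ = _ := by ring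
    exact (ENNReal.add_le_add_iff_right hLfin).1 h3

/-- The classical derivative of a mollification is the mollification of the weak derivative. -/
theorem fderiv_convolution_of_weak {n : ℕ} {U : Set (Fin n → ℝ)} (hU : MeasurableSet U)
    {f g : (Fin n → ℝ) → ℝ} (i : Fin n) (hf : LocallyIntegrable (U.indicator f) volume)
    (hw : ∀ φ : (Fin n → ℝ) → ℝ, ContDiff ℝ ∞ φ → HasCompactSupport φ → tsupport φ ⊆ U →
      ∫ x in U, f x * fderiv ℝ φ x (Pi.single i 1) = - ∫ x in U, g x * φ x)
    {φ : (Fin n → ℝ) → ℝ} (hφ : ContDiff ℝ ∞ φ) (hφc : HasCompactSupport φ) {x : Fin n → ℝ}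
    (hx : ∀ y ∈ tsupport φ, x - y ∈ U) :
    fderiv ℝ (φ ⋆[lsmul ℝ ℝ, volume] (U.indicator f)) x (Pi.single i 1) =
      (φ ⋆[lsmul ℝ ℝ, volume] (U.indicator g)) x := by
  have hφ1 : ContDiff ℝ 1 φ := hφ.of_le (by exact_mod_cast le_top)
  rw [(hφc.hasFDerivAt_convolution_left (lsmul ℝ ℝ) hφ1 hf x).fderiv]
  have hfd : HasCompactSupport (fderiv ℝ φ) := hφc.fderiv (𝕜 := ℝ)
  have hex : ConvolutionExistsAt (fderiv ℝ φ) (U.indicator f) x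
      ((lsmul ℝ ℝ).precompL (Fin n → ℝ)) volume :=
    hfd.convolutionExists_left _ (hφ1.continuous_fderiv one_ne_zero) hf x
  rw [convolution_def, ContinuousLinearMap.integral_apply hex]
  -- The reflected and translated mollifier is an admissible test function, because x is far enough
  -- inside U.
  set χ : (Fin n → ℝ) → ℝ := fun y => φ (x - y) with hχ
  have hχs : ContDiff ℝ ∞ χ := hφ.comp (contDiff_const.sub contDiff_id)
  have hemb : IsClosedEmbedding fun y : Fin n → ℝ => x - y :=
    (Homeomorph.subLeft x).isClosedEmbedding
  have hχc : HasCompactSupport χ := hφc.comp_isClosedEmbedding hemb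
  have hχt : tsupport χ ⊆ U := by
    intro y hy
    have h1 : tsupport χ ⊆ (fun y => x - y) ⁻¹' tsupport φ := by
      apply closure_minimal
      · intro z hz; exact subset_closure hz
      · exact (isClosed_tsupport φ).preimage (continuous_const.sub continuous_id)
    have := hx _ (h1 hy)
    simpa using this
  have hw' := hw χ hχs hχc hχt
  have hdχ : ∀ y, fderiv ℝ χ y (Pi.single i 1) = - fderiv ℝ φ (x - y) (Pi.single i 1) := by
    intro y
    have h1 : HasFDerivAt (fun y : Fin n → ℝ => x - y)
        (-(ContinuousLinearMap.id ℝ (Fin n → ℝ))) y :=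
      (hasFDerivAt_id y).const_sub x
    have h2 := ((hφ1.differentiable one_ne_zero (x - y)).hasFDerivAt).comp y h1
    have h3 : fderiv ℝ χ y = (fderiv ℝ φ (x - y)).comp (-(ContinuousLinearMap.id ℝ (Fin n → ℝ))) :=
      h2.fderiv
    rw [h3]; simp
  simp_rw [hdχ] at hw'
  have e1 : ∫ t, ((lsmul ℝ ℝ).precompL (Fin n → ℝ)) (fderiv ℝ φ t) (U.indicator f (x - t))
      (Pi.single i 1) = ∫ y in U, f y * fderiv ℝ φ (x - y) (Pi.single i 1) := by
    rw [← integral_indicator hU, ← integral_sub_left_eq_self _ volume x]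
    apply integral_congr_ae
    refine Eventually.of_forall fun t => ?_
    simp only [ContinuousLinearMap.precompL_apply, lsmul_apply, smul_eq_mul, sub_sub_cancel]
    by_cases ht : t ∈ U <;> simp [ht, mul_comm]
  have e2 : (φ ⋆[lsmul ℝ ℝ, volume] (U.indicator g)) x = ∫ y in U, g y * φ (x - y) := by
    rw [convolution_def, ← integral_indicator hU, ← integral_sub_left_eq_self _ volume x]
    apply integral_congr_ae
    refine Eventually.of_forall fun t => ?_
    simp only [lsmul_apply, smul_eq_mul, sub_sub_cancel]
    by_cases ht : t ∈ U <;> simp [ht, mul_comm]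
  rw [e1, e2]
  simp only [mul_neg, integral_neg, neg_inj] at hw'
  exact hw'

end Mollify
end AnisoDG

namespace AnisoDG

open Set MeasureTheory
open scoped ContDiff ENNReal

/-! ### Sobolev inequality for truncations on a time slice -/

section SliceSobolev

open Function Filter Topology ContinuousLinearMap
open scoped Convolution

/-- A `C¹` approximation of the positive part, `s ↦ s₊² / (s₊ + a)`. -/
noncomputable def softPos (a s : ℝ) : ℝ := s * (max s 0 / (max s 0 + a))

/-- The derivative of `softPos`. -/
noncomputable def softStep (a s : ℝ) : ℝ := 1 - (a / (max s 0 + a)) ^ 2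

theorem max_add_pos {a : ℝ} (ha : 0 < a) (s : ℝ) : 0 < max s 0 + a := by
  have := le_max_right s 0; linarith

theorem continuous_softPos {a : ℝ} (ha : 0 < a) : Continuous (softPos a) := by
  unfold softPos
  exact continuous_id.mul ((continuous_id.max continuous_const).div
    ((continuous_id.max continuous_const).add continuous_const) fun s => (max_add_pos ha s).ne')

theorem continuous_softStep {a : ℝ} (ha : 0 < a) : Continuous (softStep a) := by
  unfold softStep
  exact continuous_const.sub ((continuous_const.div
    ((continuous_id.max continuous_const).add continuous_const)
      fun s => (max_add_pos ha s).ne').pow 2)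

/-- Away from 0 this is calculus. At 0 the function is continuous and its derivative nearby has the
continuous limit `softStep`, which forces differentiability there. -/
theorem hasDerivAt_softPos {a : ℝ} (ha : 0 < a) (s : ℝ) :
    HasDerivAt (softPos a) (softStep a s) s := by
  have key : ∀ y ≠ (0 : ℝ), HasDerivAt (softPos a) (softStep a y) y := by
    intro y hy
    rcases lt_or_gt_of_ne hy with h | h
    · have : softStep a y = 0 := by simp [softStep, max_eq_right h.le, ha.ne']
      rw [this]
      refine (hasDerivAt_const y (0 : ℝ)).congr_of_eventuallyEq ?_
      filter_upwards [Iio_mem_nhds h] with z hz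
      have hz : z < 0 := hz
      simp [softPos, max_eq_right hz.le]
    · have h1 : HasDerivAt (fun z : ℝ => z * (z / (z + a)))
          (1 * (y / (y + a)) + y * ((1 * (y + a) - y * 1) / (y + a) ^ 2)) y := by
        apply (hasDerivAt_id y).mul
        exact (hasDerivAt_id y).div ((hasDerivAt_id y).add_const a) (by positivity)
      have h2 : softStep a y = 1 * (y / (y + a)) + y * ((1 * (y + a) - y * 1) / (y + a) ^ 2) := by
        simp only [softStep, max_eq_left h.le]
        have : y + a ≠ 0 := by positivity
        field_simp; ring
      rw [h2]
      refine h1.congr_of_eventuallyEq ?_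
      filter_upwards [Ioi_mem_nhds h] with z hz
      have hz : 0 < z := hz
      simp [softPos, max_eq_left hz.le]
  by_cases hs : s = 0
  · subst hs
    exact hasDerivAt_of_hasDerivAt_of_ne key (continuous_softPos ha).continuousAt
      (continuous_softStep ha).continuousAt
  · exact key s hs

theorem contDiff_softPos {a : ℝ} (ha : 0 < a) : ContDiff ℝ 1 (softPos a) := by
  rw [contDiff_one_iff_deriv]
  refine ⟨fun s => (hasDerivAt_softPos ha s).differentiableAt, ?_⟩
  rw [show deriv (softPos a) = softStep a from funext fun s => (hasDerivAt_softPos ha s).deriv]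
  exact continuous_softStep ha

theorem softPos_nonneg {a : ℝ} (ha : 0 < a) (s : ℝ) : 0 ≤ softPos a s := by
  rcases le_total s 0 with h | h
  · simp [softPos, max_eq_right h]
  · have := max_add_pos ha s
    unfold softPos; positivity

theorem softPos_le {a : ℝ} (ha : 0 < a) (s : ℝ) : softPos a s ≤ max s 0 := by
  rcases le_total s 0 with h | h
  · simp [softPos, max_eq_right h]
  · simp only [softPos, max_eq_left h]
    have : s / (s + a) ≤ 1 := by rw [div_le_one (by linarith)]; linarith
    nlinarith

/-- The smoothing costs only a factor 2 once the level is exceeded by the smoothing width. In the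
iteration that width is the gap between levels, so nothing is lost. -/
theorem half_le_softPos {a s : ℝ} (ha : 0 < a) (h : a ≤ s) : s / 2 ≤ softPos a s := by
  have h0 : 0 ≤ s := by linarith
  simp only [softPos, max_eq_left h0]
  have : 1 / 2 ≤ s / (s + a) := by rw [div_le_div_iff₀ (by norm_num) (by linarith)]; linarith
  nlinarith

theorem softStep_mem {a : ℝ} (ha : 0 < a) (s : ℝ) : softStep a s ∈ Icc (0 : ℝ) 1 := by
  have h1 := le_max_right s 0
  have h2 : 0 ≤ a / (max s 0 + a) := by have := max_add_pos ha s; positivity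
  have h3 : a / (max s 0 + a) ≤ 1 := by rw [div_le_one (max_add_pos ha s)]; linarith
  constructor
  · unfold softStep; nlinarith
  · unfold softStep; nlinarith

theorem softStep_of_nonpos {a s : ℝ} (ha : 0 < a) (h : s ≤ 0) : softStep a s = 0 := by
  simp [softStep, max_eq_right h, ha.ne']

/-- The product rule, with one factor F taken out of `softPos`. When the derivatives of η are
bounded, both terms are then a bounded coefficient times a power of F or of its derivative, the
shape that `eventually_lintegral_mul_le` can pass to the limit. -/
theorem enorm_fderiv_softPos_mul_rpow_le {n : ℕ} {a : ℝ} (ha : 0 < a) {F η : (Fin n → ℝ) → ℝ}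
    (hF : Differentiable ℝ F) (hη : Differentiable ℝ η) {p : ℝ} (hp : 1 ≤ p)
    (x v : Fin n → ℝ) :
    ‖fderiv ℝ (fun x => softPos a (F x) * η x) x v‖ₑ ^ p ≤
      2 ^ (p - 1) * (‖softStep a (F x) * η x‖ₑ ^ p * ‖fderiv ℝ F x v‖ₑ ^ p +
        ‖max (F x) 0 / (max (F x) 0 + a) * fderiv ℝ η x v‖ₑ ^ p * ‖F x‖ₑ ^ p) := by
  have h1 : HasFDerivAt (fun x => softPos a (F x)) (softStep a (F x) • fderiv ℝ F x) x :=
    (hasDerivAt_softPos ha (F x)).comp_hasFDerivAt x (hF x).hasFDerivAt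
  have h2 := (h1.mul (hη x).hasFDerivAt).fderiv
  have h3 : fderiv ℝ (fun x => softPos a (F x) * η x) x v =
      (softStep a (F x) * η x) * fderiv ℝ F x v +
      (max (F x) 0 / (max (F x) 0 + a) * fderiv ℝ η x v) * F x := by
    have : fderiv ℝ (fun x => softPos a (F x) * η x) x = _ := h2
    rw [this]
    simp only [add_apply, smul_apply, smul_eq_mul, softPos]
    ring
  have hp0 : 0 ≤ p := by linarith
  rw [h3, ← ENNReal.mul_rpow_of_nonneg _ _ hp0, ← ENNReal.mul_rpow_of_nonneg _ _ hp0,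
    ← enorm_mul, ← enorm_mul]
  refine (ENNReal.rpow_le_rpow (enorm_add_le _ _) hp0).trans ?_
  exact ENNReal.rpow_add_le_mul_rpow_add_rpow _ _ hp

theorem memLp_ofReal_of_lintegral {α : Type*} [MeasurableSpace α] {μ : Measure α} {f : α → ℝ}
    (hf : AEStronglyMeasurable f μ) {p : ℝ} (hp : 0 < p) (h : ∫⁻ x, ‖f x‖ₑ ^ p ∂μ ≠ ⊤) :
    MemLp f (ENNReal.ofReal p) μ := by
  refine ⟨hf, ?_⟩
  rw [eLpNorm_lt_top_iff_lintegral_rpow_enorm_lt_top (by simpa using hp) (by simp),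
    ENNReal.toReal_ofReal hp.le]
  exact h.lt_top

theorem integrable_indicator_of_lintegral_rpow {n : ℕ} {U : Set (Fin n → ℝ)}
    (hU : MeasurableSet U) (hUf : volume U ≠ ⊤) {f : (Fin n → ℝ) → ℝ} (hf : Measurable f)
    {p : ℝ} (hp : 1 ≤ p) (h : ∫⁻ x in U, ‖f x‖ₑ ^ p ≠ ⊤) :
    Integrable (U.indicator f) volume := by
  have : IsFiniteMeasure (volume.restrict U) := ⟨by simpa using hUf.lt_top⟩
  rw [integrable_indicator_iff hU]
  refine (memLp_ofReal_of_lintegral hf.aestronglyMeasurable (by linarith) h).integrable ?_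
  simpa using hp

/-- The anisotropic Sobolev inequality for a truncated, cut-off weakly differentiable function. -/
theorem slice_sobolev {n : ℕ} (hn : 2 ≤ n) {p : Fin n → ℝ} (hp : ∀ i, 1 < p i)
    (hσ : 1 < ∑ i, 1 / p i) :
    ∃ C : ℝ≥0∞, C ≠ ⊤ ∧ ∀ U : Set (Fin n → ℝ), IsOpen U → volume U ≠ ⊤ →
      ∀ (f : (Fin n → ℝ) → ℝ) (g : Fin n → (Fin n → ℝ) → ℝ), Measurable f →
      (∀ i, Measurable (g i)) → (∀ i, ∫⁻ x in U, ‖f x‖ₑ ^ p i ≠ ⊤) →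
      (∀ i, ∫⁻ x in U, ‖g i x‖ₑ ^ p i ≠ ⊤) →
      (∀ i, ∀ φ : (Fin n → ℝ) → ℝ, ContDiff ℝ ∞ φ → HasCompactSupport φ → tsupport φ ⊆ U →
        ∫ x in U, f x * fderiv ℝ φ x (Pi.single i 1) = - ∫ x in U, g i x * φ x) →
      ∀ η : (Fin n → ℝ) → ℝ, ContDiff ℝ ∞ η → HasCompactSupport η → tsupport η ⊆ U →
      (∀ x, η x ∈ Icc (0 : ℝ) 1) → ∀ a : ℝ, 0 < a →
      ∫⁻ x in U, ‖softPos a (f x) * η x‖ₑ ^ (n / (∑ i, 1 / p i - 1)) ≤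
        C * ∏ i, (∫⁻ x in U, ({y | 0 < f y}.indicator (fun y => ‖g i y‖ₑ ^ p i * ‖η y‖ₑ ^ p i) x +
          ‖max (f x) 0‖ₑ ^ p i * ‖fderiv ℝ η x (Pi.single i 1)‖ₑ ^ p i)) ^
          (1 / ((∑ i, 1 / p i - 1) * p i)) := by
  obtain ⟨K, hK, hT⟩ := troisi hn hp hσ
  set σ := ∑ i, 1 / p i with hσdef
  set s : ℝ := n / (σ - 1) with hs
  have hn0 : (0 : ℝ) < n := by exact_mod_cast (by omega : 0 < n)
  have hs0 : 0 < s := div_pos hn0 (by linarith)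
  set e : Fin n → ℝ := fun i => 1 / ((σ - 1) * p i) with he
  have hp0 : ∀ i, 0 < p i := fun i => by linarith [hp i]
  have he0 : ∀ i, 0 < e i := fun i => one_div_pos.2 (mul_pos (by linarith) (hp0 i))
  refine ⟨K * ∏ i, (2 ^ (p i - 1)) ^ e i, ?_, ?_⟩
  · refine ENNReal.mul_ne_top hK (ENNReal.prod_ne_top fun i _ => ?_)
    exact ENNReal.rpow_ne_top_of_nonneg (he0 i).le
      (ENNReal.rpow_ne_top_of_nonneg (by linarith [hp i]) (by simp))
  intro U hU hUf f g hf hg hfp hgp hw η hη hηc hηU hη01 a ha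
  have hUm := hU.measurableSet
  set F := U.indicator f with hF
  set G : Fin n → (Fin n → ℝ) → ℝ := fun i => U.indicator (g i) with hG
  have hFm : Measurable F := hf.indicator hUm
  have hGm : ∀ i, Measurable (G i) := fun i => (hg i).indicator hUm
  have hFi : Integrable F volume :=
    integrable_indicator_of_lintegral_rpow hUm hUf hf (hp ⟨0, by omega⟩).le (hfp _)
  have hGi : ∀ i, Integrable (G i) volume := fun i =>
    integrable_indicator_of_lintegral_rpow hUm hUf (hg i) (hp i).le (hgp i)
  have hind : ∀ (h : (Fin n → ℝ) → ℝ) (i : Fin n), ∫⁻ x, ‖U.indicator h x‖ₑ ^ p i =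
      ∫⁻ x in U, ‖h x‖ₑ ^ p i := by
    intro h i
    rw [← lintegral_indicator hUm]
    apply lintegral_congr; intro x
    by_cases hx : x ∈ U <;> simp [hx, hp0 i]
  have hFp : ∀ i, ∫⁻ x, ‖F x‖ₑ ^ p i ≠ ⊤ := fun i => by rw [hF, hind]; exact hfp i
  have hGp : ∀ i, ∫⁻ x, ‖G i x‖ₑ ^ p i ≠ ⊤ := fun i => by rw [hG, hind]; exact hgp i
  -- Mollifying at scale at most r around the support of η only uses values inside U, where the weak
  -- derivative is available.
  obtain ⟨r, hr, hrU⟩ := hηc.isCompact.exists_cthickening_subset_open hU hηU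
  let φ : ℕ → ContDiffBump (0 : Fin n → ℝ) := fun m =>
    { rIn := r / (m + 2) / 2
      rOut := r / (m + 2)
      rIn_pos := by positivity
      rIn_lt_rOut := by have : 0 < r / (m + 2) := by positivity
                        linarith }
  have hφ0 : Tendsto (fun m => (φ m).rOut) atTop (𝓝 0) := by
    have : Tendsto (fun m : ℕ => r / ((m : ℝ) + 2)) atTop (𝓝 0) :=
      Tendsto.div_atTop tendsto_const_nhds
        (tendsto_atTop_add_const_right _ _ tendsto_natCast_atTop_atTop)
    exact this
  -- Comparable inner and outer radii are what almost everywhere convergence of the mollifications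
  -- needs.
  have hφK : ∀ᶠ m in atTop, (φ m).rOut ≤ 2 * (φ m).rIn := by
    refine Eventually.of_forall fun m => ?_
    have : (φ m).rIn = (φ m).rOut / 2 := rfl
    rw [this]; linarith
  have hφr : ∀ m, (φ m).rOut ≤ r := by
    intro m
    have : (φ m).rOut = r / (m + 2) := rfl
    rw [this]
    apply div_le_self hr.le
    have : (0 : ℝ) ≤ m := Nat.cast_nonneg m
    linarith
  set Fm : ℕ → (Fin n → ℝ) → ℝ := fun m => (φ m).normed volume ⋆[lsmul ℝ ℝ, volume] F with hFmdef
  set Gm : Fin n → ℕ → (Fin n → ℝ) → ℝ := fun i m =>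
    (φ m).normed volume ⋆[lsmul ℝ ℝ, volume] (G i) with hGmdef
  have hsm : ∀ (h : (Fin n → ℝ) → ℝ), Integrable h volume → ∀ m,
      ContDiff ℝ 1 ((φ m).normed volume ⋆[lsmul ℝ ℝ, volume] h) := fun h hh m =>
    (φ m).hasCompactSupport_normed.contDiff_convolution_left _ (φ m).contDiff_normed
      hh.locallyIntegrable
  have hJ : ∀ (h : (Fin n → ℝ) → ℝ), Measurable h → ∀ m i,
      ∫⁻ x, ‖((φ m).normed volume ⋆[lsmul ℝ ℝ, volume] h) x‖ₑ ^ p i ≤ ∫⁻ x, ‖h x‖ₑ ^ p i := by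
    intro h hh m i
    refine lintegral_enorm_convolution_rpow_le
      ((φ m).contDiff_normed (n := 0)).continuous.measurable ?_ hh (hp i).le
    have h1 := (φ m).integral_normed (μ := volume)
    have h2 := ofReal_integral_eq_lintegral_ofReal (φ m).integrable_normed
      (Eventually.of_forall fun x => (φ m).nonneg_normed (μ := volume) x)
    rw [h1, ENNReal.ofReal_one] at h2
    rw [h2]
    apply lintegral_congr; intro x
    exact Real.enorm_of_nonneg ((φ m).nonneg_normed x)
  have hae : ∀ (h : (Fin n → ℝ) → ℝ), Integrable h volume → ∀ᵐ x,
      Tendsto (fun m => ((φ m).normed volume ⋆[lsmul ℝ ℝ, volume] h) x) atTop (𝓝 (h x)) :=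
    fun h hh => ContDiffBump.ae_convolution_tendsto_right_of_locallyIntegrable hφ0 hφK
      hh.locallyIntegrable
  have hη1 : ContDiff ℝ 1 η := hη.of_le (by exact_mod_cast le_top)
  set V : ℕ → (Fin n → ℝ) → ℝ := fun m x => softPos a (Fm m x) * η x with hV
  have hVc1 : ∀ m, ContDiff ℝ 1 (V m) := fun m =>
    ((contDiff_softPos ha).comp (hsm F hFi m)).mul hη1
  have hVcs : ∀ m, HasCompactSupport (V m) := fun m => hηc.mul_left
  have hdη : ∀ i : Fin n, Continuous fun x => fderiv ℝ η x (Pi.single i 1) := fun i =>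
    (hη1.continuous_fderiv one_ne_zero).clm_apply continuous_const
  have hfd : ∀ i m x, x ∈ tsupport η → fderiv ℝ (Fm m) x (Pi.single i 1) = Gm i m x := by
    intro i m x hx
    refine fderiv_convolution_of_weak hUm i hFi.locallyIntegrable (hw i) (φ m).contDiff_normed
      (φ m).hasCompactSupport_normed ?_
    intro y hy
    rw [ContDiffBump.tsupport_normed_eq, mem_closedBall_zero_iff] at hy
    apply hrU
    refine Metric.mem_cthickening_of_dist_le _ x _ _ hx ?_
    rw [dist_eq_norm]
    simpa using hy.trans (hφr m)
  set A : Fin n → ℕ → (Fin n → ℝ) → ℝ≥0∞ := fun i m x => ‖softStep a (Fm m x) * η x‖ₑ ^ p i with hA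
  set A' : Fin n → (Fin n → ℝ) → ℝ≥0∞ := fun i x => ‖softStep a (F x) * η x‖ₑ ^ p i with hA'
  set D : Fin n → ℕ → (Fin n → ℝ) → ℝ≥0∞ := fun i m x => ‖max (Fm m x) 0 / (max (Fm m x) 0 + a) *
    fderiv ℝ η x (Pi.single i 1)‖ₑ ^ p i with hD
  set D' : Fin n → (Fin n → ℝ) → ℝ≥0∞ := fun i x => ‖max (F x) 0 / (max (F x) 0 + a) *
    fderiv ℝ η x (Pi.single i 1)‖ₑ ^ p i with hD'
  have hgrad : ∀ i m x, ‖fderiv ℝ (V m) x (Pi.single i 1)‖ₑ ^ p i ≤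
      2 ^ (p i - 1) * (A i m x * ‖Gm i m x‖ₑ ^ p i + D i m x * ‖Fm m x‖ₑ ^ p i) := by
    intro i m x
    have h := enorm_fderiv_softPos_mul_rpow_le ha ((hsm F hFi m).differentiable one_ne_zero)
      (hη1.differentiable one_ne_zero) (hp i).le x (Pi.single i 1)
    refine h.trans (le_of_eq ?_)
    -- Off the support of η the derivative of the mollification is not identified, but its
    -- coefficient vanishes.
    by_cases hx : x ∈ tsupport η
    · have := hfd i m x hx
      simp only [hFmdef] at this
      rw [this]
    · have : η x = 0 := image_eq_zero_of_notMem_tsupport hx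
      simp [hA, this, hp0 i, hD, hFmdef]
  have hκ : ∀ t : ℝ, max t 0 / (max t 0 + a) ∈ Icc (0 : ℝ) 1 := fun t =>
    ⟨div_nonneg (le_max_right _ _) (max_add_pos ha t).le,
      (div_le_one (max_add_pos ha t)).2 (by linarith)⟩
  have hκc : Continuous fun t : ℝ => max t 0 / (max t 0 + a) :=
    (continuous_id.max continuous_const).div
      ((continuous_id.max continuous_const).add continuous_const) fun t => (max_add_pos ha t).ne'
  have hpow : ∀ (i : Fin n) (c M : ℝ), |c| ≤ M → ‖c‖ₑ ^ p i ≤ ENNReal.ofReal M ^ p i := by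
    intro i c M hc
    refine ENNReal.rpow_le_rpow ?_ (hp0 i).le
    rw [Real.enorm_eq_ofReal_abs]
    exact ENNReal.ofReal_le_ofReal hc
  have habs : ∀ t x, |softStep a t * η x| ≤ 1 := by
    intro t x
    have h1 := softStep_mem ha t
    have h2 := hη01 x
    rw [abs_of_nonneg (mul_nonneg h1.1 h2.1)]
    exact mul_le_one₀ h1.2 h2.1 h2.2
  have hbd : ∀ i, ∃ M : ℝ, ∀ x, |fderiv ℝ η x (Pi.single i 1)| ≤ M := by
    intro i
    obtain ⟨M, hM⟩ := (hdη i).bounded_above_of_compact_support (hηc.fderiv_apply (𝕜 := ℝ) _)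
    exact ⟨M, hM⟩
  choose M hM using hbd
  have habs' : ∀ i t x, |max t 0 / (max t 0 + a) * fderiv ℝ η x (Pi.single i 1)| ≤ M i := by
    intro i t x
    rw [abs_mul, abs_of_nonneg (hκ t).1]
    calc _ ≤ 1 * |fderiv ℝ η x (Pi.single i 1)| := by gcongr; exact (hκ t).2
      _ ≤ M i := by rw [one_mul]; exact hM i x
  have hFmc : ∀ m, Continuous (Fm m) := fun m => (hsm F hFi m).continuous
  have hGmc : ∀ i m, Continuous (Gm i m) := fun i m => (hsm (G i) (hGi i) m).continuous
  have hAm : ∀ i m, Measurable (A i m) := fun i m =>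
    ((((continuous_softStep ha).comp (hFmc m)).mul hη1.continuous).measurable.enorm).pow_const _
  have hA'm : ∀ i, Measurable (A' i) := fun i =>
    ((((continuous_softStep ha).measurable.comp hFm).mul
      hη1.continuous.measurable).enorm).pow_const _
  have hDm : ∀ i m, Measurable (D i m) := fun i m =>
    (((hκc.comp (hFmc m)).mul (hdη i)).measurable.enorm).pow_const _
  have hD'm : ∀ i, Measurable (D' i) := fun i =>
    (((hκc.measurable.comp hFm).mul (hdη i).measurable).enorm).pow_const _
  have hlimA : ∀ i, ∀ᵐ x, Tendsto (fun m => A i m x) atTop (𝓝 (A' i x)) := by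
    intro i
    filter_upwards [hae F hFi] with x hx
    apply (ENNReal.continuous_rpow_const.tendsto _).comp
    apply (continuous_enorm.tendsto _).comp
    exact (((continuous_softStep ha).tendsto _).comp hx).mul tendsto_const_nhds
  have hlimD : ∀ i, ∀ᵐ x, Tendsto (fun m => D i m x) atTop (𝓝 (D' i x)) := by
    intro i
    filter_upwards [hae F hFi] with x hx
    apply (ENNReal.continuous_rpow_const.tendsto _).comp
    apply (continuous_enorm.tendsto _).comp
    exact ((hκc.tendsto _).comp hx).mul tendsto_const_nhds
  have hlimp : ∀ (h : (Fin n → ℝ) → ℝ), Integrable h volume → ∀ i, ∀ᵐ x,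
      Tendsto (fun m => ‖((φ m).normed volume ⋆[lsmul ℝ ℝ, volume] h) x‖ₑ ^ p i) atTop
        (𝓝 (‖h x‖ₑ ^ p i)) := by
    intro h hh i
    filter_upwards [hae h hh] with x hx
    apply (ENNReal.continuous_rpow_const.tendsto _).comp
    exact (continuous_enorm.tendsto _).comp hx
  set S : Fin n → ℝ≥0∞ := fun i => ∫⁻ x in U,
    ({y | 0 < f y}.indicator (fun y => ‖g i y‖ₑ ^ p i * ‖η y‖ₑ ^ p i) x +
      ‖max (f x) 0‖ₑ ^ p i * ‖fderiv ℝ η x (Pi.single i 1)‖ₑ ^ p i) with hS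
  -- The gradient term is confined to {f > 0} because `softStep` vanishes at nonpositive arguments;
  -- no chain rule for the positive part is needed.
  have hSle : ∀ i, (∫⁻ x, A' i x * ‖G i x‖ₑ ^ p i) + (∫⁻ x, D' i x * ‖F x‖ₑ ^ p i) ≤ S i := by
    intro i
    rw [← lintegral_add_left (f := fun x => A' i x * ‖G i x‖ₑ ^ p i)
      ((hA'm i).mul ((hGm i).enorm.pow_const _)), hS]
    simp only
    rw [← lintegral_indicator hUm]
    apply lintegral_mono; intro x
    by_cases hx : x ∈ U
    · simp only [indicator_of_mem hx, hA', hD', hG, hF]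
      gcongr ?_ + ?_
      · by_cases h0 : 0 < f x
        · rw [indicator_of_mem (show x ∈ {y | 0 < f y} from h0), mul_comm]
          gcongr
          · exact (hp0 i).le
          rw [enorm_mul]
          calc _ ≤ 1 * ‖η x‖ₑ := by
                gcongr
                rw [Real.enorm_of_nonneg (softStep_mem ha _).1]
                simpa using (softStep_mem ha (f x)).2
            _ = _ := one_mul _
        · rw [softStep_of_nonpos ha (not_lt.1 h0)]
          simp [hp0 i]
      · rw [← ENNReal.mul_rpow_of_nonneg _ _ (hp0 i).le, ← ENNReal.mul_rpow_of_nonneg _ _ (hp0 i).le,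
          ← enorm_mul, ← enorm_mul]
        refine ENNReal.rpow_le_rpow ?_ (hp0 i).le
        rw [show max (f x) 0 / (max (f x) 0 + a) * (fderiv ℝ η x) (Pi.single i 1) * f x =
          softPos a (f x) * (fderiv ℝ η x) (Pi.single i 1) by simp only [softPos]; ring,
          enorm_mul, enorm_mul]
        gcongr
        rw [Real.enorm_of_nonneg (softPos_nonneg ha _), Real.enorm_of_nonneg (le_max_right _ _)]
        exact ENNReal.ofReal_le_ofReal (softPos_le ha _)
    · simp [hx, hG, hF, hp0 i]
  have hSfin : ∀ i, S i ≠ ⊤ := by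
    intro i
    have : S i ≤ ∫⁻ x in U, (‖g i x‖ₑ ^ p i + ‖f x‖ₑ ^ p i * ENNReal.ofReal (M i) ^ p i) := by
      apply lintegral_mono; intro x
      simp only
      gcongr ?_ + ?_ * ?_
      · by_cases h0 : x ∈ {y | 0 < f y}
        · rw [indicator_of_mem h0]
          calc _ ≤ ‖g i x‖ₑ ^ p i * 1 := by
                gcongr
                have := hpow i (η x) 1 (by rw [abs_of_nonneg (hη01 x).1]; exact (hη01 x).2)
                simpa using this
            _ = _ := mul_one _
        · rw [indicator_of_notMem h0]; exact zero_le
      · refine ENNReal.rpow_le_rpow ?_ (hp0 i).le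
        rw [Real.enorm_eq_ofReal_abs, Real.enorm_eq_ofReal_abs]
        apply ENNReal.ofReal_le_ofReal
        rw [abs_of_nonneg (le_max_right _ _)]
        exact max_le (le_abs_self _) (abs_nonneg _)
      · exact hpow i _ _ (hM i x)
    refine ne_top_of_le_ne_top ?_ this
    rw [lintegral_add_left ((hg i).enorm.pow_const _), lintegral_mul_const _ (hf.enorm.pow_const _)]
    exact ENNReal.add_ne_top.2 ⟨hgp i, ENNReal.mul_ne_top (hfp i)
      (ENNReal.rpow_ne_top_of_nonneg (hp0 i).le (by simp))⟩
  have hev : ∀ ε : ℝ≥0∞, ε ≠ 0 → ∀ᶠ m in atTop,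
      ∫⁻ x, ‖V m x‖ₑ ^ s ≤ K * ∏ i, (2 ^ (p i - 1) * (S i + 2 * ε)) ^ e i := by
    intro ε hε
    have h1 : ∀ᶠ m in atTop, ∀ i, ∫⁻ x, A i m x * ‖Gm i m x‖ₑ ^ p i ≤
        (∫⁻ x, A' i x * ‖G i x‖ₑ ^ p i) + ε := by
      rw [eventually_all]; intro i
      refine eventually_lintegral_mul_le (M := ENNReal.ofReal 1 ^ p i) (by simp) (hAm i)
        (fun m => (hGmc i m).measurable.enorm.pow_const _) (hA'm i) ((hGm i).enorm.pow_const _)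
        (fun m x => hpow i _ _ (habs _ _)) (fun x => hpow i _ _ (habs _ _)) (hlimA i)
        (hlimp (G i) (hGi i) i) (fun m => hJ (G i) (hGm i) m i) (hGp i) hε
    have h2 : ∀ᶠ m in atTop, ∀ i, ∫⁻ x, D i m x * ‖Fm m x‖ₑ ^ p i ≤
        (∫⁻ x, D' i x * ‖F x‖ₑ ^ p i) + ε := by
      rw [eventually_all]; intro i
      refine eventually_lintegral_mul_le (M := ENNReal.ofReal (M i) ^ p i)
        (ENNReal.rpow_ne_top_of_nonneg (hp0 i).le (by simp)) (hDm i)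
        (fun m => (hFmc m).measurable.enorm.pow_const _) (hD'm i) (hFm.enorm.pow_const _)
        (fun m x => hpow i _ _ (habs' _ _ _)) (fun x => hpow i _ _ (habs' _ _ _)) (hlimD i)
        (hlimp F hFi i) (fun m => hJ F hFm m i) (hFp i) hε
    filter_upwards [h1, h2] with m h1 h2
    refine (hT (V m) (hVc1 m) (hVcs m)).trans ?_
    gcongr with i _
    · exact (he0 i).le
    calc ∫⁻ x, ‖fderiv ℝ (V m) x (Pi.single i 1)‖ₑ ^ p i
        ≤ ∫⁻ x, 2 ^ (p i - 1) * (A i m x * ‖Gm i m x‖ₑ ^ p i + D i m x * ‖Fm m x‖ₑ ^ p i) :=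
          lintegral_mono (hgrad i m)
      _ = 2 ^ (p i - 1) * ((∫⁻ x, A i m x * ‖Gm i m x‖ₑ ^ p i) +
            (∫⁻ x, D i m x * ‖Fm m x‖ₑ ^ p i)) := by
          rw [lintegral_const_mul', lintegral_add_left (f := fun x => A i m x * ‖Gm i m x‖ₑ ^ p i)]
          · exact (hAm i m).mul ((hGmc i m).measurable.enorm.pow_const _)
          · exact ENNReal.rpow_ne_top_of_nonneg (by linarith [hp i]) (by simp)
      _ ≤ 2 ^ (p i - 1) * (((∫⁻ x, A' i x * ‖G i x‖ₑ ^ p i) + ε) +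
            ((∫⁻ x, D' i x * ‖F x‖ₑ ^ p i) + ε)) := by
          gcongr
          · exact h1 i
          · exact h2 i
      _ = 2 ^ (p i - 1) * (((∫⁻ x, A' i x * ‖G i x‖ₑ ^ p i) + (∫⁻ x, D' i x * ‖F x‖ₑ ^ p i))
            + 2 * ε) := by ring
      _ ≤ _ := by gcongr; exact hSle i
  have hLHS : ∫⁻ x in U, ‖softPos a (f x) * η x‖ₑ ^ s ≤
      liminf (fun m => ∫⁻ x, ‖V m x‖ₑ ^ s) atTop := by
    calc ∫⁻ x in U, ‖softPos a (f x) * η x‖ₑ ^ s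
        ≤ ∫⁻ x, ‖softPos a (F x) * η x‖ₑ ^ s := by
          rw [← lintegral_indicator hUm]
          apply lintegral_mono; intro x
          by_cases hx : x ∈ U <;> simp [hx, hF]
      _ ≤ ∫⁻ x, liminf (fun m => ‖V m x‖ₑ ^ s) atTop := by
          apply lintegral_mono_ae
          filter_upwards [hae F hFi] with x hx
          apply le_of_eq; symm
          apply Tendsto.liminf_eq
          apply (ENNReal.continuous_rpow_const.tendsto _).comp
          apply (continuous_enorm.tendsto _).comp
          exact (((continuous_softPos ha).tendsto _).comp hx).mul tendsto_const_nhds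
      _ ≤ _ := lintegral_liminf_le fun m => ((hVc1 m).continuous.measurable.enorm).pow_const _
  have hε : ∀ ε : ℝ≥0∞, ε ≠ 0 → ∫⁻ x in U, ‖softPos a (f x) * η x‖ₑ ^ s ≤
      K * ∏ i, (2 ^ (p i - 1) * (S i + 2 * ε)) ^ e i := by
    intro ε h0
    refine hLHS.trans ((liminf_le_liminf (hev ε h0)).trans ?_)
    simp
  have hlim : Tendsto (fun ε : ℝ≥0∞ => K * ∏ i, (2 ^ (p i - 1) * (S i + 2 * ε)) ^ e i) (𝓝[>] 0)
      (𝓝 (K * ∏ i, (2 ^ (p i - 1) * (S i + 2 * 0)) ^ e i)) := by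
    apply Tendsto.mono_left _ nhdsWithin_le_nhds
    apply ENNReal.Tendsto.const_mul _ (Or.inr hK)
    have h2p : ∀ i, (2 : ℝ≥0∞) ^ (p i - 1) ≠ ⊤ := fun i =>
      ENNReal.rpow_ne_top_of_nonneg (by linarith [hp i]) (by simp)
    apply ENNReal.tendsto_finsetProd_of_ne_top
    · intro i _
      apply (ENNReal.continuous_rpow_const.tendsto _).comp
      apply ENNReal.Tendsto.const_mul _ (Or.inr (h2p i))
      apply tendsto_const_nhds.add
      exact ENNReal.Tendsto.const_mul tendsto_id (Or.inr (by simp))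
    · intro i _
      exact ENNReal.rpow_ne_top_of_nonneg (he0 i).le
        (ENNReal.mul_ne_top (h2p i) (by simpa using hSfin i))
  have hfinal := ge_of_tendsto hlim (by
    filter_upwards [self_mem_nhdsWithin] with ε h0
    exact hε ε (ne_of_gt h0))
  refine hfinal.trans (le_of_eq ?_)
  rw [mul_assoc, ← Finset.prod_mul_distrib]
  congr 1
  apply Finset.prod_congr rfl; intro i _
  rw [mul_zero, add_zero, ENNReal.mul_rpow_of_nonneg _ _ (he0 i).le]

end SliceSobolev
end AnisoDG

namespace AnisoDG

open Set MeasureTheory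
open scoped ContDiff ENNReal

/-! ### Cut-off functions with scaled derivative bounds -/

section Cutoff

open Function Filter Topology

/-- Since exp(-1/x)^p = exp(-p/x), a real power of this function is only a rescaling and stays
smooth at 0. Cut-offs built from it therefore have smooth pᵢ-th powers for every real pᵢ > 0. -/
theorem expNegInvGlue_rpow {p : ℝ} (hp : 0 < p) (x : ℝ) :
    expNegInvGlue x ^ p = expNegInvGlue (x / p) := by
  rcases le_or_gt x 0 with h | h
  · rw [expNegInvGlue.zero_of_nonpos h,
      expNegInvGlue.zero_of_nonpos (div_nonpos_of_nonpos_of_nonneg h hp.le),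
      Real.zero_rpow hp.ne']
  · have h' : 0 < x / p := by positivity
    rw [expNegInvGlue, expNegInvGlue, if_neg h.not_ge, if_neg h'.not_ge, ← Real.exp_mul]
    congr 1
    field_simp

theorem contDiff_smoothTransition_rpow {p : ℝ} (hp : 0 < p) :
    ContDiff ℝ ∞ fun x => Real.smoothTransition x ^ p := by
  have h : (fun x => Real.smoothTransition x ^ p) = fun x => expNegInvGlue (x / p) /
      (expNegInvGlue x + expNegInvGlue (1 - x)) ^ p := by
    funext x
    rw [Real.smoothTransition, Real.div_rpow (expNegInvGlue.nonneg x)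
      (Real.smoothTransition.pos_denom x).le, expNegInvGlue_rpow hp]
  rw [h]
  refine ContDiff.div ?_ ?_ fun x => (Real.rpow_pos_of_pos (Real.smoothTransition.pos_denom x) p).ne'
  · exact expNegInvGlue.contDiff.comp (contDiff_id.div_const p)
  · exact (expNegInvGlue.contDiff.add
      (expNegInvGlue.contDiff.comp (contDiff_const.sub contDiff_id))).rpow_const_of_ne
      fun x => (Real.smoothTransition.pos_denom x).ne'

theorem exists_deriv_smoothTransition_bound :
    ∃ L : ℝ, 1 ≤ L ∧ ∀ x, |deriv Real.smoothTransition x| ≤ L := by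
  have hc : Continuous (deriv Real.smoothTransition) :=
    (Real.smoothTransition.contDiff (n := 1)).continuous_deriv le_rfl
  have hs : HasCompactSupport (deriv Real.smoothTransition) := by
    refine HasCompactSupport.of_support_subset_isCompact (isCompact_Icc (a := (0 : ℝ)) (b := 1)) ?_
    intro x hx
    by_contra h
    apply hx
    simp only [mem_Icc, not_and_or, not_le] at h
    rcases h with h | h
    · have : Real.smoothTransition =ᶠ[𝓝 x] fun _ => 0 := by
        filter_upwards [Iio_mem_nhds h] with y hy
        exact Real.smoothTransition.zero_of_nonpos (le_of_lt hy)
      rw [this.deriv_eq]; simp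
    · have : Real.smoothTransition =ᶠ[𝓝 x] fun _ => 1 := by
        filter_upwards [Ioi_mem_nhds h] with y hy
        exact Real.smoothTransition.one_of_one_le (le_of_lt hy)
      rw [this.deriv_eq]; simp
  obtain ⟨M, hM⟩ := hc.bounded_above_of_compact_support hs
  exact ⟨max M 1, le_max_right _ _, fun x => (hM x).trans (le_max_left _ _)⟩

/-- A smooth bump on the line with a smooth `p`-th power. -/
theorem exists_profile : ∃ L : ℝ, 1 ≤ L ∧ ∀ p c α β : ℝ, 0 < p → α < β →
    ∃ η : ℝ → ℝ, ContDiff ℝ ∞ η ∧ ContDiff ℝ ∞ (fun s => η s ^ p) ∧ HasCompactSupport η ∧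
      (∀ s, η s ∈ Icc (0 : ℝ) 1) ∧ tsupport η ⊆ Ioo (c - β) (c + β) ∧
      (∀ s ∈ Ioo (c - α) (c + α), η s = 1) ∧ ∀ s, |deriv η s| ≤ L / (β - α) := by
  obtain ⟨L, hL1, hL⟩ := exists_deriv_smoothTransition_bound
  refine ⟨4 * L, by linarith, ?_⟩
  intro p c α β hp hαβ
  -- The descent takes place between α and the midpoint m, which keeps the closed support inside the
  -- open interval of half-length β.
  set w := (β - α) / 2 with hw
  have hw0 : 0 < w := by rw [hw]; linarith
  set m := (α + β) / 2 with hm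
  set A : ℝ → ℝ := fun s => (s - (c - m)) / w with hA
  set B : ℝ → ℝ := fun s => ((c + m) - s) / w with hB
  have hAc : ContDiff ℝ ∞ A := (contDiff_id.sub contDiff_const).div_const w
  have hBc : ContDiff ℝ ∞ B := (contDiff_const.sub contDiff_id).div_const w
  set η : ℝ → ℝ := fun s => Real.smoothTransition (A s) * Real.smoothTransition (B s) with hη
  have hsupp : tsupport η ⊆ Icc (c - m) (c + m) := by
    apply closure_minimal _ isClosed_Icc
    intro s hs
    by_contra h
    apply hs
    simp only [mem_Icc, not_and_or, not_le] at h
    rcases h with h | h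
    · simp only [hη]
      rw [Real.smoothTransition.zero_of_nonpos (x := A s), zero_mul]
      exact div_nonpos_of_nonpos_of_nonneg (by linarith) hw0.le
    · simp only [hη]
      rw [Real.smoothTransition.zero_of_nonpos (x := B s), mul_zero]
      exact div_nonpos_of_nonpos_of_nonneg (by linarith) hw0.le
  refine ⟨η, ?_, ?_, ?_, ?_, ?_, ?_, ?_⟩
  · exact (Real.smoothTransition.contDiff.comp hAc).mul (Real.smoothTransition.contDiff.comp hBc)
  · have : (fun s => η s ^ p) = fun s => Real.smoothTransition (A s) ^ p *
        Real.smoothTransition (B s) ^ p := by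
      funext s
      exact Real.mul_rpow (Real.smoothTransition.nonneg _) (Real.smoothTransition.nonneg _)
    rw [this]
    exact ((contDiff_smoothTransition_rpow hp).comp hAc).mul
      ((contDiff_smoothTransition_rpow hp).comp hBc)
  · exact HasCompactSupport.of_support_subset_isCompact isCompact_Icc
      ((subset_tsupport _).trans hsupp)
  · intro s
    exact ⟨mul_nonneg (Real.smoothTransition.nonneg _) (Real.smoothTransition.nonneg _),
      mul_le_one₀ (Real.smoothTransition.le_one _) (Real.smoothTransition.nonneg _)
        (Real.smoothTransition.le_one _)⟩
  · refine hsupp.trans ?_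
    intro s hs
    constructor
    · have := hs.1; linarith
    · have := hs.2; linarith
  · intro s hs
    have h1 := hs.1
    have h2 := hs.2
    simp only [hη]
    rw [Real.smoothTransition.one_of_one_le, Real.smoothTransition.one_of_one_le, one_mul]
    · rw [hB]; simp only; rw [le_div_iff₀ hw0]; linarith
    · rw [hA]; simp only; rw [le_div_iff₀ hw0]; linarith
  · intro s
    have hd : ∀ x, HasDerivAt Real.smoothTransition (deriv Real.smoothTransition x) x := fun x =>
      ((Real.smoothTransition.contDiff (n := 1)).differentiable one_ne_zero x).hasDerivAt
    have hA' : HasDerivAt A (1 / w) s := ((hasDerivAt_id s).sub_const _).div_const w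
    have hB' : HasDerivAt B (-1 / w) s := ((hasDerivAt_id s).const_sub _).div_const w
    have h := ((hd (A s)).comp s hA').mul ((hd (B s)).comp s hB')
    have h' : deriv η s = _ := h.deriv
    rw [h']
    have e1 : ∀ x y σ : ℝ, |σ| = 1 → |deriv Real.smoothTransition x * (σ / w) *
        Real.smoothTransition y| ≤ L / w := by
      intro x y σ hσ
      rw [abs_mul, abs_mul, abs_div, hσ, abs_of_pos hw0,
        abs_of_nonneg (Real.smoothTransition.nonneg y)]
      calc _ ≤ L * (1 / w) * 1 := by
            gcongr
            · exact Real.smoothTransition.nonneg y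
            · exact hL x
            · exact Real.smoothTransition.le_one y
        _ = L / w := by ring
    calc _ ≤ L / w + L / w := by
          refine (abs_add_le _ _).trans (add_le_add ?_ ?_)
          · exact e1 _ _ 1 (by simp)
          · rw [mul_comm]; exact e1 _ _ (-1) (by simp)
      _ = 4 * L / (β - α) := by
          rw [hw]; have : β - α ≠ 0 := by linarith
          field_simp; ring

/-- Lower bound for the difference of two powers with exponent `1 / p`. -/
theorem div_rpow_sub_rpow_le {p ρ r R M : ℝ} (hp : 1 < p) (hρ : 0 < ρ) (hr : ρ ≤ r) (hR : r < R)
    (hR2 : R ≤ 2 * ρ) (hM : 0 ≤ M) :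
    (M / (R ^ (1 / p) - r ^ (1 / p))) ^ p ≤ (2 * p * M) ^ p * ((R - r) / ρ) ^ (-p) / ρ := by
  have hp0 : 0 < p := by linarith
  have hR0 : 0 < R := by linarith
  have hr0 : 0 < r := by linarith
  set x := R ^ (1 / p) with hx
  set y := r ^ (1 / p) with hy
  have hx0 : 0 < x := Real.rpow_pos_of_pos hR0 _
  have hy0 : 0 < y := Real.rpow_pos_of_pos hr0 _
  have hyx : y < x := Real.rpow_lt_rpow hr0.le hR (by positivity)
  have hxp : x ^ p = R := by rw [hx, ← Real.rpow_mul hR0.le, one_div_mul_cancel hp0.ne', Real.rpow_one]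
  have hyp : y ^ p = r := by rw [hy, ← Real.rpow_mul hr0.le, one_div_mul_cancel hp0.ne', Real.rpow_one]
  -- Bernoulli's inequality for (y / x) ^ p = r / R, with x and y the p-th roots of R and r.
  have hB : R - r ≤ p * R * ((x - y) / x) := by
    have h1 := one_add_mul_self_le_rpow_one_add (s := (y - x) / x) (p := p)
      (by rw [le_div_iff₀ hx0]; linarith) hp.le
    have h2 : (1 + (y - x) / x) ^ p = r / R := by
      rw [← hxp, ← hyp, ← Real.div_rpow hy0.le hx0.le]
      congr 1; field_simp; ring
    rw [h2, le_div_iff₀ hR0] at h1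
    have : (x - y) / x = - ((y - x) / x) := by ring
    rw [this]; linarith
  have hd : 0 < x - y := by linarith
  have h3 : 1 / (x - y) ≤ p * R / ((R - r) * x) := by
    have hRr : 0 < R - r := by linarith
    rw [div_le_div_iff₀ hd (by positivity)]
    have : p * R * ((x - y) / x) * x = p * R * (x - y) := by field_simp
    nlinarith
  have hRr : 0 < R - r := by linarith
  calc (M / (x - y)) ^ p = (M * (1 / (x - y))) ^ p := by rw [mul_one_div]
    _ ≤ (M * (p * R / ((R - r) * x))) ^ p := by
        apply Real.rpow_le_rpow (by positivity) _ hp0.le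
        gcongr
    _ = (p * M) ^ p * (R / (R - r)) ^ p / R := by
        rw [show M * (p * R / ((R - r) * x)) = (p * M) * (R / (R - r)) / x by field_simp,
          Real.div_rpow (by positivity) hx0.le, hxp, Real.mul_rpow (by positivity) (by positivity)]
    _ ≤ (p * M) ^ p * (2 * ρ / (R - r)) ^ p / ρ := by
        gcongr
        linarith
    _ = _ := by
        rw [show 2 * ρ / (R - r) = 2 * ((R - r) / ρ)⁻¹ by field_simp, Real.mul_rpow (x := 2) (y := ((R - r) / ρ)⁻¹)
          (by norm_num) (by positivity), Real.inv_rpow (by positivity), ← Real.rpow_neg (by positivity),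
          show 2 * p * M = 2 * (p * M) by ring, Real.mul_rpow (x := 2) (y := p * M)
          (by norm_num) (by positivity)]
        ring

/-- As θ ≤ 1, the largest exponent dominates. One number then bounds the time derivative and the
pᵢ-th powers of all spatial derivatives. -/
theorem scaled_bound_le {p Pb θ ρ a L : ℝ} (hpP : p ≤ Pb) (hθ : 0 < θ) (hθ1 : θ ≤ 1) (hρ : 0 < ρ)
    (ha : 0 ≤ a) (haL : a ≤ L) : a * θ ^ (-p) / ρ ≤ L * θ ^ (-Pb) / ρ := by
  have : θ ^ (-p) ≤ θ ^ (-Pb) := Real.rpow_le_rpow_of_exponent_ge hθ hθ1 (by linarith)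
  have h2 : 0 ≤ θ ^ (-p) := Real.rpow_nonneg hθ.le _
  have h3 : 0 ≤ L := ha.trans haL
  gcongr

/-- Cut-off functions between two cylinders, with bounds on their derivatives. -/
theorem exists_cutoff {n : ℕ} {p : Fin n → ℝ} (hp : ∀ i, 1 < p i) {Pb : ℝ} (hPb : ∀ i, p i ≤ Pb)
    (hPb1 : 1 ≤ Pb) : ∃ L : ℝ, 1 ≤ L ∧ ∀ (x₀ : Fin n → ℝ) (t₀ ρ r R : ℝ), 0 < ρ → ρ ≤ r → r < R →
      R ≤ 2 * ρ → ∃ ζ : (Fin n → ℝ) × ℝ → ℝ, IsCutoff p x₀ t₀ R ζ ∧ (∀ z, ζ z ∈ Icc (0 : ℝ) 1) ∧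
        (∀ z ∈ cyl p x₀ t₀ r, ζ z = 1) ∧
        (∀ t, HasCompactSupport (fun x => ζ (x, t)) ∧
          tsupport (fun x => ζ (x, t)) ⊆ box p x₀ R) ∧
        (∀ z : (Fin n → ℝ) × ℝ, deriv (fun s => ζ (z.1, s)) z.2 ≤ L * ((R - r) / ρ) ^ (-Pb) / ρ) ∧
        (∀ i, ∀ z : (Fin n → ℝ) × ℝ, |deriv (fun s => ζ (update z.1 i s, z.2) ^ (1 / p i)) (z.1 i)| ^ p i ≤
          L * ((R - r) / ρ) ^ (-Pb) / ρ) ∧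
        (∀ i t x, |fderiv ℝ (fun x => ζ (x, t)) x (Pi.single i 1)| ^ p i ≤
          L * ((R - r) / ρ) ^ (-Pb) / ρ) := by
  obtain ⟨L₁, hL₁, hprof⟩ := exists_profile
  obtain ⟨L₂, hL₂, hst⟩ := exists_deriv_smoothTransition_bound
  have hp0 : ∀ i, 0 < p i := fun i => by linarith [hp i]
  set a : Fin n → ℝ := fun i => (2 * p i * (p i * L₁)) ^ p i with ha
  have ha0 : ∀ i, 0 ≤ a i := fun i => by have := hp0 i; positivity
  refine ⟨2 * L₂ + ∑ i, a i, ?_, ?_⟩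
  · have : 0 ≤ ∑ i, a i := Finset.sum_nonneg fun i _ => ha0 i
    linarith
  intro x₀ t₀ ρ r R hρ hr hrR hR
  have haL : ∀ i, a i ≤ 2 * L₂ + ∑ i, a i := fun i => by
    have := Finset.single_le_sum (f := a) (fun i _ => ha0 i) (Finset.mem_univ i)
    linarith
  have hr0 : 0 < r := by linarith
  have hR0 : 0 < R := by linarith
  have hθ : 0 < (R - r) / ρ := div_pos (by linarith) hρ
  have hθ1 : (R - r) / ρ ≤ 1 := by rw [div_le_one hρ]; linarith
  have hlt : ∀ i, r ^ (1 / p i) < R ^ (1 / p i) := fun i =>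
    Real.rpow_lt_rpow hr0.le hrR (by have := hp0 i; positivity)
  choose η hηs hηp hηc hη01 hηt hη1 hηd using fun i =>
    hprof (p i) (x₀ i) (r ^ (1 / p i)) (R ^ (1 / p i)) (hp0 i) (hlt i)
  -- The time cut-off then reaches 1 at t₀ - R + ε = t₀ - r, the bottom of the inner cylinder.
  set ε := R - r with hε
  have hε0 : 0 < ε := by rw [hε]; linarith
  set ψ : ℝ → ℝ := fun t => Real.smoothTransition ((t - (t₀ - R + ε / 2)) / (ε / 2)) with hψ
  have hψs : ContDiff ℝ ∞ ψ := Real.smoothTransition.contDiff.comp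
    ((contDiff_id.sub contDiff_const).div_const _)
  have hψ01 : ∀ t, ψ t ∈ Icc (0 : ℝ) 1 := fun t =>
    ⟨Real.smoothTransition.nonneg _, Real.smoothTransition.le_one _⟩
  have hψ1 : ∀ t ≥ t₀ - R + ε, ψ t = 1 := fun t ht => by
    apply Real.smoothTransition.one_of_one_le
    rw [le_div_iff₀ (by positivity)]; linarith
  have hηp01 : ∀ i s, η i s ^ p i ∈ Icc (0 : ℝ) 1 := fun i s =>
    ⟨Real.rpow_nonneg (hη01 i s).1 _, Real.rpow_le_one (hη01 i s).1 (hη01 i s).2 (hp0 i).le⟩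
  set ζ : (Fin n → ℝ) × ℝ → ℝ := fun z => ψ z.2 * ∏ i, η i (z.1 i) ^ p i with hζ
  have hζs : ContDiff ℝ ∞ ζ := by
    refine (hψs.comp contDiff_snd).mul (contDiff_prod fun i _ => ?_)
    exact (hηp i).comp ((contDiff_apply ℝ ℝ i).comp contDiff_fst)
  have hprod01 : ∀ (s : Finset (Fin n)) (x : Fin n → ℝ),
      ∏ i ∈ s, η i (x i) ^ p i ∈ Icc (0 : ℝ) 1 := fun s x =>
    ⟨Finset.prod_nonneg fun i _ => (hηp01 i _).1,
      Finset.prod_le_one (fun i _ => (hηp01 i _).1) fun i _ => (hηp01 i _).2⟩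
  have hζ01 : ∀ z, ζ z ∈ Icc (0 : ℝ) 1 := fun z =>
    ⟨mul_nonneg (hψ01 _).1 (hprod01 _ _).1, mul_le_one₀ (hψ01 _).2 (hprod01 _ _).1 (hprod01 _ _).2⟩
  have hsupp : ∀ t, tsupport (fun x => ζ (x, t)) ⊆ univ.pi fun i => tsupport (η i) := by
    intro t
    apply closure_minimal
    · intro x hx i _
      apply subset_tsupport
      intro h0
      apply hx
      simp only [hζ]
      rw [Finset.prod_eq_zero (Finset.mem_univ i), mul_zero]
      rw [h0, Real.zero_rpow (hp0 i).ne']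
    · exact isClosed_set_pi fun i _ => isClosed_tsupport _
  -- Along a coordinate line the other factors form a constant at most 1, which reduces both spatial
  -- derivative bounds to one variable.
  have hslice : ∀ i (x : Fin n → ℝ) t, ∃ c ∈ Icc (0 : ℝ) 1, ∀ s,
      ζ (update x i s, t) = c * η i s ^ p i := by
    intro i x t
    refine ⟨ψ t * ∏ j ∈ Finset.univ.erase i, η j (x j) ^ p j,
      ⟨mul_nonneg (hψ01 _).1 (hprod01 _ _).1,
        mul_le_one₀ (hψ01 _).2 (hprod01 _ _).1 (hprod01 _ _).2⟩, fun s => ?_⟩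
    simp only [hζ]
    rw [← Finset.prod_erase_mul _ _ (Finset.mem_univ i), ← mul_assoc, update_self]
    congr 2
    apply Finset.prod_congr rfl; intro j hj
    rw [update_of_ne (Finset.ne_of_mem_erase hj)]
  have hw : ∀ i, 0 < R ^ (1 / p i) - r ^ (1 / p i) := fun i => by linarith [hlt i]
  have hηdiff : ∀ i, Differentiable ℝ (η i) := fun i => (hηs i).differentiable (by simp)
  have hbound : ∀ i, ((p i * L₁) / (R ^ (1 / p i) - r ^ (1 / p i))) ^ p i ≤
      (2 * L₂ + ∑ i, a i) * (ε / ρ) ^ (-Pb) / ρ := by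
    intro i
    have := hp0 i
    refine (div_rpow_sub_rpow_le (hp i) hρ hr hrR hR (by positivity)).trans ?_
    exact scaled_bound_le (hPb i) hθ hθ1 hρ (ha0 i) (haL i)
  refine ⟨ζ, ⟨hζs, ψ, η, ⟨hψs, ?_, hψ01, ε, ⟨hε0, by linarith⟩, ?_, hψ1⟩, ?_, ?_⟩, hζ01, ?_, ?_,
    ?_, ?_, ?_⟩
  · intro s t hst'
    apply Real.smoothTransition.monotone
    gcongr
  · intro t ht
    apply Real.smoothTransition.zero_of_nonpos
    exact div_nonpos_of_nonpos_of_nonneg (by linarith) (by positivity)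
  · exact fun i => ⟨hηs i, hηc i, hη01 i, hηt i⟩
  · intro x t; rfl
  · rintro ⟨x, t⟩ ⟨hx, ht⟩
    simp only [hζ]
    rw [hψ1 t (by have := ht.1; simp only at this; linarith), one_mul]
    apply Finset.prod_eq_one; intro i _
    rw [hη1 i _ (hx i (mem_univ i)), Real.one_rpow]
  · intro t
    refine ⟨?_, (hsupp t).trans (pi_mono fun i _ => hηt i)⟩
    exact (isCompact_univ_pi fun i => hηc i).of_isClosed_subset (isClosed_tsupport _) (hsupp t)
  · rintro ⟨x, t⟩
    have hd : HasDerivAt ψ (deriv Real.smoothTransition ((t - (t₀ - R + ε / 2)) / (ε / 2)) *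
        (1 / (ε / 2))) t :=
      (((Real.smoothTransition.contDiff (n := 1)).differentiable one_ne_zero _).hasDerivAt).comp t
        (((hasDerivAt_id t).sub_const _).div_const _)
    have hd2 := (hd.mul_const (∏ i, η i (x i) ^ p i)).deriv
    simp only [hζ]
    rw [hd2]
    have h1 := hprod01 Finset.univ x
    calc _ ≤ |deriv Real.smoothTransition ((t - (t₀ - R + ε / 2)) / (ε / 2)) *
          (1 / (ε / 2)) * ∏ i, η i (x i) ^ p i| := le_abs_self _
      _ ≤ L₂ * (1 / (ε / 2)) * 1 := by
          rw [abs_mul, abs_mul, abs_of_nonneg h1.1, abs_of_pos (by positivity : 0 < 1 / (ε / 2))]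
          gcongr
          · exact h1.1
          · exact hst _
          · exact h1.2
      _ = (2 * L₂) * (ε / ρ) ^ (-(1 : ℝ)) / ρ := by
          rw [Real.rpow_neg_one]; field_simp
      _ ≤ _ := scaled_bound_le hPb1 hθ hθ1 hρ (by linarith) (by
          have : 0 ≤ ∑ i, a i := Finset.sum_nonneg fun i _ => ha0 i
          linarith)
  · rintro i ⟨x, t⟩
    obtain ⟨c, hc, hcs⟩ := hslice i x t
    have h1 : (fun s => ζ (update x i s, t) ^ (1 / p i)) = fun s => c ^ (1 / p i) * η i s := by
      funext s
      rw [hcs, Real.mul_rpow hc.1 (hηp01 i s).1, ← Real.rpow_mul (hη01 i s).1,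
        mul_one_div_cancel (hp0 i).ne', Real.rpow_one]
    simp only
    rw [h1, deriv_const_mul _ (hηdiff i _), abs_mul]
    refine le_trans (Real.rpow_le_rpow (by positivity) ?_ (hp0 i).le) (hbound i)
    rw [abs_of_nonneg (Real.rpow_nonneg hc.1 _)]
    have h2 := Real.rpow_le_one hc.1 hc.2 (one_div_pos.2 (hp0 i)).le
    calc _ ≤ 1 * (L₁ / (R ^ (1 / p i) - r ^ (1 / p i))) := by
          gcongr
          exact hηd i _
      _ ≤ _ := by
          rw [one_mul]
          apply div_le_div_of_nonneg_right _ (hw i).le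
          nlinarith [hp i]
  · intro i t x
    obtain ⟨c, hc, hcs⟩ := hslice i x t
    have hζt : Differentiable ℝ (fun x => ζ (x, t)) :=
      (hζs.comp (contDiff_id.prodMk contDiff_const)).differentiable (by simp)
    have h1 : HasDerivAt (fun s => ζ (update x i s, t))
        (fderiv ℝ (fun x => ζ (x, t)) x (Pi.single i 1)) (x i) := by
      have h := (hζt (update x i (x i))).hasFDerivAt.comp_hasDerivAt (x i) (hasDerivAt_update x i (x i))
      rw [update_eq_self] at h
      exact h
    have h2 : HasDerivAt (fun s => ζ (update x i s, t))
        (c * (deriv (η i) (x i) * p i * η i (x i) ^ (p i - 1))) (x i) := by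
      rw [funext hcs]
      exact ((hηdiff i _).hasDerivAt.rpow_const (Or.inr (hp i).le)).const_mul c
    rw [h1.unique h2]
    refine le_trans (Real.rpow_le_rpow (abs_nonneg _) ?_ (hp0 i).le) (hbound i)
    have h3 := Real.rpow_le_one (hη01 i (x i)).1 (hη01 i (x i)).2 (by linarith [hp i] : 0 ≤ p i - 1)
    have h4 : 0 ≤ η i (x i) ^ (p i - 1) := Real.rpow_nonneg (hη01 i (x i)).1 _
    rw [abs_mul, abs_mul, abs_mul, abs_of_nonneg hc.1, abs_of_pos (hp0 i), abs_of_nonneg h4]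
    calc _ ≤ 1 * (L₁ / (R ^ (1 / p i) - r ^ (1 / p i)) * p i * 1) := by
          have := hp0 i
          have := hw i
          gcongr
          · exact hc.2
          · exact hηd i _
      _ = _ := by ring

end Cutoff
end AnisoDG

namespace AnisoDG

open Set MeasureTheory
open scoped ContDiff ENNReal

/-! ### Parabolic anisotropic Sobolev inequality -/

section SpaceTime

open Function Filter Topology

/-- A measurable function satisfying the energy inequality for its upper truncations on all
cylinders of radius at most `R₀` with a fixed vertex. -/
structure LocalDG {n : ℕ} (p δ : Fin n → ℝ) (P C₀ : ℝ) (x₀ : Fin n → ℝ) (t₀ R₀ : ℝ)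
    (u : (Fin n → ℝ) × ℝ → ℝ) (g : Fin n → (Fin n → ℝ) × ℝ → ℝ) : Prop where
  measurable : Measurable u
  measurable_grad : ∀ i, Measurable (g i)
  lintegral_ne_top : ∫⁻ z in cyl p x₀ t₀ R₀, ‖u z‖ₑ ^ P ≠ ⊤
  lintegral_grad_ne_top : ∀ i, ∫⁻ z in cyl p x₀ t₀ R₀, ‖g i z‖ₑ ^ p i ≠ ⊤
  weak : ∀ᵐ t ∂(volume.restrict (Ioo (t₀ - R₀) t₀)), ∀ i, ∀ φ : (Fin n → ℝ) → ℝ,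
    ContDiff ℝ ∞ φ → HasCompactSupport φ → tsupport φ ⊆ box p x₀ R₀ →
      ∫ x, u (x, t) * fderiv ℝ φ x (Pi.single i 1) = - ∫ x, g i (x, t) * φ x
  energy : ∀ R, 0 < R → R ≤ R₀ → ∀ (k : ℝ) (ζ : (Fin n → ℝ) × ℝ → ℝ), IsCutoff p x₀ t₀ R ζ →
    EnergyIneq p δ C₀ x₀ t₀ R (fun z => max (u z - k) 0) {z | k < u z} g ζ

theorem isOpen_box {n : ℕ} (p : Fin n → ℝ) (x₀ : Fin n → ℝ) (R : ℝ) : IsOpen (box p x₀ R) :=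
  isOpen_set_pi finite_univ fun _ _ => isOpen_Ioo

theorem isOpen_cyl {n : ℕ} (p : Fin n → ℝ) (x₀ : Fin n → ℝ) (t₀ R : ℝ) :
    IsOpen (cyl p x₀ t₀ R) :=
  (isOpen_box p x₀ R).prod isOpen_Ioo

theorem box_subset_box {n : ℕ} {p : Fin n → ℝ} (hp : ∀ i, 0 < p i) (x₀ : Fin n → ℝ) {r R : ℝ}
    (hr : 0 ≤ r) (hrR : r ≤ R) : box p x₀ r ⊆ box p x₀ R := by
  refine pi_mono fun i _ => ?_
  have : r ^ (1 / p i) ≤ R ^ (1 / p i) :=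
    Real.rpow_le_rpow hr hrR (one_div_pos.2 (hp i)).le
  exact Ioo_subset_Ioo (by linarith) (by linarith)

theorem cyl_subset_cyl {n : ℕ} {p : Fin n → ℝ} (hp : ∀ i, 0 < p i) (x₀ : Fin n → ℝ) (t₀ : ℝ)
    {r R : ℝ} (hr : 0 ≤ r) (hrR : r ≤ R) : cyl p x₀ t₀ r ⊆ cyl p x₀ t₀ R :=
  prod_mono (box_subset_box hp x₀ hr hrR) (Ioo_subset_Ioo (by linarith) le_rfl)

theorem volume_box {n : ℕ} {p : Fin n → ℝ} (x₀ : Fin n → ℝ) {R : ℝ} (hR : 0 < R) :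
    volume (box p x₀ R) = ENNReal.ofReal (2 ^ n * R ^ (∑ i, 1 / p i)) := by
  have h : ∀ i, volume (Ioo (x₀ i - R ^ (1 / p i)) (x₀ i + R ^ (1 / p i))) =
      ENNReal.ofReal (2 * R ^ (1 / p i)) := fun i => by
    rw [Real.volume_Ioo]; congr 1; ring
  rw [box, volume_pi_pi]
  simp_rw [h]
  rw [← ENNReal.ofReal_prod_of_nonneg fun i _ => by positivity]
  congr 1
  rw [Finset.prod_mul_distrib, Real.rpow_sum_of_pos hR]
  simp

theorem volume_cyl {n : ℕ} {p : Fin n → ℝ} (x₀ : Fin n → ℝ) (t₀ : ℝ) {R : ℝ} (hR : 0 < R) :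
    volume (cyl p x₀ t₀ R) = ENNReal.ofReal (2 ^ n * R ^ (1 + ∑ i, 1 / p i)) := by
  rw [cyl, Measure.volume_eq_prod, Measure.prod_prod, volume_box x₀ hR, Real.volume_Ioo,
    ← ENNReal.ofReal_mul (by positivity)]
  congr 1
  rw [Real.rpow_add hR, Real.rpow_one]; ring

theorem volume_cyl_ne_top {n : ℕ} {p : Fin n → ℝ} (x₀ : Fin n → ℝ) (t₀ : ℝ) {R : ℝ} (hR : 0 < R) :
    volume (cyl p x₀ t₀ R) ≠ ⊤ := by
  rw [volume_cyl x₀ t₀ hR]; exact ENNReal.ofReal_ne_top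

theorem lintegral_cyl {n : ℕ} (p : Fin n → ℝ) (x₀ : Fin n → ℝ) (t₀ R : ℝ)
    {f : (Fin n → ℝ) × ℝ → ℝ≥0∞} (hf : Measurable f) :
    ∫⁻ z in cyl p x₀ t₀ R, f z = ∫⁻ t in Ioo (t₀ - R) t₀, ∫⁻ x in box p x₀ R, f (x, t) := by
  rw [cyl, Measure.volume_eq_prod, ← Measure.prod_restrict, lintegral_prod_symm _ hf.aemeasurable]

/-- Integration by parts against the constant 1. It shows that subtracting a level h from u leaves
the weak gradient unchanged. -/
theorem integral_fderiv_single_eq_zero {n : ℕ} {φ : (Fin n → ℝ) → ℝ} (hφ : ContDiff ℝ ∞ φ)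
    (hφc : HasCompactSupport φ) (i : Fin n) :
    ∫ x, fderiv ℝ φ x (Pi.single i 1) = 0 := by
  have hφ1 : ContDiff ℝ 1 φ := hφ.of_le (by exact_mod_cast le_top)
  have hc : Continuous fun x => fderiv ℝ φ x (Pi.single i 1) :=
    (hφ1.continuous_fderiv one_ne_zero).clm_apply continuous_const
  have h := integral_mul_fderiv_eq_neg_fderiv_mul_of_integrable (μ := (volume : Measure (Fin n → ℝ)))
    (f := fun _ => (1 : ℝ)) (g := φ) (v := Pi.single i 1) (by simp)
    (by simpa using hc.integrable_of_hasCompactSupport (hφc.fderiv_apply (𝕜 := ℝ) _))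
    (by simpa using hφ.continuous.integrable_of_hasCompactSupport hφc)
    (fun _ _ => by fun_prop) (fun _ _ => hφ1.differentiable one_ne_zero _)
  simpa using h

theorem lintegral_rpow_ne_top_of_le {α : Type*} [MeasurableSpace α] {μ : Measure α}
    [IsFiniteMeasure μ] {f : α → ℝ} (hf : Measurable f) {p q : ℝ} (hp : 0 < p) (hpq : p ≤ q)
    (h : ∫⁻ x, ‖f x‖ₑ ^ q ∂μ ≠ ⊤) : ∫⁻ x, ‖f x‖ₑ ^ p ∂μ ≠ ⊤ := by
  have h1 := memLp_ofReal_of_lintegral hf.aestronglyMeasurable (hp.trans_le hpq) h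
  have h2 := h1.mono_exponent (ENNReal.ofReal_le_ofReal hpq)
  have h3 := lintegral_rpow_enorm_lt_top_of_eLpNorm_lt_top (by simpa using hp) (by simp) h2.2
  rw [ENNReal.toReal_ofReal hp.le] at h3
  exact h3.ne

theorem lintegral_sub_const_rpow_ne_top {α : Type*} [MeasurableSpace α] {μ : Measure α}
    [IsFiniteMeasure μ] {f : α → ℝ} (hf : Measurable f) {p q : ℝ} (hp : 0 < p) (hpq : p ≤ q)
    (h : ∫⁻ x, ‖f x‖ₑ ^ q ∂μ ≠ ⊤) (c : ℝ) : ∫⁻ x, ‖f x - c‖ₑ ^ p ∂μ ≠ ⊤ := by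
  have h1 := memLp_ofReal_of_lintegral hf.aestronglyMeasurable (hp.trans_le hpq) h
  have h2 := (h1.mono_exponent (ENNReal.ofReal_le_ofReal hpq)).sub (memLp_const c)
  have h3 := lintegral_rpow_enorm_lt_top_of_eLpNorm_lt_top (by simpa using hp) (by simp) h2.2
  rw [ENNReal.toReal_ofReal hp.le] at h3
  exact h3.ne

/-- The parabolic anisotropic Sobolev inequality for a truncated, cut-off function. -/
theorem spaceTime_sobolev {n : ℕ} (hn : 2 ≤ n) {p : Fin n → ℝ} (hp : ∀ i, 1 < p i)
    (hσ : 1 < ∑ i, 1 / p i) {P : ℝ} (hP : ∀ i, p i ≤ P) :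
    ∃ C : ℝ≥0∞, C ≠ ⊤ ∧ ∀ (δ : Fin n → ℝ) (C₀ : ℝ) (x₀ : Fin n → ℝ) (t₀ R₀ : ℝ)
      (u : (Fin n → ℝ) × ℝ → ℝ) (g : Fin n → (Fin n → ℝ) × ℝ → ℝ),
      LocalDG p δ P C₀ x₀ t₀ R₀ u g → ∀ R, 0 < R → R ≤ R₀ → ∀ ζ : (Fin n → ℝ) × ℝ → ℝ,
      ContDiff ℝ ∞ ζ → (∀ z, ζ z ∈ Icc (0 : ℝ) 1) →
      (∀ t, HasCompactSupport (fun x => ζ (x, t)) ∧ tsupport (fun x => ζ (x, t)) ⊆ box p x₀ R) →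
      ∀ (h a : ℝ), 0 < a → ∀ S : ℝ≥0∞, S ≠ ⊤ →
      (∀ᵐ t ∂(volume.restrict (Ioo (t₀ - R) t₀)),
        ∫⁻ x in box p x₀ R, ‖softPos a (u (x, t) - h) * ζ (x, t)‖ₑ ^ (2 : ℝ) ≤ S) →
      ∫⁻ z in cyl p x₀ t₀ R, ‖softPos a (u z - h) * ζ z‖ₑ ^ ((n + 2) / ∑ i, 1 / p i) ≤
        C * S ^ (1 / ∑ i, 1 / p i) * ∏ i, (∫⁻ z in cyl p x₀ t₀ R,
          ({z | h < u z}.indicator (fun z => ‖g i z‖ₑ ^ p i * ‖ζ z‖ₑ ^ p i) z +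
          ‖max (u z - h) 0‖ₑ ^ p i *
            ‖fderiv ℝ (fun x => ζ (x, z.2)) z.1 (Pi.single i 1)‖ₑ ^ p i)) ^
          (1 / ((∑ i, 1 / p i) * p i)) := by
  obtain ⟨K, hK, hsl⟩ := slice_sobolev hn hp hσ
  set σ := ∑ i, 1 / p i with hσdef
  have hp0 : ∀ i, 0 < p i := fun i => by linarith [hp i]
  have hσ0 : 0 < σ := by linarith
  refine ⟨K ^ ((σ - 1) / σ), ENNReal.rpow_ne_top_of_nonneg
    (div_nonneg (by linarith) hσ0.le) hK, ?_⟩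
  intro δ C₀ x₀ t₀ R₀ u g hu R hR hRR ζ hζ hζ01 hζc h a ha S hStop hS
  have hcyl := cyl_subset_cyl hp0 x₀ t₀ hR.le hRR
  have hbox := box_subset_box hp0 x₀ hR.le hRR
  have hfinite : IsFiniteMeasure (volume.restrict (cyl p x₀ t₀ R)) :=
    ⟨by simpa using (volume_cyl_ne_top x₀ t₀ hR).lt_top⟩
  have hζt : ∀ t, ContDiff ℝ ∞ fun x => ζ (x, t) := fun t =>
    hζ.comp (contDiff_id.prodMk contDiff_const)
  have hum := hu.measurable
  have hgm := hu.measurable_grad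
  set V : (Fin n → ℝ) × ℝ → ℝ := fun z => softPos a (u z - h) * ζ z with hV
  have hVm : Measurable V :=
    ((continuous_softPos ha).measurable.comp (hum.sub_const h)).mul hζ.continuous.measurable
  have hdm : ∀ i : Fin n, Measurable fun z : (Fin n → ℝ) × ℝ =>
      fderiv ℝ (fun x => ζ (x, z.2)) z.1 (Pi.single i 1) := by
    intro i
    have : (fun z : (Fin n → ℝ) × ℝ => fderiv ℝ (fun x => ζ (x, z.2)) z.1 (Pi.single i 1)) =
        fun z => fderiv ℝ ζ z (Pi.single i 1, 0) := by
      funext z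
      have h1 : HasFDerivAt (fun x : Fin n → ℝ => (x, z.2))
          (ContinuousLinearMap.inl ℝ (Fin n → ℝ) ℝ) z.1 := hasFDerivAt_prodMk_left z.1 z.2
      have h2 := ((hζ.differentiable (by simp) (z.1, z.2)).hasFDerivAt).comp z.1 h1
      have h3 : fderiv ℝ (fun x => ζ (x, z.2)) z.1 = _ := h2.fderiv
      rw [h3]; simp
    rw [this]
    exact ((hζ.continuous_fderiv (by simp)).clm_apply continuous_const).measurable
  set T : Fin n → (Fin n → ℝ) × ℝ → ℝ≥0∞ := fun i z =>
    {z | h < u z}.indicator (fun z => ‖g i z‖ₑ ^ p i * ‖ζ z‖ₑ ^ p i) z +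
          ‖max (u z - h) 0‖ₑ ^ p i *
            ‖fderiv ℝ (fun x => ζ (x, z.2)) z.1 (Pi.single i 1)‖ₑ ^ p i with hT
  have hTm : ∀ i, Measurable (T i) := by
    intro i
    refine Measurable.add (Measurable.indicator ?_ (measurableSet_lt measurable_const hum)) ?_
    · exact ((hgm i).enorm.pow_const _).mul (hζ.continuous.measurable.enorm.pow_const _)
    · exact (((hum.sub_const h).max measurable_const).enorm.pow_const _).mul
        ((hdm i).enorm.pow_const _)
  have hufin : ∀ i, ∀ᵐ t ∂(volume.restrict (Ioo (t₀ - R) t₀)),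
      ∫⁻ x in box p x₀ R, ‖u (x, t) - h‖ₑ ^ p i < ⊤ := by
    intro i
    have h1 : ∫⁻ z in cyl p x₀ t₀ R, ‖u z‖ₑ ^ P ≠ ⊤ :=
      ne_top_of_le_ne_top hu.lintegral_ne_top (lintegral_mono_set hcyl)
    have h2 := lintegral_sub_const_rpow_ne_top hum (hp0 i) (hP i) h1 h
    have h3 : Measurable fun z => ‖u z - h‖ₑ ^ p i := (hum.sub_const h).enorm.pow_const _
    rw [lintegral_cyl _ _ _ _ h3] at h2
    exact ae_lt_top h3.lintegral_prod_left' h2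
  have hgfin : ∀ i, ∀ᵐ t ∂(volume.restrict (Ioo (t₀ - R) t₀)),
      ∫⁻ x in box p x₀ R, ‖g i (x, t)‖ₑ ^ p i < ⊤ := by
    intro i
    have h2 : ∫⁻ z in cyl p x₀ t₀ R, ‖g i z‖ₑ ^ p i ≠ ⊤ :=
      ne_top_of_le_ne_top (hu.lintegral_grad_ne_top i) (lintegral_mono_set hcyl)
    have h3 : Measurable fun z => ‖g i z‖ₑ ^ p i := (hgm i).enorm.pow_const _
    rw [lintegral_cyl _ _ _ _ h3] at h2
    exact ae_lt_top h3.lintegral_prod_left' h2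
  have hweak : ∀ᵐ t ∂(volume.restrict (Ioo (t₀ - R) t₀)), ∀ i, ∀ φ : (Fin n → ℝ) → ℝ,
      ContDiff ℝ ∞ φ → HasCompactSupport φ → tsupport φ ⊆ box p x₀ R₀ →
      ∫ x, u (x, t) * fderiv ℝ φ x (Pi.single i 1) = - ∫ x, g i (x, t) * φ x :=
    ae_mono (Measure.restrict_mono (Ioo_subset_Ioo (by linarith) le_rfl) le_rfl) hu.weak
  have hbv : volume (box p x₀ R) ≠ ⊤ := by rw [volume_box x₀ hR]; exact ENNReal.ofReal_ne_top
  have hbfin : IsFiniteMeasure (volume.restrict (box p x₀ R)) := ⟨by simpa using hbv.lt_top⟩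
  have hslice : ∀ᵐ t ∂(volume.restrict (Ioo (t₀ - R) t₀)),
      ∫⁻ x in box p x₀ R, ‖V (x, t)‖ₑ ^ ((n + 2) / σ) ≤ K ^ ((σ - 1) / σ) * S ^ (1 / σ) *
        ∏ i, (∫⁻ x in box p x₀ R, T i (x, t)) ^ (1 / (σ * p i)) := by
    filter_upwards [hS, ae_all_iff.2 hufin, ae_all_iff.2 hgfin, hweak] with t hSt hut hgt hwt
    have hut_m : Measurable fun x => u (x, t) := hum.comp measurable_prodMk_right
    have hVt_m : Measurable fun x => V (x, t) := hVm.comp measurable_prodMk_right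
    have hsob := hsl (box p x₀ R) (isOpen_box p x₀ R) hbv (fun x => u (x, t) - h)
      (fun i x => g i (x, t)) (hut_m.sub_const h)
      (fun i => (hgm i).comp measurable_prodMk_right) (fun i => (hut i).ne) (fun i => (hgt i).ne)
      (by
        intro i φ hφ hφc hφs
        have hφ1 : ContDiff ℝ 1 φ := hφ.of_le (by exact_mod_cast le_top)
        have hdc : Continuous fun x => fderiv ℝ φ x (Pi.single i 1) :=
          (hφ1.continuous_fderiv one_ne_zero).clm_apply continuous_const
        have hd0 : ∀ x ∉ box p x₀ R, fderiv ℝ φ x (Pi.single i 1) = 0 := by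
          intro x hx
          have := image_eq_zero_of_notMem_tsupport (f := fderiv ℝ φ) (x := x)
            fun hx' => hx (hφs (tsupport_fderiv_subset ℝ hx'))
          rw [this]; simp
        have hφ0 : ∀ x ∉ box p x₀ R, φ x = 0 := fun x hx =>
          image_eq_zero_of_notMem_tsupport fun hx' => hx (hφs hx')
        rw [setIntegral_eq_integral_of_forall_compl_eq_zero
            (fun x hx => by rw [hd0 x hx, mul_zero]),
          setIntegral_eq_integral_of_forall_compl_eq_zero
            (fun x hx => by rw [hφ0 x hx, mul_zero]), ← hwt i φ hφ hφc (hφs.trans hbox)]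
        have e1 : ∫ x, (u (x, t) - h) * fderiv ℝ φ x (Pi.single i 1) =
            ∫ x, (u (x, t) * fderiv ℝ φ x (Pi.single i 1) -
              h * fderiv ℝ φ x (Pi.single i 1)) := by
          apply integral_congr_ae; exact Eventually.of_forall fun x => by simp only; ring
        have hint2 : Integrable fun x => fderiv ℝ φ x (Pi.single i 1) :=
          hdc.integrable_of_hasCompactSupport (hφc.fderiv_apply (𝕜 := ℝ) _)
        have hint1 : Integrable fun x => (u (x, t) - h) * fderiv ℝ φ x (Pi.single i 1) := by
          obtain ⟨M, hM⟩ := hdc.bounded_above_of_compact_support (hφc.fderiv_apply (𝕜 := ℝ) _)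
          have h1 := (integrable_indicator_of_lintegral_rpow (isOpen_box p x₀ R).measurableSet hbv
            (hut_m.sub_const h) (hp i).le (hut i).ne).mul_bdd
              (c := M) hdc.aestronglyMeasurable (Eventually.of_forall hM)
          refine h1.congr (Eventually.of_forall fun x => ?_)
          by_cases hx : x ∈ box p x₀ R
          · simp [hx]
          · simp [hx, hd0 x hx]
        have hint3 : Integrable fun x => u (x, t) * fderiv ℝ φ x (Pi.single i 1) := by
          refine (hint1.add (hint2.const_mul h)).congr (Eventually.of_forall fun x => ?_)
          simp only [Pi.add_apply]; ring
        rw [e1, integral_sub hint3 (hint2.const_mul h), integral_const_mul,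
          integral_fderiv_single_eq_zero hφ hφc, mul_zero, sub_zero])
      (fun x => ζ (x, t)) (hζt t) (hζc t).1 (hζc t).2 (fun x => hζ01 _) a ha
    have hset : {y | 0 < u (y, t) - h} = {y | (y, t) ∈ {z | h < u z}} := by
      ext y; simp
    have hRHS : ∀ i, ∫⁻ x in box p x₀ R, ({y | 0 < u (y, t) - h}.indicator
        (fun y => ‖g i (y, t)‖ₑ ^ p i * ‖ζ (y, t)‖ₑ ^ p i) x + ‖max (u (x, t) - h) 0‖ₑ ^ p i *
          ‖fderiv ℝ (fun x => ζ (x, t)) x (Pi.single i 1)‖ₑ ^ p i) =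
        ∫⁻ x in box p x₀ R, T i (x, t) := by
      intro i
      apply lintegral_congr; intro x
      simp only [hT]
      congr 1
      rw [hset]
      rfl
    simp_rw [hRHS] at hsob
    have hσ1 : 0 ≤ (σ - 1) / σ := div_nonneg (by linarith) hσ0.le
    -- Interpolation between the exponents 2 and n / (σ - 1) with weights 1 / σ and (σ - 1) / σ,
    -- which produces the exponent (n + 2) / σ.
    have hH := ENNReal.lintegral_mul_norm_pow_le (μ := volume.restrict (box p x₀ R))
      (f := fun x => ‖V (x, t)‖ₑ ^ (2 : ℝ)) (g := fun x => ‖V (x, t)‖ₑ ^ (n / (σ - 1)))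
      (p := 1 / σ) (q := (σ - 1) / σ) (hVt_m.enorm.pow_const _).aemeasurable
      (hVt_m.enorm.pow_const _).aemeasurable (by positivity) hσ1 (by field_simp; ring)
    have hσ1' : 0 < σ - 1 := by linarith
    calc ∫⁻ x in box p x₀ R, ‖V (x, t)‖ₑ ^ ((n + 2) / σ)
        = ∫⁻ x in box p x₀ R, (‖V (x, t)‖ₑ ^ (2 : ℝ)) ^ (1 / σ) *
            (‖V (x, t)‖ₑ ^ (n / (σ - 1))) ^ ((σ - 1) / σ) := by
          apply lintegral_congr; intro x
          rw [← ENNReal.rpow_mul, ← ENNReal.rpow_mul, ← ENNReal.rpow_add_of_nonneg]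
          · congr 1; field_simp; ring
          · positivity
          · positivity
      _ ≤ _ := hH
      _ ≤ S ^ (1 / σ) * (K * ∏ i, (∫⁻ x in box p x₀ R, T i (x, t)) ^
            (1 / ((σ - 1) * p i))) ^ ((σ - 1) / σ) := by
          gcongr
      _ = _ := by
          rw [ENNReal.mul_rpow_of_nonneg _ _ hσ1, ← ENNReal.prod_rpow_of_nonneg hσ1]
          rw [mul_left_comm, ← mul_assoc]
          congr 1
          apply Finset.prod_congr rfl; intro i _
          rw [← ENNReal.rpow_mul]
          congr 1
          have := (hp0 i).ne'
          field_simp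
  rw [lintegral_cyl _ _ _ _ (hVm.enorm.pow_const _)]
  refine (lintegral_mono_ae hslice).trans ?_
  rw [lintegral_const_mul' _ _ (ENNReal.mul_ne_top (ENNReal.rpow_ne_top_of_nonneg
    (div_nonneg (by linarith) hσ0.le) hK) (ENNReal.rpow_ne_top_of_nonneg (by positivity) hStop))]
  gcongr
  change _ ≤ ∏ i, (∫⁻ z in cyl p x₀ t₀ R, T i z) ^ (1 / (σ * p i))
  simp_rw [fun i => lintegral_cyl p x₀ t₀ R (hTm i)]
  -- The exponents 1 / (σ * p i) sum to 1, so Hölder in time applies to the product with no factor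
  -- left over.
  apply ENNReal.lintegral_prod_norm_pow_le
  · intro i _
    exact (hTm i).lintegral_prod_left'.aemeasurable
  · have : ∀ i, 1 / (σ * p i) = 1 / σ * (1 / p i) := fun i => by
      rw [one_div_mul_one_div]
    simp_rw [this]
    rw [← Finset.mul_sum, ← hσdef]
    field_simp
  · intro i _
    have := hp0 i
    positivity

end SpaceTime
end AnisoDG

namespace AnisoDG

open Set MeasureTheory
open scoped ContDiff ENNReal

/-! ### One step of the De Giorgi iteration -/

section Step

open Function Filter Topology

/-- Where s > 0, b (s + a) is at least 1, so raising the exponent to P costs at most b ^ P. The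
different powers 2 and pᵢ are thereby all replaced by P. -/
theorem trunc_rpow_le {e P a b s : ℝ} (he : 0 < e) (heP : e ≤ P) (ha : 0 < a) (hb : 1 ≤ b)
    (hab : 1 ≤ b * a) : max s 0 ^ e ≤ b ^ P * max (s + a) 0 ^ P := by
  have hb0 : 0 < b := by linarith
  rcases le_or_gt s 0 with h | h
  · rw [max_eq_right h, Real.zero_rpow he.ne']
    have := le_max_right (s + a) 0
    positivity
  · rw [max_eq_left h.le, max_eq_left (by linarith)]
    have hsa : 0 < s + a := by linarith
    calc s ^ e ≤ (s + a) ^ e := Real.rpow_le_rpow h.le (by linarith) he.le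
      _ = (s + a) ^ e * 1 := (mul_one _).symm
      _ ≤ (s + a) ^ e * (b * (s + a)) ^ (P - e) := by
          gcongr
          exact Real.one_le_rpow (by nlinarith) (by linarith)
      _ = b ^ (P - e) * (s + a) ^ P := by
          rw [Real.mul_rpow hb0.le hsa.le, mul_left_comm, ← Real.rpow_add hsa]
          congr 2; ring
      _ ≤ _ := by
          gcongr
          linarith

/-- The pointwise form of Chebyshev's inequality: the level h - a, with s = u - h, controls the set
{u > h}. -/
theorem one_le_trunc_rpow {P a s : ℝ} (hP : 0 ≤ P) (ha : 0 < a) (hs : 0 < s) :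
    1 ≤ a ^ (-P) * max (s + a) 0 ^ P := by
  rw [max_eq_left (by linarith), Real.rpow_neg ha.le, ← div_eq_inv_mul, ← Real.div_rpow
    (by linarith) ha.le]
  apply Real.one_le_rpow _ hP
  rw [le_div_iff₀ ha]; linarith

theorem enorm_max_rpow (s : ℝ) {e : ℝ} (he : 0 ≤ e) :
    ‖max s 0‖ₑ ^ e = ENNReal.ofReal (max s 0 ^ e) := by
  rw [Real.enorm_of_nonneg (le_max_right _ _),
    ENNReal.ofReal_rpow_of_nonneg (le_max_right _ _) he]

/-- |x| is at most twice the larger of (|x| - d)₊ and d. This recovers the full gradient from the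
degenerate one in the energy inequality. -/
theorem abs_rpow_le_trunc {p x d : ℝ} (hp : 1 ≤ p) (hd : 0 ≤ d) :
    |x| ^ p ≤ 2 ^ p * (max (|x| - d) 0 ^ p + d ^ p) := by
  have hp0 : 0 ≤ p := by linarith
  have hm := le_max_right (|x| - d) 0
  have h1 : |x| ≤ 2 * max (max (|x| - d) 0) d := by
    have h2 := le_max_left (|x| - d) 0
    have h3 := le_max_left (max (|x| - d) 0) d
    have h4 := le_max_right (max (|x| - d) 0) d
    linarith
  calc |x| ^ p ≤ (2 * max (max (|x| - d) 0) d) ^ p := Real.rpow_le_rpow (abs_nonneg _) h1 hp0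
    _ = 2 ^ p * max (max (|x| - d) 0) d ^ p :=
        Real.mul_rpow (by norm_num) (hm.trans (le_max_left _ _))
    _ ≤ _ := by
        gcongr
        rcases max_choice (max (|x| - d) 0) d with h | h
        · rw [h]; have := Real.rpow_nonneg hd p; linarith
        · rw [h]; have := Real.rpow_nonneg hm p; linarith

/-- There are n + 1 terms, each a power of (u - h)₊ times a derivative factor at most Λ, and
`trunc_rpow_le` gives them all the same bound. -/
theorem cutoffEnergy_le {n : ℕ} {p : Fin n → ℝ} (hp : ∀ i, 1 < p i) {P : ℝ} (hP : ∀ i, p i ≤ P)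
    (hP2 : 2 ≤ P) {x₀ : Fin n → ℝ} {t₀ R Λ : ℝ} (hΛ : 0 ≤ Λ) {u ζ : (Fin n → ℝ) × ℝ → ℝ}
    (hdt : ∀ z : (Fin n → ℝ) × ℝ, deriv (fun s => ζ (z.1, s)) z.2 ≤ Λ)
    (hdx : ∀ i, ∀ z : (Fin n → ℝ) × ℝ,
      |deriv (fun s => ζ (update z.1 i s, z.2) ^ (1 / p i)) (z.1 i)| ^ p i ≤ Λ)
    {h a b : ℝ} (ha : 0 < a) (hb : 1 ≤ b) (hab : 1 ≤ b * a) :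
    cutoffEnergy p x₀ t₀ R (fun z => max (u z - h) 0) ζ ≤
      (n + 1) * (ENNReal.ofReal (b ^ P * Λ) *
        ∫⁻ z in cyl p x₀ t₀ R, ‖max (u z - h + a) 0‖ₑ ^ P) := by
  have hb0 : 0 < b := by linarith
  have hP0 : 0 ≤ P := by linarith
  have key : ∀ (e c s : ℝ), 0 < e → e ≤ P → c ≤ Λ →
      ENNReal.ofReal (max s 0 ^ e * c) ≤
        ENNReal.ofReal (b ^ P * Λ) * ‖max (s + a) 0‖ₑ ^ P := by
    intro e c s he heP hc
    rw [enorm_max_rpow _ hP0, ← ENNReal.ofReal_mul (by positivity)]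
    apply ENNReal.ofReal_le_ofReal
    have h1 := trunc_rpow_le (s := s) he heP ha hb hab
    have h2 : 0 ≤ max s 0 ^ e := Real.rpow_nonneg (le_max_right _ _) _
    calc _ ≤ max s 0 ^ e * Λ := by gcongr
      _ ≤ b ^ P * max (s + a) 0 ^ P * Λ := by gcongr
      _ = _ := by ring
  have hint : ∀ F : (Fin n → ℝ) × ℝ → ℝ≥0∞,
      (∀ z, F z ≤ ENNReal.ofReal (b ^ P * Λ) * ‖max (u z - h + a) 0‖ₑ ^ P) →
      ∫⁻ z in cyl p x₀ t₀ R, F z ≤ ENNReal.ofReal (b ^ P * Λ) *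
        ∫⁻ z in cyl p x₀ t₀ R, ‖max (u z - h + a) 0‖ₑ ^ P := by
    intro F hF
    rw [← lintegral_const_mul' _ _ ENNReal.ofReal_ne_top]
    exact lintegral_mono hF
  set E := ENNReal.ofReal (b ^ P * Λ) * ∫⁻ z in cyl p x₀ t₀ R, ‖max (u z - h + a) 0‖ₑ ^ P
  unfold cutoffEnergy
  calc _ ≤ E + ∑ i : Fin n, E := by
        refine add_le_add (hint _ fun z => ?_) (Finset.sum_le_sum fun i _ => hint _ fun z => ?_)
        · have := key 2 _ (u z - h) (by norm_num) hP2 (hdt z)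
          rw [Real.rpow_two] at this
          exact this
        · exact key (p i) _ (u z - h) (by linarith [hp i]) (hP i) (hdx i z)
    _ = (n + 1) * E := by
        rw [Finset.sum_const, Finset.card_univ, Fintype.card_fin, nsmul_eq_mul]; ring

/-- Removing δᵢ from the gradient leaves a multiple of the measure of {u > h}. Chebyshev bounds that
measure with a factor a^(-P), and `haΛ` lets it join the cut-off terms. -/
theorem gradTerm_le {n : ℕ} {p δ : Fin n → ℝ} (hp : ∀ i, 1 < p i) {P : ℝ} (hP : ∀ i, p i ≤ P)
    (hP2 : 2 ≤ P) {D : ℝ} (hδ : ∀ i, 0 ≤ δ i) (hδD : ∀ i, δ i ≤ D)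
    {x₀ : Fin n → ℝ} {t₀ R Λ : ℝ} (hΛ : 0 ≤ Λ) {u ζ : (Fin n → ℝ) × ℝ → ℝ}
    {g : Fin n → (Fin n → ℝ) × ℝ → ℝ} (hu : Measurable u)
    (hζ01 : ∀ z, ζ z ∈ Icc (0 : ℝ) 1)
    (hfx : ∀ i t x, |fderiv ℝ (fun x => ζ (x, t)) x (Pi.single i 1)| ^ p i ≤ Λ)
    {h a b : ℝ} (ha : 0 < a) (hb : 1 ≤ b) (hab : 1 ≤ b * a) (haΛ : a ^ (-P) ≤ b ^ P * Λ)
    (i : Fin n) :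
    ∫⁻ z in cyl p x₀ t₀ R, ({z | h < u z}.indicator (fun z => ‖g i z‖ₑ ^ p i * ‖ζ z‖ₑ ^ p i) z +
        ‖max (u z - h) 0‖ₑ ^ p i *
          ‖fderiv ℝ (fun x => ζ (x, z.2)) z.1 (Pi.single i 1)‖ₑ ^ p i) ≤
      ENNReal.ofReal (2 ^ p i) * gradEnergy p δ x₀ t₀ R g {z | h < u z} ζ +
        (ENNReal.ofReal (2 ^ p i * D ^ p i) + 1) * (ENNReal.ofReal (b ^ P * Λ) *
          ∫⁻ z in cyl p x₀ t₀ R, ‖max (u z - h + a) 0‖ₑ ^ P) := by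
  have hp0 : 0 < p i := by linarith [hp i]
  have hb0 : 0 < b := by linarith
  have hP0 : 0 ≤ P := by linarith
  have hD0 : 0 ≤ D := (hδ i).trans (hδD i)
  set W : (Fin n → ℝ) × ℝ → ℝ≥0∞ := fun z => ‖max (u z - h + a) 0‖ₑ ^ P with hW
  have hWm : Measurable W :=
    (((hu.sub_const h).add_const a).max measurable_const).enorm.pow_const _
  set G : (Fin n → ℝ) × ℝ → ℝ≥0∞ := fun z => {z | h < u z}.indicator
    (fun z => ENNReal.ofReal (max (|g i z| - δ i) 0 ^ p i * ζ z)) z with hG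
  have hgrad : ∫⁻ z in cyl p x₀ t₀ R, G z ≤ gradEnergy p δ x₀ t₀ R g {z | h < u z} ζ := by
    unfold gradEnergy
    exact Finset.single_le_sum (f := fun i => ∫⁻ z in cyl p x₀ t₀ R, {z | h < u z}.indicator
      (fun z => ENNReal.ofReal (max (|g i z| - δ i) 0 ^ p i * ζ z)) z) (fun _ _ => zero_le)
      (Finset.mem_univ i)
  have h1 : ∀ z, {z | h < u z}.indicator (fun z => ‖g i z‖ₑ ^ p i * ‖ζ z‖ₑ ^ p i) z ≤
      ENNReal.ofReal (2 ^ p i) * G z +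
        ENNReal.ofReal (2 ^ p i * D ^ p i) * (ENNReal.ofReal (b ^ P * Λ) * W z) := by
    intro z
    by_cases hz : z ∈ {z | h < u z}
    · have hz' : 0 < u z - h := sub_pos.2 hz
      simp only [hG, indicator_of_mem hz, hW]
      have hζz := hζ01 z
      have e1 : ‖g i z‖ₑ ^ p i * ‖ζ z‖ₑ ^ p i = ENNReal.ofReal (|g i z| ^ p i * ζ z ^ p i) := by
        rw [Real.enorm_eq_ofReal_abs, Real.enorm_of_nonneg hζz.1,
          ENNReal.ofReal_rpow_of_nonneg (abs_nonneg _) hp0.le,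
          ENNReal.ofReal_rpow_of_nonneg hζz.1 hp0.le, ENNReal.ofReal_mul (by positivity)]
      have hpos1 : 0 ≤ max (u z - h + a) 0 ^ P := Real.rpow_nonneg (le_max_right _ _) _
      have hpos2 : 0 ≤ max (|g i z| - δ i) 0 ^ p i := Real.rpow_nonneg (le_max_right _ _) _
      have hDp : 0 ≤ D ^ p i := Real.rpow_nonneg hD0 _
      rw [e1, enorm_max_rpow _ hP0, ← ENNReal.ofReal_mul (by positivity),
        ← ENNReal.ofReal_mul (by positivity), ← ENNReal.ofReal_mul (by positivity),
        ← ENNReal.ofReal_add (mul_nonneg (by positivity) (mul_nonneg hpos2 hζz.1)) (by positivity)]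
      apply ENNReal.ofReal_le_ofReal
      have e2 : ζ z ^ p i ≤ ζ z := by
        calc ζ z ^ p i ≤ ζ z ^ (1 : ℝ) :=
              Real.rpow_le_rpow_of_exponent_ge_of_imp hζz.1 hζz.2 (hp i).le (by
                intro _ h0; linarith)
          _ = ζ z := Real.rpow_one _
      have e3 := abs_rpow_le_trunc (x := g i z) (hp i).le (hδ i)
      have e4 : δ i ^ p i ≤ D ^ p i := Real.rpow_le_rpow (hδ i) (hδD i) hp0.le
      have e5 : 1 ≤ b ^ P * Λ * max (u z - h + a) 0 ^ P :=
        (one_le_trunc_rpow hP0 ha hz').trans (by gcongr)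
      calc |g i z| ^ p i * ζ z ^ p i
          ≤ (2 ^ p i * (max (|g i z| - δ i) 0 ^ p i + D ^ p i)) * ζ z := by
            refine mul_le_mul (e3.trans (by gcongr)) e2 (Real.rpow_nonneg hζz.1 _) ?_
            positivity
        _ = 2 ^ p i * (max (|g i z| - δ i) 0 ^ p i * ζ z) + 2 ^ p i * D ^ p i * ζ z := by ring
        _ ≤ 2 ^ p i * (max (|g i z| - δ i) 0 ^ p i * ζ z) + 2 ^ p i * D ^ p i *
            (b ^ P * Λ * max (u z - h + a) 0 ^ P) := by
            gcongr
            exact hζz.2.trans e5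
    · rw [indicator_of_notMem hz]; exact zero_le
  have h2 : ∀ z : (Fin n → ℝ) × ℝ, ‖max (u z - h) 0‖ₑ ^ p i *
      ‖fderiv ℝ (fun x => ζ (x, z.2)) z.1 (Pi.single i 1)‖ₑ ^ p i ≤
      ENNReal.ofReal (b ^ P * Λ) * W z := by
    intro z
    simp only [hW]
    rw [enorm_max_rpow _ hP0, enorm_max_rpow _ hp0.le, Real.enorm_eq_ofReal_abs,
      ENNReal.ofReal_rpow_of_nonneg (abs_nonneg _) hp0.le,
      ← ENNReal.ofReal_mul (Real.rpow_nonneg (le_max_right _ _) _),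
      ← ENNReal.ofReal_mul (by positivity)]
    apply ENNReal.ofReal_le_ofReal
    have e1 := trunc_rpow_le (s := u z - h) hp0 (hP i) ha hb hab
    calc _ ≤ b ^ P * max (u z - h + a) 0 ^ P * Λ := by
          gcongr
          exact hfx i z.2 z.1
      _ = _ := by ring
  calc _ ≤ ∫⁻ z in cyl p x₀ t₀ R, (ENNReal.ofReal (2 ^ p i) * G z +
        (ENNReal.ofReal (2 ^ p i * D ^ p i) + 1) * (ENNReal.ofReal (b ^ P * Λ) * W z)) := by
        apply lintegral_mono; intro z
        refine (add_le_add (h1 z) (h2 z)).trans (le_of_eq ?_)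
        ring
    _ = ENNReal.ofReal (2 ^ p i) * (∫⁻ z in cyl p x₀ t₀ R, G z) +
        (ENNReal.ofReal (2 ^ p i * D ^ p i) + 1) * (ENNReal.ofReal (b ^ P * Λ) *
          ∫⁻ z in cyl p x₀ t₀ R, W z) := by
        rw [lintegral_add_right _ ((hWm.const_mul _).const_mul _),
          lintegral_const_mul' _ _ ENNReal.ofReal_ne_top, lintegral_const_mul' _ _ (by finiteness),
          lintegral_const_mul' _ _ ENNReal.ofReal_ne_top]
    _ ≤ _ := by gcongr

/-- One step of the De Giorgi iteration. -/
theorem deGiorgi_step {n : ℕ} (hn : 2 ≤ n) {p : Fin n → ℝ} (hp : ∀ i, 1 < p i)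
    (hσ : 1 < ∑ i, 1 / p i) {P : ℝ} (hP : ∀ i, p i ≤ P) (hP2 : 2 ≤ P)
    (hPσ : P * ∑ i, 1 / p i < n + 2) (C₀ D : ℝ) :
    ∃ C : ℝ≥0∞, C ≠ ⊤ ∧ ∀ (δ : Fin n → ℝ), (∀ i, 0 ≤ δ i) → (∀ i, δ i ≤ D) →
      ∀ (x₀ : Fin n → ℝ) (t₀ R₀ : ℝ)
      (u : (Fin n → ℝ) × ℝ → ℝ) (g : Fin n → (Fin n → ℝ) × ℝ → ℝ),
      LocalDG p δ P C₀ x₀ t₀ R₀ u g → ∀ r R Λ, 0 < r → r ≤ R → R ≤ R₀ → 0 ≤ Λ →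
      ∀ ζ : (Fin n → ℝ) × ℝ → ℝ, IsCutoff p x₀ t₀ R ζ → (∀ z, ζ z ∈ Icc (0 : ℝ) 1) →
      (∀ z ∈ cyl p x₀ t₀ r, ζ z = 1) →
      (∀ t, HasCompactSupport (fun x => ζ (x, t)) ∧ tsupport (fun x => ζ (x, t)) ⊆ box p x₀ R) →
      (∀ z : (Fin n → ℝ) × ℝ, deriv (fun s => ζ (z.1, s)) z.2 ≤ Λ) →
      (∀ i, ∀ z : (Fin n → ℝ) × ℝ,
        |deriv (fun s => ζ (update z.1 i s, z.2) ^ (1 / p i)) (z.1 i)| ^ p i ≤ Λ) →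
      (∀ i t x, |fderiv ℝ (fun x => ζ (x, t)) x (Pi.single i 1)| ^ p i ≤ Λ) →
      ∀ h a b : ℝ, 0 < a → 1 ≤ b → 1 ≤ b * a → a ^ (-P) ≤ b ^ P * Λ →
      ∫⁻ z in cyl p x₀ t₀ r, ‖max (u z - h - a) 0‖ₑ ^ P ≤
        C * (ENNReal.ofReal (b ^ P * Λ) * ∫⁻ z in cyl p x₀ t₀ R, ‖max (u z - h + a) 0‖ₑ ^ P) ^
            (P * (1 + ∑ i, 1 / p i) / (n + 2)) *
          (ENNReal.ofReal (a ^ (-P)) * ∫⁻ z in cyl p x₀ t₀ R, ‖max (u z - h + a) 0‖ₑ ^ P) ^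
            (1 - P * (∑ i, 1 / p i) / (n + 2)) := by
  obtain ⟨K, hK, hsob⟩ := spaceTime_sobolev hn hp hσ hP
  set σ := ∑ i, 1 / p i with hσdef
  have hp0 : ∀ i, 0 < p i := fun i => by linarith [hp i]
  have hσ0 : 0 < σ := by linarith
  have hP0 : 0 < P := by linarith
  have hn2 : (0 : ℝ) < n + 2 := by positivity
  set M : ℝ≥0∞ := ENNReal.ofReal C₀ * (n + 1) with hM
  have hMtop : M ≠ ⊤ := by rw [hM]; finiteness
  set N : Fin n → ℝ≥0∞ := fun i => ENNReal.ofReal (2 ^ p i) * M +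
    (ENNReal.ofReal (2 ^ p i * D ^ p i) + 1) with hN
  have hNtop : ∀ i, N i ≠ ⊤ := fun i => by simp only [hN]; finiteness
  set K' : ℝ≥0∞ := K * M ^ (1 / σ) * ∏ i, N i ^ (1 / (σ * p i)) with hK'
  have hK'top : K' ≠ ⊤ := by
    refine ENNReal.mul_ne_top (ENNReal.mul_ne_top hK (ENNReal.rpow_ne_top_of_nonneg
      (by positivity) hMtop)) (ENNReal.prod_ne_top fun i _ => ?_)
    exact ENNReal.rpow_ne_top_of_nonneg (by have := hp0 i; positivity) (hNtop i)
  -- ϑ is P divided by the Sobolev exponent (n + 2) / σ. The remaining weight 1 - ϑ > 0 goes to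
  -- Chebyshev.
  set ϑ : ℝ := P * σ / (n + 2) with hϑ
  have hϑ0 : 0 < ϑ := by positivity
  have hϑ1 : 0 < 1 - ϑ := by
    rw [hϑ, sub_pos, div_lt_one hn2]; exact hPσ
  refine ⟨2 ^ P * K' ^ ϑ, ENNReal.mul_ne_top (by finiteness)
    (ENNReal.rpow_ne_top_of_nonneg hϑ0.le hK'top), ?_⟩
  intro δ hδ hδD x₀ t₀ R₀ u g hu r R Λ hr hrR hRR hΛ ζ hζc hζ01 hζ1 hζs hdt hdx hfx h a b ha hb
    hab haΛ
  have hR : 0 < R := hr.trans_le hrR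
  have hum := hu.measurable
  have hcyl := cyl_subset_cyl hp0 x₀ t₀ hr.le hrR
  have hcylR := cyl_subset_cyl hp0 x₀ t₀ hR.le hRR
  have hb0 : 0 < b := by linarith
  set W : (Fin n → ℝ) × ℝ → ℝ≥0∞ := fun z => ‖max (u z - h + a) 0‖ₑ ^ P with hW
  set Y := ∫⁻ z in cyl p x₀ t₀ R, W z with hY
  set E := ENNReal.ofReal (b ^ P * Λ) * Y with hE
  have hfinite : IsFiniteMeasure (volume.restrict (cyl p x₀ t₀ R)) :=
    ⟨by simpa using (volume_cyl_ne_top x₀ t₀ hR).lt_top⟩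
  have hYtop : Y ≠ ⊤ := by
    have h1 : ∫⁻ z in cyl p x₀ t₀ R, ‖u z‖ₑ ^ P ≠ ⊤ :=
      ne_top_of_le_ne_top hu.lintegral_ne_top (lintegral_mono_set hcylR)
    refine ne_top_of_le_ne_top (lintegral_sub_const_rpow_ne_top hum hP0 le_rfl h1 (h - a)) ?_
    apply lintegral_mono; intro z
    refine ENNReal.rpow_le_rpow ?_ hP0.le
    rw [Real.enorm_eq_ofReal_abs, Real.enorm_eq_ofReal_abs, abs_of_nonneg (le_max_right _ _)]
    apply ENNReal.ofReal_le_ofReal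
    rw [show u z - h + a = u z - (h - a) by ring]
    exact max_le (le_abs_self _) (abs_nonneg _)
  have hEtop : E ≠ ⊤ := ENNReal.mul_ne_top ENNReal.ofReal_ne_top hYtop
  have hen := hu.energy R hR hRR h ζ hζc
  unfold EnergyIneq at hen
  have hce := cutoffEnergy_le hp hP hP2 (x₀ := x₀) (t₀ := t₀) (R := R) (u := u) hΛ hdt hdx
    (h := h) ha hb hab
  have hen2 := hen.trans (mul_le_mul_right hce (ENNReal.ofReal C₀))
  rw [← mul_assoc] at hen2
  change _ ≤ M * E at hen2
  have hS : ∀ᵐ t ∂(volume.restrict (Ioo (t₀ - R) t₀)),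
      ∫⁻ x in box p x₀ R, ‖softPos a (u (x, t) - h) * ζ (x, t)‖ₑ ^ (2 : ℝ) ≤ M * E := by
    filter_upwards [ae_le_essSup (μ := volume.restrict (Ioo (t₀ - R) t₀))
      (f := sliceEnergy p x₀ R (fun z => max (u z - h) 0) ζ)] with t ht
    refine le_trans ?_ (ht.trans (le_self_add.trans hen2))
    unfold sliceEnergy
    apply lintegral_mono; intro x
    have h1 := softPos_nonneg ha (u (x, t) - h)
    have h2 := softPos_le ha (u (x, t) - h)
    have h3 := hζ01 (x, t)
    simp only
    rw [Real.enorm_of_nonneg (mul_nonneg h1 h3.1),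
      ENNReal.ofReal_rpow_of_nonneg (mul_nonneg h1 h3.1) (by norm_num)]
    apply ENNReal.ofReal_le_ofReal
    rw [Real.rpow_two, mul_pow]
    have h4 : ζ (x, t) ^ 2 ≤ ζ (x, t) := by nlinarith [h3.1, h3.2]
    exact mul_le_mul (pow_le_pow_left₀ h1 h2 2) h4 (by positivity) (by positivity)
  have hgE : gradEnergy p δ x₀ t₀ R g {z | h < u z} ζ ≤ M * E := le_add_self.trans hen2
  have hmain := hsob δ C₀ x₀ t₀ R₀ u g hu R hR hRR ζ hζc.1 hζ01 hζs h a ha (M * E)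
    (ENNReal.mul_ne_top hMtop hEtop) hS
  set V : (Fin n → ℝ) × ℝ → ℝ := fun z => softPos a (u z - h) * ζ z with hV
  have hVm : Measurable V := ((continuous_softPos ha).measurable.comp (hum.sub_const h)).mul
    hζc.1.continuous.measurable
  -- The power 1 / σ comes from the slice energy and the power 1 = ∑ 1 / (σ * p i) from the
  -- gradients.
  have hVq : ∫⁻ z in cyl p x₀ t₀ R, ‖V z‖ₑ ^ ((n + 2) / σ) ≤ K' * E ^ (1 / σ + 1) := by
    refine hmain.trans ?_
    calc _ ≤ K * (M * E) ^ (1 / σ) * ∏ i, (N i * E) ^ (1 / (σ * p i)) := by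
          gcongr with i _
          · have := hp0 i; positivity
          refine (gradTerm_le hp hP hP2 hδ hδD hΛ hum hζ01 hfx ha hb hab haΛ i).trans ?_
          calc _ ≤ ENNReal.ofReal (2 ^ p i) * (M * E) +
                (ENNReal.ofReal (2 ^ p i * D ^ p i) + 1) * E := by gcongr
            _ = N i * E := by simp only [hN]; ring
      _ = K' * (E ^ (1 / σ) * ∏ i, E ^ (1 / (σ * p i))) := by
          rw [ENNReal.mul_rpow_of_nonneg _ _ (by positivity)]
          simp_rw [fun i => ENNReal.mul_rpow_of_nonneg (N i) E
            (by have := hp0 i; positivity : 0 ≤ 1 / (σ * p i))]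
          rw [Finset.prod_mul_distrib, hK']
          ring
      _ = K' * E ^ (1 / σ + 1) := by
          congr 1
          rw [← ennreal_rpow_sum _ _ (fun i _ => by have := hp0 i; positivity),
            ← ENNReal.rpow_add_of_nonneg _ _ (by positivity)
              (Finset.sum_nonneg fun i _ => by have := hp0 i; positivity)]
          congr 2
          have : ∀ i, 1 / (σ * p i) = 1 / σ * (1 / p i) := fun i => by
            rw [one_div_mul_one_div]
          simp_rw [this]
          rw [← Finset.mul_sum, ← hσdef]
          field_simp
  -- Only points with u > h + a matter. There `half_le_softPos` applies and the Chebyshev factor is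
  -- at least 1, so it may be inserted to prepare Hölder.
  have hpt : ∀ z ∈ cyl p x₀ t₀ r, ‖max (u z - h - a) 0‖ₑ ^ P ≤
      2 ^ P * ((‖V z‖ₑ ^ ((n + 2) / σ)) ^ ϑ * (ENNReal.ofReal (a ^ (-P)) * W z) ^ (1 - ϑ)) := by
    intro z hz
    rcases le_or_gt (u z - h - a) 0 with hle | hgt
    · rw [max_eq_right hle]
      simp [hP0]
    · have hVz : V z = softPos a (u z - h) := by simp only [hV]; rw [hζ1 z hz, mul_one]
      have h1 : u z - h - a ≤ 2 * V z := by
        rw [hVz]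
        have := half_le_softPos ha (by linarith : a ≤ u z - h)
        linarith
      have h2 : 1 ≤ ENNReal.ofReal (a ^ (-P)) * W z := by
        simp only [hW]
        rw [enorm_max_rpow _ hP0.le, ← ENNReal.ofReal_mul (by positivity), ENNReal.one_le_ofReal]
        exact one_le_trunc_rpow hP0.le ha (by linarith)
      have h3 : 1 ≤ (ENNReal.ofReal (a ^ (-P)) * W z) ^ (1 - ϑ) := ENNReal.one_le_rpow h2 hϑ1
      have h4 : (‖V z‖ₑ ^ ((n + 2) / σ)) ^ ϑ = ‖V z‖ₑ ^ P := by
        rw [← ENNReal.rpow_mul, hϑ]; congr 1; field_simp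
      rw [h4]
      calc ‖max (u z - h - a) 0‖ₑ ^ P ≤ (2 * ‖V z‖ₑ) ^ P := by
            refine ENNReal.rpow_le_rpow ?_ hP0.le
            rw [max_eq_left hgt.le, Real.enorm_of_nonneg hgt.le,
              Real.enorm_of_nonneg (by linarith : 0 ≤ V z)]
            calc _ ≤ ENNReal.ofReal (2 * V z) := ENNReal.ofReal_le_ofReal h1
              _ = _ := by rw [ENNReal.ofReal_mul (by norm_num)]; simp
        _ = 2 ^ P * (‖V z‖ₑ ^ P * 1) := by
            rw [ENNReal.mul_rpow_of_nonneg _ _ hP0.le, mul_one]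
        _ ≤ _ := by gcongr
  have hWm : Measurable W :=
    (((hum.sub_const h).add_const a).max measurable_const).enorm.pow_const _
  calc ∫⁻ z in cyl p x₀ t₀ r, ‖max (u z - h - a) 0‖ₑ ^ P
      ≤ ∫⁻ z in cyl p x₀ t₀ r, 2 ^ P * ((‖V z‖ₑ ^ ((n + 2) / σ)) ^ ϑ *
          (ENNReal.ofReal (a ^ (-P)) * W z) ^ (1 - ϑ)) :=
        setLIntegral_mono' (isOpen_cyl p x₀ t₀ r).measurableSet hpt
    _ ≤ ∫⁻ z in cyl p x₀ t₀ R, 2 ^ P * ((‖V z‖ₑ ^ ((n + 2) / σ)) ^ ϑ *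
          (ENNReal.ofReal (a ^ (-P)) * W z) ^ (1 - ϑ)) := lintegral_mono_set hcyl
    _ = 2 ^ P * ∫⁻ z in cyl p x₀ t₀ R, ((‖V z‖ₑ ^ ((n + 2) / σ)) ^ ϑ *
          (ENNReal.ofReal (a ^ (-P)) * W z) ^ (1 - ϑ)) :=
        lintegral_const_mul' _ _ (by finiteness)
    _ ≤ 2 ^ P * ((∫⁻ z in cyl p x₀ t₀ R, ‖V z‖ₑ ^ ((n + 2) / σ)) ^ ϑ *
          (∫⁻ z in cyl p x₀ t₀ R, ENNReal.ofReal (a ^ (-P)) * W z) ^ (1 - ϑ)) := by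
        gcongr
        exact ENNReal.lintegral_mul_norm_pow_le (hVm.enorm.pow_const _).aemeasurable
          (hWm.const_mul _).aemeasurable hϑ0.le hϑ1.le (by ring)
    _ ≤ 2 ^ P * ((K' * E ^ (1 / σ + 1)) ^ ϑ * (ENNReal.ofReal (a ^ (-P)) * Y) ^ (1 - ϑ)) := by
        rw [lintegral_const_mul' _ _ ENNReal.ofReal_ne_top]
        gcongr
    _ = _ := by
        rw [ENNReal.mul_rpow_of_nonneg _ _ hϑ0.le, ← ENNReal.rpow_mul]
        rw [show (1 / σ + 1) * ϑ = P * (1 + σ) / (n + 2) by rw [hϑ]; field_simp]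
        ring

end Step
end AnisoDG

namespace AnisoDG

open Set MeasureTheory
open scoped ContDiff ENNReal

/-! ### The iteration and the bound in terms of L^P -/

section Iteration

open Function Filter Topology

/-- Fast geometric convergence. -/
theorem fast_geometric_convergence {y : ℕ → ℝ} {K B α : ℝ} (hy : ∀ j, 0 ≤ y j) (hK : 0 ≤ K)
    (hB : 1 < B) (hα : 0 < α) (hrec : ∀ j : ℕ, y (j + 1) ≤ K * B ^ (j : ℝ) * y j ^ (1 + α))
    (h0 : K * y 0 ^ α ≤ B ^ (-1 / α)) (j : ℕ) : y j ≤ y 0 * B ^ (-(j : ℝ) / α) := by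
  have hB0 : 0 < B := by linarith
  induction j with
  | zero => simp
  | succ j ih =>
    have h1 : 0 ≤ y 0 := hy 0
    calc y (j + 1) ≤ K * B ^ (j : ℝ) * y j ^ (1 + α) := hrec j
      _ ≤ K * B ^ (j : ℝ) * (y 0 * B ^ (-(j : ℝ) / α)) ^ (1 + α) := by
          gcongr
          exact hy j
      _ = (K * y 0 ^ α) * (y 0 * B ^ (-(j : ℝ) / α)) := by
          rw [Real.mul_rpow h1 (by positivity), Real.rpow_add_of_nonneg h1 zero_le_one hα.le,
            Real.rpow_one, ← Real.rpow_mul hB0.le]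
          have : B ^ (-(j : ℝ) / α) = B ^ (j : ℝ) * B ^ (-(j : ℝ) / α * (1 + α)) := by
            rw [← Real.rpow_add hB0]; congr 1; field_simp; ring
          rw [this]; ring
      _ ≤ B ^ (-1 / α) * (y 0 * B ^ (-(j : ℝ) / α)) := by gcongr
      _ = y 0 * B ^ (-((j + 1 : ℕ) : ℝ) / α) := by
          rw [mul_left_comm, ← Real.rpow_add hB0]
          congr 2; push_cast; ring

/-- The algebra of the constants in the De Giorgi recursion. -/
theorem recursion_constants {P L θ ρ k y κ ϑ α : ℝ} (hP : 0 < P) (hL : 0 < L) (hθ : 0 < θ)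
    (hρ : 0 < ρ) (hk : 0 < k) (hy : 0 ≤ y) (hκ : 0 ≤ κ) (hϑ : 0 ≤ 1 - ϑ) (hα : κ + (1 - ϑ) = 1 + α)
    (j : ℕ) :
    (((2 : ℝ) ^ (j + 2)) ^ P * (L * (θ / 2 ^ (j + 1)) ^ (-P) / ρ) * y) ^ κ *
      ((k / 2 ^ (j + 2)) ^ (-P) * y) ^ (1 - ϑ) ≤
    ((8 ^ P) ^ (1 + α) * (L * θ ^ (-P) / ρ) ^ κ * (k ^ (-P)) ^ (1 - ϑ)) *
      ((4 ^ P) ^ (1 + α)) ^ (j : ℝ) * y ^ (1 + α) := by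
  -- T = 2^((2j+3)P) is exactly the dyadic factor of the first product and dominates the factor
  -- 2^((j+2)P) of the second.
  set T : ℝ := 8 ^ P * (4 ^ P) ^ (j : ℝ) with hT
  have hT0 : 0 < T := by positivity
  have e2 : ∀ m : ℕ, ((2 : ℝ) ^ m) ^ P = (2 ^ P) ^ (m : ℝ) := fun m => by
    rw [← Real.rpow_natCast, ← Real.rpow_mul (by norm_num), ← Real.rpow_mul (by norm_num), mul_comm]
  have e8 : (8 : ℝ) ^ P = (2 ^ P) ^ (3 : ℝ) := by
    rw [← Real.rpow_mul (by norm_num), mul_comm, Real.rpow_mul (by norm_num)]; norm_num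
  have e4 : (4 : ℝ) ^ P = (2 ^ P) ^ (2 : ℝ) := by
    rw [← Real.rpow_mul (by norm_num), mul_comm, Real.rpow_mul (by norm_num)]; norm_num
  have h2P : (1 : ℝ) ≤ 2 ^ P := Real.one_le_rpow (by norm_num) hP.le
  have h2P0 : (0 : ℝ) < 2 ^ P := by positivity
  have eT : T = (2 ^ P) ^ (3 + 2 * (j : ℝ)) := by
    rw [hT, e8, e4, ← Real.rpow_mul h2P0.le, ← Real.rpow_add h2P0]
  have h1 : ((2 : ℝ) ^ (j + 2)) ^ P * (L * (θ / 2 ^ (j + 1)) ^ (-P) / ρ) * y =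
      T * ((L * θ ^ (-P) / ρ) * y) := by
    rw [Real.div_rpow hθ.le (by positivity), Real.rpow_neg (x := 2 ^ (j + 1)) (by positivity),
      e2, e2, eT]
    have : (2 ^ P : ℝ) ^ (3 + 2 * (j : ℝ)) = (2 ^ P) ^ ((j + 2 : ℕ) : ℝ) *
        (2 ^ P) ^ ((j + 1 : ℕ) : ℝ) := by
      rw [← Real.rpow_add h2P0]; congr 1; push_cast; ring
    rw [this, div_inv_eq_mul]; ring
  have h2 : (k / 2 ^ (j + 2)) ^ (-P) * y ≤ T * (k ^ (-P) * y) := by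
    rw [Real.div_rpow hk.le (by positivity), Real.rpow_neg (x := 2 ^ (j + 2)) (by positivity),
      e2, div_inv_eq_mul, eT]
    have : (2 ^ P : ℝ) ^ ((j + 2 : ℕ) : ℝ) ≤ (2 ^ P) ^ (3 + 2 * (j : ℝ)) := by
      apply Real.rpow_le_rpow_of_exponent_le h2P
      push_cast
      have : (0 : ℝ) ≤ j := Nat.cast_nonneg j
      linarith
    have hky : 0 ≤ k ^ (-P) * y := by positivity
    nlinarith
  calc _ ≤ (T * ((L * θ ^ (-P) / ρ) * y)) ^ κ * (T * (k ^ (-P) * y)) ^ (1 - ϑ) := by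
        rw [h1]; gcongr
    _ = T ^ (1 + α) * ((L * θ ^ (-P) / ρ) ^ κ * (k ^ (-P)) ^ (1 - ϑ)) * y ^ (1 + α) := by
        rw [Real.mul_rpow hT0.le (by positivity), Real.mul_rpow hT0.le (by positivity),
          Real.mul_rpow (by positivity) hy, Real.mul_rpow (by positivity) hy, ← hα,
          Real.rpow_add_of_nonneg hT0.le hκ hϑ, Real.rpow_add_of_nonneg hy hκ hϑ]
        ring
    _ = _ := by
        have h4 : (((4 : ℝ) ^ P) ^ (j : ℝ)) ^ (1 + α) = ((4 ^ P) ^ (1 + α)) ^ (j : ℝ) := by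
          rw [← Real.rpow_mul (by positivity), mul_comm, Real.rpow_mul (by positivity)]
        rw [hT, Real.mul_rpow (by positivity) (by positivity), h4]
        ring

/-- Local boundedness from above in terms of the `L^P` norm of the positive part. -/
theorem le_of_lintegral_le {n : ℕ} (hn : 2 ≤ n) {p : Fin n → ℝ} (hp : ∀ i, 1 < p i)
    (hσ : 1 < ∑ i, 1 / p i) {P : ℝ} (hP : ∀ i, p i ≤ P) (hP2 : 2 ≤ P)
    (hPσ : P * ∑ i, 1 / p i < n + 2) (C₀ D : ℝ) :
    ∃ c : ℝ, 0 < c ∧ ∀ (δ : Fin n → ℝ), (∀ i, 0 ≤ δ i) → (∀ i, δ i ≤ D) →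
      ∀ (x₀ : Fin n → ℝ) (t₀ ρ : ℝ) (u : (Fin n → ℝ) × ℝ → ℝ) (g : Fin n → (Fin n → ℝ) × ℝ → ℝ),
      0 < ρ → LocalDG p δ P C₀ x₀ t₀ (2 * ρ) u g → ∀ r R, ρ ≤ r → r < R → R ≤ 2 * ρ →
      ∀ k : ℝ, 1 ≤ k → ρ ≤ k ^ P →
      ∫⁻ z in cyl p x₀ t₀ R, ‖max (u z) 0‖ₑ ^ P ≤
        ENNReal.ofReal (c * ((R - r) / ρ) ^ (P * (1 + ∑ i, 1 / p i)) * ρ ^ (1 + ∑ i, 1 / p i) *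
          k ^ (n + 2 - P * ∑ i, 1 / p i)) →
      ∀ᵐ z ∂(volume.restrict (cyl p x₀ t₀ r)), u z ≤ k := by
  obtain ⟨C, hC, hstep⟩ := deGiorgi_step hn hp hσ hP hP2 hPσ C₀ D
  obtain ⟨L, hL1, hcut⟩ := exists_cutoff hp hP (by linarith)
  set σ := ∑ i, 1 / p i with hσdef
  have hp0 : ∀ i, 0 < p i := fun i => by linarith [hp i]
  have hσ0 : 0 < σ := by linarith
  have hP0 : 0 < P := by linarith
  have hL0 : 0 < L := by linarith
  have hn2 : (0 : ℝ) < n + 2 := by positivity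
  set ϑ : ℝ := P * σ / (n + 2) with hϑ
  have hϑ1 : 0 < 1 - ϑ := by rw [hϑ, sub_pos, div_lt_one hn2]; exact hPσ
  set κ : ℝ := P * (1 + σ) / (n + 2) with hκ
  have hκ0 : 0 < κ := by positivity
  set α : ℝ := P / (n + 2) with hα
  have hα0 : 0 < α := by positivity
  have hκϑ : κ + (1 - ϑ) = 1 + α := by rw [hκ, hϑ, hα]; field_simp; ring
  set B : ℝ := (4 ^ P) ^ (1 + α) with hB
  have hB1 : 1 < B := Real.one_lt_rpow (Real.one_lt_rpow (by norm_num) hP0) (by linarith)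
  have hB0 : 0 < B := by linarith
  set C₁ : ℝ := (C.toReal + 1) * (8 ^ P) ^ (1 + α) * L ^ κ with hC₁
  have hCr : 0 ≤ C.toReal := ENNReal.toReal_nonneg
  have hC₁0 : 0 < C₁ := by positivity
  -- The solution c of C₁ c^α = B^(-1/α), the threshold in `fast_geometric_convergence`.
  refine ⟨(B ^ (-1 / α) / C₁) ^ (1 / α), by positivity, ?_⟩
  set c : ℝ := (B ^ (-1 / α) / C₁) ^ (1 / α) with hc
  have hc0 : 0 < c := by positivity
  intro δ hδ hδD x₀ t₀ ρ u g hρ hu r R hr hrR hR k hk hρk hint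
  have hum := hu.measurable
  have hr0 : 0 < r := by linarith
  set θ : ℝ := (R - r) / ρ with hθ
  have hθ0 : 0 < θ := div_pos (by linarith) hρ
  have hθ1 : θ ≤ 1 := by rw [hθ, div_le_one hρ]; linarith
  have hk0 : 0 < k := by linarith
  -- Radii fall from R to r while levels rise from 0 to k, so the starting integral is that of u₊^P.
  set rad : ℕ → ℝ := fun j => r + (R - r) / 2 ^ j with hrad
  set lev : ℕ → ℝ := fun j => k - k / 2 ^ j with hlev
  set Y : ℕ → ℝ≥0∞ := fun j => ∫⁻ z in cyl p x₀ t₀ (rad j), ‖max (u z - lev j) 0‖ₑ ^ P with hY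
  have hradr : ∀ j, r < rad j := fun j => by
    have : 0 < (R - r) / 2 ^ j := div_pos (by linarith) (by positivity)
    simp only [hrad]; linarith
  have hradR : ∀ j, rad j ≤ R := fun j => by
    have : (R - r) / 2 ^ j ≤ R - r := div_le_self (by linarith) (one_le_pow₀ (by norm_num))
    simp only [hrad]; linarith
  have hdiff : ∀ j, rad j - rad (j + 1) = (R - r) / 2 ^ (j + 1) := fun j => by
    simp only [hrad, pow_succ]; field_simp; ring
  have hradlt : ∀ j, rad (j + 1) < rad j := fun j => by
    have h1 : 0 < (R - r) / 2 ^ (j + 1) := div_pos (by linarith) (by positivity)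
    linarith [hdiff j]
  have hY0 : Y 0 = ∫⁻ z in cyl p x₀ t₀ R, ‖max (u z) 0‖ₑ ^ P := by
    simp [hY, hrad, hlev]
  have hYtop : ∀ j, Y j ≠ ⊤ := by
    intro j
    have hfin : IsFiniteMeasure (volume.restrict (cyl p x₀ t₀ (rad j))) :=
      ⟨by simpa using (volume_cyl_ne_top x₀ t₀ (hr0.trans (hradr j))).lt_top⟩
    have h1 : ∫⁻ z in cyl p x₀ t₀ (rad j), ‖u z‖ₑ ^ P ≠ ⊤ :=
      ne_top_of_le_ne_top hu.lintegral_ne_top (lintegral_mono_set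
        (cyl_subset_cyl hp0 x₀ t₀ (hr0.trans (hradr j)).le ((hradR j).trans hR)))
    refine ne_top_of_le_ne_top (lintegral_sub_const_rpow_ne_top hum hP0 le_rfl h1 (lev j)) ?_
    apply lintegral_mono; intro z
    refine ENNReal.rpow_le_rpow ?_ hP0.le
    rw [Real.enorm_eq_ofReal_abs, Real.enorm_eq_ofReal_abs, abs_of_nonneg (le_max_right _ _)]
    exact ENNReal.ofReal_le_ofReal (max_le (le_abs_self _) (abs_nonneg _))
  set y : ℕ → ℝ := fun j => (Y j).toReal with hy
  have hy0 : ∀ j, 0 ≤ y j := fun j => ENNReal.toReal_nonneg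
  have hYy : ∀ j, Y j = ENNReal.ofReal (y j) := fun j => (ENNReal.ofReal_toReal (hYtop j)).symm
  set K : ℝ := C₁ * (θ ^ (-P) / ρ) ^ κ * (k ^ (-P)) ^ (1 - ϑ) with hK
  have hK0 : 0 ≤ K := by positivity
  have hrec : ∀ j : ℕ, y (j + 1) ≤ K * B ^ (j : ℝ) * y j ^ (1 + α) := by
    intro j
    obtain ⟨ζ, hζ1, hζ2, hζ3, hζ4, hζ5, hζ6, hζ7⟩ := hcut x₀ t₀ ρ (rad (j + 1)) (rad j) hρ
      (hr.trans (hradr _).le) (hradlt j) ((hradR j).trans hR)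
    have hΛeq : (rad j - rad (j + 1)) / ρ = θ / 2 ^ (j + 1) := by
      rw [hdiff, hθ]; field_simp
    rw [hΛeq] at hζ5 hζ6 hζ7
    set Λ := L * (θ / 2 ^ (j + 1)) ^ (-P) / ρ with hΛ
    have hΛ0 : 0 ≤ Λ := by positivity
    set a : ℝ := k / 2 ^ (j + 2) with ha
    have ha0 : 0 < a := by positivity
    -- The one use of ρ ≤ k ^ P: it makes the Chebyshev constant at most the cut-off constant.
    have hkΛ : k ^ (-P) ≤ Λ := by
      have h1 : k ^ (-P) ≤ 1 / ρ := by
        rw [Real.rpow_neg hk0.le, ← one_div]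
        exact one_div_le_one_div_of_le hρ hρk
      have h2 : (1 : ℝ) ≤ (θ / 2 ^ (j + 1)) ^ (-P) := by
        apply Real.one_le_rpow_of_pos_of_le_one_of_nonpos (by positivity) _ (by linarith)
        exact (div_le_self hθ0.le (one_le_pow₀ (by norm_num))).trans hθ1
      refine h1.trans ?_
      rw [hΛ]
      gcongr
      nlinarith
    -- The energy is used at the level half-way between `lev j` and `lev (j + 1)`, which are 2a
    -- apart. With b = 2 ^ (j + 2) the condition 1 ≤ b a is 1 ≤ k.
    have h := hstep δ hδ hδD x₀ t₀ (2 * ρ) u g hu (rad (j + 1)) (rad j) Λ (hr0.trans (hradr _))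
      (hradlt j).le ((hradR j).trans hR) hΛ0 ζ hζ1 hζ2 hζ3
      hζ4 hζ5 hζ6 hζ7 (lev j + a) a (2 ^ (j + 2)) ha0 (one_le_pow₀ (by norm_num))
      (by rw [ha]; field_simp; exact hk)
      (by
        rw [ha, Real.div_rpow hk0.le (by positivity),
          Real.rpow_neg (x := 2 ^ (j + 2)) (by positivity), div_inv_eq_mul, mul_comm]
        gcongr)
    have e1 : ∀ z, u z - (lev j + a) - a = u z - lev (j + 1) := fun z => by
      simp only [hlev, ha, pow_succ]; field_simp; ring
    have e2 : ∀ z, u z - (lev j + a) + a = u z - lev j := fun z => by ring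
    simp_rw [e1, e2] at h
    change Y (j + 1) ≤ C * (ENNReal.ofReal ((2 ^ (j + 2)) ^ P * Λ) * Y j) ^ κ *
      (ENNReal.ofReal (a ^ (-P)) * Y j) ^ (1 - ϑ) at h
    rw [hYy j, ← ENNReal.ofReal_mul (by positivity), ← ENNReal.ofReal_mul (by positivity),
      ENNReal.ofReal_rpow_of_nonneg (by have := hy0 j; positivity) hκ0.le,
      ENNReal.ofReal_rpow_of_nonneg (by have := hy0 j; positivity) hϑ1.le,
      ← ENNReal.ofReal_toReal hC, ← ENNReal.ofReal_mul hCr, ← ENNReal.ofReal_mul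
        (by have := hy0 j; positivity), hYy (j + 1), ENNReal.ofReal_le_ofReal_iff
        (by have := hy0 j; positivity)] at h
    refine h.trans ?_
    have hcon := recursion_constants hP0 hL0 hθ0 hρ hk0 (hy0 j) hκ0.le hϑ1.le hκϑ j
    have hpos : 0 ≤ (((2 : ℝ) ^ (j + 2)) ^ P * Λ * y j) ^ κ * (a ^ (-P) * y j) ^ (1 - ϑ) := by
      have := hy0 j
      positivity
    calc _ = C.toReal * ((((2 : ℝ) ^ (j + 2)) ^ P * Λ * y j) ^ κ * (a ^ (-P) * y j) ^ (1 - ϑ)) := by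
          ring
      _ ≤ (C.toReal + 1) * ((((2 : ℝ) ^ (j + 2)) ^ P * Λ * y j) ^ κ *
            (a ^ (-P) * y j) ^ (1 - ϑ)) := by gcongr; linarith
      _ ≤ (C.toReal + 1) * (((8 ^ P) ^ (1 + α) * (L * θ ^ (-P) / ρ) ^ κ * (k ^ (-P)) ^ (1 - ϑ)) *
            ((4 ^ P) ^ (1 + α)) ^ (j : ℝ) * y j ^ (1 + α)) := by gcongr
      _ = _ := by
          rw [hK, hC₁, mul_div_assoc, Real.mul_rpow hL0.le (by positivity)]
          ring
  -- The powers of θ, ρ and k in the smallness hypothesis are those that cancel against K after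
  -- raising to α.
  have h0 : K * y 0 ^ α ≤ B ^ (-1 / α) := by
    have hy0' : y 0 ≤ c * θ ^ (P * (1 + σ)) * ρ ^ (1 + σ) * k ^ (n + 2 - P * σ) := by
      have : Y 0 ≤ ENNReal.ofReal (c * θ ^ (P * (1 + σ)) * ρ ^ (1 + σ) * k ^ (n + 2 - P * σ)) := by
        rw [hY0]; exact hint
      rw [hYy 0, ENNReal.ofReal_le_ofReal_iff (by positivity)] at this
      exact this
    calc K * y 0 ^ α ≤ K * (c * θ ^ (P * (1 + σ)) * ρ ^ (1 + σ) * k ^ (n + 2 - P * σ)) ^ α := by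
          gcongr
      _ = C₁ * c ^ α := by
          rw [hK, Real.mul_rpow (by positivity) (by positivity),
            Real.mul_rpow (by positivity) (by positivity),
            Real.mul_rpow (by positivity) (by positivity),
            Real.div_rpow (by positivity) hρ.le, ← Real.rpow_mul hθ0.le, ← Real.rpow_mul hθ0.le,
            ← Real.rpow_mul hρ.le, ← Real.rpow_mul hk0.le, ← Real.rpow_mul hk0.le]
          have e1 : θ ^ (-P * κ) * θ ^ (P * (1 + σ) * α) = 1 := by
            rw [← Real.rpow_add hθ0, show -P * κ + P * (1 + σ) * α = 0 by
              rw [hκ, hα]; field_simp; ring, Real.rpow_zero]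
          have e2 : ρ ^ ((1 + σ) * α) = ρ ^ κ := by
            congr 1; rw [hκ, hα]; field_simp
          have e3 : k ^ (-P * (1 - ϑ)) * k ^ ((n + 2 - P * σ) * α) = 1 := by
            rw [← Real.rpow_add hk0, show -P * (1 - ϑ) + (n + 2 - P * σ) * α = 0 by
              rw [hϑ, hα]; field_simp; ring, Real.rpow_zero]
          rw [e2]
          have hρκ : ρ ^ κ ≠ 0 := by positivity
          calc _ = C₁ * c ^ α * (θ ^ (-P * κ) * θ ^ (P * (1 + σ) * α)) *
                (k ^ (-P * (1 - ϑ)) * k ^ ((n + 2 - P * σ) * α)) * (ρ ^ κ / ρ ^ κ) := by ring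
            _ = _ := by rw [e1, e3, div_self hρκ]; ring
      _ = B ^ (-1 / α) := by
          rw [hc, ← Real.rpow_mul (by positivity), one_div_mul_cancel hα0.ne', Real.rpow_one]
          field_simp
      _ ≤ _ := le_rfl
  have hfast := fast_geometric_convergence hy0 hK0 hB1 hα0 hrec h0
  have hlim : Tendsto (fun j : ℕ => ENNReal.ofReal (y 0 * B ^ (-(j : ℝ) / α))) atTop (𝓝 0) := by
    have h1 : Tendsto (fun j : ℕ => y 0 * (B ^ (-1 / α)) ^ j) atTop (𝓝 (y 0 * 0)) := by
      apply Tendsto.const_mul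
      apply tendsto_pow_atTop_nhds_zero_of_lt_one (by positivity)
      exact Real.rpow_lt_one_of_one_lt_of_neg hB1 (div_neg_of_neg_of_pos (by norm_num) hα0)
    have h2 := ENNReal.tendsto_ofReal h1
    rw [mul_zero, ENNReal.ofReal_zero] at h2
    refine h2.congr fun j => ?_
    rw [← Real.rpow_natCast, ← Real.rpow_mul hB0.le]
    congr 3; ring
  have hzero : ∫⁻ z in cyl p x₀ t₀ r, ‖max (u z - k) 0‖ₑ ^ P ≤ 0 := by
    refine ge_of_tendsto' hlim fun j => ?_
    calc ∫⁻ z in cyl p x₀ t₀ r, ‖max (u z - k) 0‖ₑ ^ P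
        ≤ ∫⁻ z in cyl p x₀ t₀ (rad j), ‖max (u z - k) 0‖ₑ ^ P :=
          lintegral_mono_set (cyl_subset_cyl hp0 x₀ t₀ hr0.le (hradr j).le)
      _ ≤ Y j := by
          apply lintegral_mono; intro z
          refine ENNReal.rpow_le_rpow ?_ hP0.le
          rw [Real.enorm_of_nonneg (le_max_right _ _), Real.enorm_of_nonneg (le_max_right _ _)]
          apply ENNReal.ofReal_le_ofReal
          have : 0 < k / 2 ^ j := by positivity
          gcongr
          simp only [hlev]; linarith
      _ = ENNReal.ofReal (y j) := hYy j
      _ ≤ _ := ENNReal.ofReal_le_ofReal (hfast j)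
  have hm : Measurable fun z => ‖max (u z - k) 0‖ₑ ^ P :=
    ((hum.sub_const k).max measurable_const).enorm.pow_const _
  have hae := (lintegral_eq_zero_iff hm).1 (le_antisymm hzero zero_le)
  filter_upwards [hae] with z hz
  have h1 : ‖max (u z - k) 0‖ₑ = 0 := by
    simpa [ENNReal.rpow_eq_zero_iff_of_pos hP0] using hz
  rw [enorm_eq_zero] at h1
  have := le_max_left (u z - k) 0
  linarith

end Iteration
end AnisoDG

namespace AnisoDG

open Set MeasureTheory
open scoped ContDiff ENNReal

/-! ### Lowering the exponent from P to ν -/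

section Interpolation

open Function Filter Topology

/-- The constants in front of Z form an exact solution of the recursion: the map Z ↦ M b^j Z^β sends
the one at j + 1 to the one at j. Only the extra factor Z changes, and each step raises it to the
power β. -/
theorem sublinear_descent {Q : ℕ → ℝ → Prop} {M b β : ℝ} (hM : 1 ≤ M) (hb : 1 ≤ b) (hβ : 0 ≤ β)
    (hβ1 : β < 1) (hstep : ∀ j Z, 1 ≤ Z → Q (j + 1) Z → Q j (M * b ^ (j : ℝ) * Z ^ β)) (j : ℕ) :
    ∀ Z, 1 ≤ Z →
      Q j ((M * b ^ (β / (1 - β))) ^ (1 / (1 - β)) * b ^ ((j : ℝ) / (1 - β)) * Z) →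
      Q 0 ((M * b ^ (β / (1 - β))) ^ (1 / (1 - β)) * Z ^ (β ^ j)) := by
  have hb0 : 0 < b := by linarith
  have hβ' : 0 < 1 - β := by linarith
  set A : ℝ := M * b ^ (β / (1 - β)) with hA
  have hA1 : 1 ≤ A := one_le_mul_of_one_le_of_one_le hM (Real.one_le_rpow hb (by positivity))
  have hA0 : 0 < A := by linarith
  clear_value A
  induction j with
  | zero => intro Z _ h; simpa using h
  | succ j ih =>
    intro Z hZ h
    have hZ0 : 0 ≤ Z := by linarith
    have h1 : 1 ≤ A ^ (1 / (1 - β)) * b ^ (((j + 1 : ℕ) : ℝ) / (1 - β)) * Z :=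
      one_le_mul_of_one_le_of_one_le (one_le_mul_of_one_le_of_one_le
        (Real.one_le_rpow hA1 (by positivity)) (Real.one_le_rpow hb (by positivity))) hZ
    have h2 := hstep j _ h1 h
    have h3 := ih (Z ^ β) (Real.one_le_rpow hZ hβ) ?_
    · rwa [← Real.rpow_mul hZ0, ← pow_succ'] at h3
    · convert h2 using 1
      rw [Real.mul_rpow (by positivity) hZ0, Real.mul_rpow (by positivity) (by positivity),
        ← Real.rpow_mul hA0.le, ← Real.rpow_mul hb0.le, ← mul_assoc]
      congr 1
      have e1 : A ^ (1 / (1 - β)) = A * A ^ (1 / (1 - β) * β) := by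
        rw [← Real.rpow_one_add' hA0.le (by positivity)]
        congr 1; field_simp; ring
      have e2 : b ^ (β / (1 - β)) * b ^ ((j : ℝ) / (1 - β)) =
          b ^ (j : ℝ) * b ^ (((j + 1 : ℕ) : ℝ) / (1 - β) * β) := by
        rw [← Real.rpow_add hb0, ← Real.rpow_add hb0]
        congr 1; push_cast; field_simp; ring
      linear_combination b ^ ((j : ℝ) / (1 - β)) * e1 +
        A ^ (1 / (1 - β) * β) * b ^ ((j : ℝ) / (1 - β)) * hA + M * A ^ (1 / (1 - β) * β) * e2

/-- If a bound `Z` at step `j + 1` improves to a bound `M b ^ j Z ^ β` with `β < 1` at step `j`,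
and there is some bound common to all steps, then there is a bound at step `0` that depends only
on `M`, `b` and `β`. -/
theorem absorb_sublinear {Q : ℕ → ℝ → Prop} {M b β : ℝ} (hM : 1 ≤ M) (hb : 1 ≤ b) (hβ : 0 ≤ β)
    (hβ1 : β < 1) (hstep : ∀ j Z, 1 ≤ Z → Q (j + 1) Z → Q j (M * b ^ (j : ℝ) * Z ^ β))
    (hmono : ∀ j Z Z', Z ≤ Z' → Q j Z → Q j Z') (hinit : ∃ Z, ∀ j, Q j Z) :
    Q 0 ((M * b ^ (β / (1 - β))) ^ (1 / (1 - β)) * 2) := by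
  obtain ⟨Z₀, hZ₀⟩ := hinit
  set Z := max Z₀ 1 with hZ
  have hZ1 : 1 ≤ Z := le_max_right _ _
  have hβ' : 0 < 1 - β := by linarith
  have hA1 : 1 ≤ M * b ^ (β / (1 - β)) :=
    one_le_mul_of_one_le_of_one_le hM (Real.one_le_rpow hb (by positivity))
  have hlim : Tendsto (fun j : ℕ => Z ^ (β ^ j)) atTop (𝓝 (Z ^ (0 : ℝ))) :=
    ((Real.continuous_const_rpow (by linarith : Z ≠ 0)).tendsto 0).comp
      (tendsto_pow_atTop_nhds_zero_of_lt_one hβ hβ1)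
  rw [Real.rpow_zero] at hlim
  -- Any constant above 1 would do in place of 2. The number of steps depends on the initial bound,
  -- the result does not.
  obtain ⟨j, hj⟩ := (hlim.eventually (eventually_le_nhds (by norm_num : (1 : ℝ) < 2))).exists
  have h := sublinear_descent hM hb hβ hβ1 hstep j Z hZ1 (hmono j _ _ ?_ (hZ₀ j))
  · refine hmono 0 _ _ ?_ h
    gcongr
  · refine (le_max_left Z₀ 1).trans (le_mul_of_one_le_left (by linarith) ?_)
    exact one_le_mul_of_one_le_of_one_le (Real.one_le_rpow hA1 (by positivity))
      (Real.one_le_rpow hb (by positivity))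

/-- Local boundedness in terms of the `L^P` norm. -/
theorem abs_le_of_lintegral_le {n : ℕ} (hn : 2 ≤ n) {p : Fin n → ℝ} (hp : ∀ i, 1 < p i)
    (hσ : 1 < ∑ i, 1 / p i) {P : ℝ} (hP : ∀ i, p i ≤ P) (hP2 : 2 ≤ P)
    (hPσ : P * ∑ i, 1 / p i < n + 2) (C₀ D : ℝ) :
    ∃ c : ℝ, 0 < c ∧ ∀ (δ : Fin n → ℝ), (∀ i, 0 ≤ δ i) → (∀ i, δ i ≤ D) →
      ∀ (x₀ : Fin n → ℝ) (t₀ ρ : ℝ) (u : (Fin n → ℝ) × ℝ → ℝ) (g : Fin n → (Fin n → ℝ) × ℝ → ℝ),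
      0 < ρ → LocalDG p δ P C₀ x₀ t₀ (2 * ρ) u g →
      LocalDG p δ P C₀ x₀ t₀ (2 * ρ) (fun z => -u z) (fun i z => -g i z) →
      ∀ r R, ρ ≤ r → r < R → R ≤ 2 * ρ → ∀ k : ℝ, 1 ≤ k → ρ ≤ k ^ P →
      ∫⁻ z in cyl p x₀ t₀ R, ‖u z‖ₑ ^ P ≤
        ENNReal.ofReal (c * ((R - r) / ρ) ^ (P * (1 + ∑ i, 1 / p i)) * ρ ^ (1 + ∑ i, 1 / p i) *
          k ^ (n + 2 - P * ∑ i, 1 / p i)) →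
      ∀ᵐ z ∂(volume.restrict (cyl p x₀ t₀ r)), |u z| ≤ k := by
  obtain ⟨c, hc, h⟩ := le_of_lintegral_le hn hp hσ hP hP2 hPσ C₀ D
  refine ⟨c, hc, fun δ hδ hδD x₀ t₀ ρ u g hρ hu hu' r R hr hrR hR k hk hρk hint => ?_⟩
  have hle : ∀ s : ℝ, ‖max s 0‖ₑ ^ P ≤ ‖s‖ₑ ^ P := fun s => by
    refine ENNReal.rpow_le_rpow ?_ (by linarith)
    rw [Real.enorm_eq_ofReal_abs, Real.enorm_eq_ofReal_abs, abs_of_nonneg (le_max_right _ _)]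
    exact ENNReal.ofReal_le_ofReal (max_le (le_abs_self _) (abs_nonneg _))
  have h1 := h δ hδ hδD x₀ t₀ ρ u g hρ hu r R hr hrR hR k hk hρk
    ((lintegral_mono fun z => hle (u z)).trans hint)
  have h2 := h δ hδ hδD x₀ t₀ ρ _ _ hρ hu' r R hr hrR hR k hk hρk
    ((lintegral_mono fun z => (hle (-u z)).trans_eq (by rw [enorm_neg])).trans hint)
  filter_upwards [h1, h2] with z hz1 hz2
  exact abs_le.2 ⟨by linarith, hz1⟩

/-- The local sup bound in terms of the mean value of `|u| ^ ν`. -/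
theorem abs_le_average {n : ℕ} (hn : 2 ≤ n) {p : Fin n → ℝ} (hp : ∀ i, 1 < p i)
    (hσ : 1 < ∑ i, 1 / p i) {P : ℝ} (hP : ∀ i, p i ≤ P) (hP2 : 2 ≤ P)
    (hPσ : P * ∑ i, 1 / p i < n + 2) (C₀ D : ℝ) {ϖ ν : ℝ}
    (hω : ϖ = P - 2 + P * ∑ i, 1 / p i - n) (hων : ϖ < ν) (hνP : ν ≤ P) :
    ∃ C : ℝ, 0 < C ∧ ∀ (δ : Fin n → ℝ), (∀ i, 0 ≤ δ i) → (∀ i, δ i ≤ D) →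
      ∀ (x₀ : Fin n → ℝ) (t₀ ρ : ℝ) (u : (Fin n → ℝ) × ℝ → ℝ) (g : Fin n → (Fin n → ℝ) × ℝ → ℝ),
      0 < ρ → LocalDG p δ P C₀ x₀ t₀ (2 * ρ) u g →
      LocalDG p δ P C₀ x₀ t₀ (2 * ρ) (fun z => -u z) (fun i z => -g i z) →
      ∀ᵐ z ∂(volume.restrict (cyl p x₀ t₀ ρ)), |u z| ≤
        C * ((⨍ z in cyl p x₀ t₀ (2 * ρ), |u z| ^ ν) ^ (1 / (ν - ϖ)) + 1 + ρ ^ (1 / P)) := by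
  obtain ⟨c, hc, hbd⟩ := abs_le_of_lintegral_le hn hp hσ hP hP2 hPσ C₀ D
  set σ := ∑ i, 1 / p i with hσdef
  have hp0 : ∀ i, 0 < p i := fun i => by linarith [hp i]
  have hP0 : 0 < P := by linarith
  have hσ0 : 0 < σ := by linarith
  have hPω : P - ϖ = n + 2 - P * σ := by rw [hω]; ring
  have hPω0 : 0 < P - ϖ := by linarith
  -- Both parts are nonnegative: P ≥ 2, and P σ ≥ n because every p i ≤ P. Hence ν > 0.
  have hω0 : 0 ≤ ϖ := by
    have h1 : ∑ i : Fin n, 1 / P ≤ σ :=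
      Finset.sum_le_sum fun i _ => one_div_le_one_div_of_le (hp0 i) (hP i)
    have h2 : (n : ℝ) ≤ P * σ := by
      calc (n : ℝ) = P * ∑ i : Fin n, 1 / P := by simp; field_simp
        _ ≤ _ := by gcongr
    rw [hω]; linarith
  have hν0 : 0 < ν := by linarith
  have hνω : 0 < ν - ϖ := by linarith
  -- The smallness condition asks for k^(P-ϖ) of the order of sup^(P-ν), so k is of the order of
  -- sup^β; β < 1 means ν > ϖ.
  set β : ℝ := (P - ν) / (P - ϖ) with hβ
  have hβ0 : 0 ≤ β := div_nonneg (by linarith) hPω0.le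
  have hβ1 : β < 1 := by rw [hβ, div_lt_one hPω0]; linarith
  set V : ℝ := 2 ^ n * 2 ^ (1 + σ) with hV
  have hV0 : 0 < V := by positivity
  -- V / c compares the volume of the large cylinder with the smallness constant. The factors 4 ^ A
  -- and 2 ^ A below compensate the gap 1 / (4 * 2 ^ j) between consecutive radii.
  set M₀ : ℝ := max 1 (V / c) with hM₀
  have hM₀1 : 1 ≤ M₀ := le_max_left _ _
  set A : ℝ := P * (1 + σ) with hA
  have hA0 : 0 < A := by positivity
  set M : ℝ := (M₀ * 4 ^ A) ^ (1 / (P - ϖ)) with hM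
  set b : ℝ := (2 ^ A) ^ (1 / (P - ϖ)) with hb
  have hM1 : 1 ≤ M := Real.one_le_rpow (one_le_mul_of_one_le_of_one_le hM₀1
    (Real.one_le_rpow (by norm_num) hA0.le)) (by positivity)
  have hb1 : 1 ≤ b := Real.one_le_rpow (Real.one_le_rpow (by norm_num) hA0.le) (by positivity)
  have hM0 : 0 < M := by linarith
  have hb0 : 0 < b := by linarith
  have hβ' : 0 < 1 - β := by linarith
  refine ⟨(M * b ^ (β / (1 - β))) ^ (1 / (1 - β)) * 2, by positivity, ?_⟩
  intro δ hδ hδD x₀ t₀ ρ u g hρ hu hu'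
  have hum := hu.measurable
  set I : ℝ := ⨍ z in cyl p x₀ t₀ (2 * ρ), |u z| ^ ν with hI
  have hI0 : 0 ≤ I := by
    rw [hI, setAverage_eq]
    exact smul_nonneg (by positivity) (integral_nonneg fun z => by positivity)
  -- All bounds are measured as multiples Z X. For a multiple at least 1 the conditions k ≥ 1 and
  -- k^P ≥ ρ hold automatically.
  set X : ℝ := I ^ (1 / (ν - ϖ)) + 1 + ρ ^ (1 / P) with hX
  have hX1 : 1 ≤ X := by
    have h1 : 0 ≤ I ^ (1 / (ν - ϖ)) := by positivity
    have h2 : 0 ≤ ρ ^ (1 / P) := by positivity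
    linarith
  have hX0 : 0 < X := by linarith
  have hρX : ρ ≤ X ^ P := by
    calc ρ = (ρ ^ (1 / P)) ^ P := by
          rw [← Real.rpow_mul hρ.le, one_div_mul_cancel hP0.ne', Real.rpow_one]
      _ ≤ X ^ P := by
          have h1 : 0 ≤ I ^ (1 / (ν - ϖ)) := by positivity
          gcongr
          linarith
  have hIX : I ≤ X ^ (ν - ϖ) := by
    calc I = (I ^ (1 / (ν - ϖ))) ^ (ν - ϖ) := by
          rw [← Real.rpow_mul hI0, one_div_mul_cancel hνω.ne', Real.rpow_one]
      _ ≤ X ^ (ν - ϖ) := by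
          have h1 : 0 ≤ ρ ^ (1 / P) := by positivity
          gcongr
          linarith
  have h2ρ : 0 < 2 * ρ := by linarith
  have hvol : (volume (cyl p x₀ t₀ (2 * ρ))).toReal = V * ρ ^ (1 + σ) := by
    rw [volume_cyl x₀ t₀ h2ρ, ENNReal.toReal_ofReal (by positivity),
      Real.mul_rpow (by norm_num) hρ.le, hV]
    ring
  have hfin : IsFiniteMeasure (volume.restrict (cyl p x₀ t₀ (2 * ρ))) :=
    ⟨by simpa using (volume_cyl_ne_top x₀ t₀ h2ρ).lt_top⟩
  have hν_lint : ∫⁻ z in cyl p x₀ t₀ (2 * ρ), ‖u z‖ₑ ^ ν =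
      ENNReal.ofReal (V * ρ ^ (1 + σ) * I) := by
    have hne := lintegral_rpow_ne_top_of_le hum hν0 hνP hu.lintegral_ne_top
    have e1 : ∀ z, ‖u z‖ₑ ^ ν = ENNReal.ofReal (|u z| ^ ν) := fun z => by
      rw [Real.enorm_eq_ofReal_abs, ENNReal.ofReal_rpow_of_nonneg (abs_nonneg _) hν0.le]
    simp_rw [e1] at hne ⊢
    have hint : IntegrableOn (fun z => |u z| ^ ν) (cyl p x₀ t₀ (2 * ρ)) :=
      ⟨(hum.abs.pow_const _).aestronglyMeasurable, by
        rw [hasFiniteIntegral_iff_ofReal (ae_of_all _ fun z => by positivity)]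
        exact hne.lt_top⟩
    rw [← ofReal_integral_eq_lintegral_ofReal hint (ae_of_all _ fun z => by positivity)]
    congr 1
    rw [hI, setAverage_eq, measureReal_def, hvol, smul_eq_mul]
    field_simp
  -- The radii stay below 3ρ/2, leaving room up to 2ρ for a first bound common to all of them.
  set rad : ℕ → ℝ := fun j => 3 / 2 * ρ - ρ / 2 / 2 ^ j with hrad
  have hrad_ge : ∀ j, ρ ≤ rad j := fun j => by
    have : ρ / 2 / 2 ^ j ≤ ρ / 2 := div_le_self (by positivity) (one_le_pow₀ (by norm_num))
    simp only [hrad]; linarith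
  have hrad_lt : ∀ j, rad j < 3 / 2 * ρ := fun j => by
    have : 0 < ρ / 2 / 2 ^ j := by positivity
    simp only [hrad]; linarith
  have hdiff : ∀ j, rad (j + 1) - rad j = ρ / (4 * 2 ^ j) := fun j => by
    simp only [hrad, pow_succ]; field_simp; ring
  have hrad_mono : ∀ j, rad j < rad (j + 1) := fun j => by
    have : 0 < ρ / (4 * 2 ^ j) := by positivity
    linarith [hdiff j]
  have hmain := absorb_sublinear
    (Q := fun j Z => ∀ᵐ z ∂(volume.restrict (cyl p x₀ t₀ (rad j))), |u z| ≤ Z * X)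
    hM1 hb1 hβ0 hβ1 ?_ ?_ ?_
  · have : rad 0 = ρ := by simp only [hrad]; ring
    rwa [this] at hmain
  · intro j Z hZ hQ
    have hZ0 : 0 < Z := by linarith
    have hk1 : 1 ≤ M * b ^ (j : ℝ) * Z ^ β := one_le_mul_of_one_le_of_one_le
      (one_le_mul_of_one_le_of_one_le hM1 (Real.one_le_rpow hb1 (by positivity)))
      (Real.one_le_rpow hZ hβ0)
    have hkX : X ≤ M * b ^ (j : ℝ) * Z ^ β * X := le_mul_of_one_le_left hX0.le hk1
    refine hbd δ hδ hδD x₀ t₀ ρ u g hρ hu hu' (rad j) (rad (j + 1)) (hrad_ge j) (hrad_mono j)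
      (by linarith [hrad_lt (j + 1)]) _ (hX1.trans hkX)
      (hρX.trans (Real.rpow_le_rpow hX0.le hkX hP0.le)) ?_
    calc ∫⁻ z in cyl p x₀ t₀ (rad (j + 1)), ‖u z‖ₑ ^ P
        ≤ ∫⁻ z in cyl p x₀ t₀ (rad (j + 1)), ENNReal.ofReal ((Z * X) ^ (P - ν)) * ‖u z‖ₑ ^ ν := by
          apply lintegral_mono_ae
          filter_upwards [hQ] with z hz
          rw [Real.enorm_eq_ofReal_abs, ENNReal.ofReal_rpow_of_nonneg (abs_nonneg _) hP0.le,
            ENNReal.ofReal_rpow_of_nonneg (abs_nonneg _) hν0.le,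
            ← ENNReal.ofReal_mul (by positivity)]
          apply ENNReal.ofReal_le_ofReal
          rw [show P = (P - ν) + ν by ring, Real.rpow_add_of_nonneg (abs_nonneg _) (by linarith)
            hν0.le, show P - ν + ν - ν = P - ν by ring]
          gcongr
      _ = ENNReal.ofReal ((Z * X) ^ (P - ν)) *
            ∫⁻ z in cyl p x₀ t₀ (rad (j + 1)), ‖u z‖ₑ ^ ν :=
          lintegral_const_mul' _ _ ENNReal.ofReal_ne_top
      _ ≤ ENNReal.ofReal ((Z * X) ^ (P - ν)) * ENNReal.ofReal (V * ρ ^ (1 + σ) * I) := by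
          rw [← hν_lint]
          gcongr
          exact cyl_subset_cyl hp0 x₀ t₀ (hρ.le.trans (hrad_ge _)) (by linarith [hrad_lt (j + 1)])
      _ = ENNReal.ofReal ((Z * X) ^ (P - ν) * (V * ρ ^ (1 + σ) * I)) :=
          (ENNReal.ofReal_mul (by positivity)).symm
      _ ≤ _ := by
          apply ENNReal.ofReal_le_ofReal
          rw [hdiff, ← hPω]
          have e1 : (M * b ^ (j : ℝ) * Z ^ β * X) ^ (P - ϖ) =
              M₀ * 4 ^ A * (2 ^ A) ^ (j : ℝ) * Z ^ (P - ν) * X ^ (P - ϖ) := by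
            rw [Real.mul_rpow (by positivity) hX0.le, Real.mul_rpow (by positivity) (by positivity),
              Real.mul_rpow (by positivity) (by positivity), hM, hb,
              ← Real.rpow_mul (x := M₀ * 4 ^ A) (by positivity), one_div_mul_cancel hPω0.ne',
              Real.rpow_one, ← Real.rpow_mul (x := 2 ^ A) (by positivity),
              ← Real.rpow_mul (x := 2 ^ A) (by positivity), ← Real.rpow_mul hZ0.le,
              show 1 / (P - ϖ) * (j : ℝ) * (P - ϖ) = j by field_simp,
              show β * (P - ϖ) = P - ν by rw [hβ]; field_simp]
          have e2 : (ρ / (4 * 2 ^ j) / ρ) ^ A * (4 ^ A * (2 ^ A) ^ (j : ℝ)) = 1 := by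
            rw [show ρ / (4 * 2 ^ j) / ρ = (4 * (2 : ℝ) ^ (j : ℝ))⁻¹ by
              rw [Real.rpow_natCast]; field_simp, Real.inv_rpow (by positivity),
              Real.mul_rpow (by norm_num) (by positivity), ← Real.rpow_mul (by norm_num),
              ← Real.rpow_mul (by norm_num), mul_comm A]
            exact inv_mul_cancel₀ (by positivity)
          have e3 : X ^ (P - ϖ) = X ^ (P - ν) * X ^ (ν - ϖ) := by
            rw [← Real.rpow_add hX0]; congr 1; ring
          have hVM : V ≤ c * M₀ := by
            calc V = c * (V / c) := by field_simp
              _ ≤ c * M₀ := by gcongr; exact le_max_right _ _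
          rw [e1, Real.mul_rpow hZ0.le hX0.le]
          calc Z ^ (P - ν) * X ^ (P - ν) * (V * ρ ^ (1 + σ) * I)
              ≤ Z ^ (P - ν) * X ^ (P - ν) * (c * M₀ * ρ ^ (1 + σ) * X ^ (ν - ϖ)) := by gcongr
            _ = ((ρ / (4 * 2 ^ j) / ρ) ^ A * (4 ^ A * (2 ^ A) ^ (j : ℝ))) *
                  (c * M₀ * ρ ^ (1 + σ) * Z ^ (P - ν) * X ^ (P - ϖ)) := by rw [e2, e3]; ring
            _ = _ := by ring
  · intro j Z Z' hZ hQ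
    filter_upwards [hQ] with z hz
    exact hz.trans (by gcongr)
  -- A purely qualitative bound on the cylinder of radius 3ρ/2, from finiteness of the L^P norm. It
  -- depends on u, which is harmless since `absorb_sublinear` only needs its existence.
  · set c' : ℝ := c * ((2 * ρ - 3 / 2 * ρ) / ρ) ^ A * ρ ^ (1 + σ) with hc'
    have hc'0 : 0 < c' := by
      have : 0 < (2 * ρ - 3 / 2 * ρ) / ρ := div_pos (by linarith) hρ
      positivity
    set J : ℝ := (∫⁻ z in cyl p x₀ t₀ (2 * ρ), ‖u z‖ₑ ^ P).toReal with hJ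
    have hJ0 : 0 ≤ J := ENNReal.toReal_nonneg
    set k : ℝ := max X ((J / c') ^ (1 / (P - ϖ))) with hk
    have hkX : X ≤ k := le_max_left _ _
    have hres := hbd δ hδ hδD x₀ t₀ ρ u g hρ hu hu' (3 / 2 * ρ) (2 * ρ) (by linarith) (by linarith)
      le_rfl k (hX1.trans hkX) (hρX.trans (Real.rpow_le_rpow hX0.le hkX hP0.le)) (by
        rw [← ENNReal.ofReal_toReal hu.lintegral_ne_top, ← hPω, ← hJ]
        apply ENNReal.ofReal_le_ofReal
        calc J = c' * ((J / c') ^ (1 / (P - ϖ))) ^ (P - ϖ) := by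
              rw [← Real.rpow_mul (by positivity), one_div_mul_cancel hPω0.ne', Real.rpow_one]
              field_simp
          _ ≤ c' * k ^ (P - ϖ) := by
              gcongr
              exact le_max_right _ _)
    refine ⟨k / X, fun j => ?_⟩
    have hsub : cyl p x₀ t₀ (rad j) ⊆ cyl p x₀ t₀ (3 / 2 * ρ) :=
      cyl_subset_cyl hp0 x₀ t₀ (hρ.le.trans (hrad_ge j)) (hrad_lt j).le
    filter_upwards [ae_restrict_of_ae_restrict_of_subset hsub hres] with z hz
    rwa [div_mul_cancel₀ _ hX0.ne']

end Interpolation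
end AnisoDG

namespace AnisoDG

open Set MeasureTheory
open scoped ContDiff ENNReal

/-! ### Passage to measurable representatives -/

section Representative

open Function Filter Topology

theorem ae_slice_of_ae_cyl {n : ℕ} {p : Fin n → ℝ} {x₀ : Fin n → ℝ} {t₀ R : ℝ}
    {S : (Fin n → ℝ) × ℝ → Prop} (h : ∀ᵐ z ∂(volume.restrict (cyl p x₀ t₀ R)), S z) :
    ∀ᵐ t ∂(volume.restrict (Ioo (t₀ - R) t₀)), ∀ᵐ x ∂(volume.restrict (box p x₀ R)), S (x, t) := by
  rw [cyl, Measure.volume_eq_prod, ← Measure.prod_restrict] at h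
  exact Measure.ae_ae_of_ae_prod (Measure.measurePreserving_swap.quasiMeasurePreserving.ae h)

/-- The energy inequality does not depend on the representatives. -/
theorem EnergyIneq.congr_ae {n : ℕ} {p δ : Fin n → ℝ} {C₀ : ℝ} {x₀ : Fin n → ℝ} {t₀ R : ℝ}
    {w w' : (Fin n → ℝ) × ℝ → ℝ} {A A' : Set ((Fin n → ℝ) × ℝ)}
    {g g' : Fin n → (Fin n → ℝ) × ℝ → ℝ} {ζ : (Fin n → ℝ) × ℝ → ℝ}
    (h : EnergyIneq p δ C₀ x₀ t₀ R w A g ζ)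
    (hw : ∀ᵐ z ∂(volume.restrict (cyl p x₀ t₀ R)), w z = w' z)
    (hA : ∀ᵐ z ∂(volume.restrict (cyl p x₀ t₀ R)), z ∈ A ↔ z ∈ A')
    (hg : ∀ i, ∀ᵐ z ∂(volume.restrict (cyl p x₀ t₀ R)), |g i z| = |g' i z|) :
    EnergyIneq p δ C₀ x₀ t₀ R w' A' g' ζ := by
  have h1 : sliceEnergy p x₀ R w ζ =ᵐ[volume.restrict (Ioo (t₀ - R) t₀)]
      sliceEnergy p x₀ R w' ζ := by
    filter_upwards [ae_slice_of_ae_cyl hw] with t ht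
    refine lintegral_congr_ae ?_
    filter_upwards [ht] with x hx
    rw [hx]
  have h2 : gradEnergy p δ x₀ t₀ R g A ζ = gradEnergy p δ x₀ t₀ R g' A' ζ := by
    refine Finset.sum_congr rfl fun i _ => lintegral_congr_ae ?_
    filter_upwards [hA, hg i] with z hz hgz
    by_cases hzA : z ∈ A
    · rw [indicator_of_mem hzA, indicator_of_mem (hz.1 hzA), hgz]
    · rw [indicator_of_notMem hzA, indicator_of_notMem (mt hz.2 hzA)]
  have h3 : cutoffEnergy p x₀ t₀ R w ζ = cutoffEnergy p x₀ t₀ R w' ζ := by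
    unfold cutoffEnergy
    congr 1
    · refine lintegral_congr_ae ?_
      filter_upwards [hw] with z hz
      rw [hz]
    · refine Finset.sum_congr rfl fun i _ => lintegral_congr_ae ?_
      filter_upwards [hw] with z hz
      rw [hz]
  unfold EnergyIneq at h ⊢
  rwa [← essSup_congr_ae h1, ← h2, ← h3]

theorem MemLpLoc.lintegral_ne_top {X : Type*} [TopologicalSpace X] [MeasureSpace X] {q : ℝ}
    {U A : Set X} {f f' : X → ℝ} (h : MemLpLoc q U f) (hq : 0 < q) (hA : CompactlyContained A U)
    (hf : f' =ᵐ[volume.restrict A] f) : ∫⁻ x in A, ‖f' x‖ₑ ^ q ≠ ⊤ := by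
  have h1 := h _ hA.1 hA.2
  have h3 := lintegral_rpow_enorm_lt_top_of_eLpNorm_lt_top (by simpa using hq) (by simp) h1.2
  rw [ENNReal.toReal_ofReal hq.le] at h3
  refine ne_top_of_le_ne_top h3.ne ?_
  calc ∫⁻ x in A, ‖f' x‖ₑ ^ q = ∫⁻ x in A, ‖f x‖ₑ ^ q := by
        refine lintegral_congr_ae ?_
        filter_upwards [hf] with x hx
        rw [hx]
    _ ≤ _ := lintegral_mono_set subset_closure

/-- Restricting a set integral against a function supported in a smaller set. -/
theorem setIntegral_mul_eq_of_support {X : Type*} [MeasurableSpace X] {μ : Measure X}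
    {A U : Set X} (hU : MeasurableSet U) (hAU : A ⊆ U) {v v' ψ : X → ℝ}
    (hψ : support ψ ⊆ A) (hv : v' =ᵐ[μ.restrict A] v) :
    ∫ x in U, v x * ψ x ∂μ = ∫ x, v' x * ψ x ∂μ := by
  have hz : ∀ x ∉ A, ψ x = 0 := fun x hx => by
    by_contra h
    exact hx (hψ h)
  calc ∫ x in U, v x * ψ x ∂μ = ∫ x in A, v x * ψ x ∂μ :=
        setIntegral_eq_of_subset_of_forall_sdiff_eq_zero hU hAU fun x hx => by
          rw [hz x hx.2, mul_zero]
    _ = ∫ x in A, v' x * ψ x ∂μ := by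
        refine integral_congr_ae ?_
        filter_upwards [hv] with x hx
        rw [hx]
    _ = _ := setIntegral_eq_integral_of_forall_compl_eq_zero fun x hx => by rw [hz x hx, mul_zero]

/-- The function and its gradient are replaced by measurable versions on the cylinder, which leaves
the energy unchanged. The lower truncation of u at level -k is the upper truncation of -u at level
k, so the two-sided class becomes two one-sided statements. -/
theorem DeGiorgiClass.exists_localDG {n : ℕ} {p δ : Fin n → ℝ} {Ω : Set (Fin n → ℝ)} {T C₀ : ℝ}
    {u : (Fin n → ℝ) × ℝ → ℝ} (hp : ∀ i, 1 < p i) (hΩ : IsOpen Ω)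
    (hu : DeGiorgiClass p δ Ω T C₀ u) {x₀ : Fin n → ℝ} {t₀ R₀ : ℝ} (hR₀ : 0 < R₀)
    (hcc : CompactlyContained (cyl p x₀ t₀ R₀) (spaceTime Ω T)) :
    ∃ v g, v =ᵐ[volume.restrict (cyl p x₀ t₀ R₀)] u ∧ LocalDG p δ (bigP p) C₀ x₀ t₀ R₀ v g ∧
      LocalDG p δ (bigP p) C₀ x₀ t₀ R₀ (fun z => -v z) (fun i z => -g i z) := by
  obtain ⟨hum, huP, G, hG, hen⟩ := hu
  have hp0 : ∀ i, 0 < p i := fun i => by linarith [hp i]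
  have hP0 : 0 < bigP p := lt_of_lt_of_le (by norm_num) (le_max_left _ _)
  set Q := cyl p x₀ t₀ R₀ with hQ
  have hQsub : Q ⊆ spaceTime Ω T := subset_closure.trans hcc.2
  have hGm : ∀ i, AEMeasurable (G i) (volume.restrict Q) := fun i =>
    ((hG.memLpLoc_grad_p i _ hcc.1 hcc.2).1.mono_measure
      (Measure.restrict_mono subset_closure le_rfl)).aemeasurable
  have hum' : AEMeasurable u (volume.restrict Q) :=
    hum.mono_measure (Measure.restrict_mono hQsub le_rfl)
  set v := hum'.mk u with hv
  have hvm : Measurable v := hum'.measurable_mk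
  have hvu : v =ᵐ[volume.restrict Q] u := hum'.ae_eq_mk.symm
  set g : Fin n → (Fin n → ℝ) × ℝ → ℝ := fun i => (hGm i).mk (G i) with hg
  have hgm : ∀ i, Measurable (g i) := fun i => (hGm i).measurable_mk
  have hgG : ∀ i, g i =ᵐ[volume.restrict Q] G i := fun i => (hGm i).ae_eq_mk.symm
  have hbox : (box p x₀ R₀).Nonempty :=
    ⟨x₀, fun i _ => by
      have : 0 < R₀ ^ (1 / p i) := by positivity
      exact ⟨by linarith, by linarith⟩⟩
  have hI : (Ioo (t₀ - R₀) t₀).Nonempty := nonempty_Ioo.2 (by linarith)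
  have hsub : box p x₀ R₀ ⊆ Ω ∧ Ioo (t₀ - R₀) t₀ ⊆ Ioo 0 T := by
    rcases prod_subset_prod_iff.1 hQsub with h | h | h
    · exact h
    · exact absurd h hbox.ne_empty
    · exact absurd h hI.ne_empty
  -- The exceptional times are fixed before the test function: those excluded in `slice` and those
  -- at which the representatives differ on a set of positive measure of the slice.
  have hweak : ∀ᵐ t ∂(volume.restrict (Ioo (t₀ - R₀) t₀)), ∀ i, ∀ φ : (Fin n → ℝ) → ℝ,
      ContDiff ℝ ∞ φ → HasCompactSupport φ → tsupport φ ⊆ box p x₀ R₀ →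
      ∫ x, v (x, t) * fderiv ℝ φ x (Pi.single i 1) = - ∫ x, g i (x, t) * φ x := by
    have h1 := ae_restrict_of_ae_restrict_of_subset hsub.2 hG.slice
    have h2 := ae_slice_of_ae_cyl hvu
    have h3 := ae_all_iff.2 fun i => ae_slice_of_ae_cyl (hgG i)
    filter_upwards [h1, h2, h3] with t ht1 ht2 ht3 i φ hφ hφc hφs
    rw [← setIntegral_mul_eq_of_support hΩ.measurableSet hsub.1
        (fun x hx => hφs (support_fderiv_subset ℝ fun h => hx (by rw [h]; rfl))) ht2,
      ← setIntegral_mul_eq_of_support hΩ.measurableSet hsub.1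
        ((subset_tsupport φ).trans hφs) (ht3 i)]
    exact ht1.integral_eq i φ hφ hφc (hφs.trans hsub.1)
  have hcR : ∀ R, 0 < R → R ≤ R₀ → cyl p x₀ t₀ R ⊆ Q := fun R hR hRR =>
    cyl_subset_cyl hp0 x₀ t₀ hR.le hRR
  have hccR : ∀ R, 0 < R → R ≤ R₀ → CompactlyContained (cyl p x₀ t₀ R) (spaceTime Ω T) :=
    fun R hR hRR => ⟨hcc.1.of_isClosed_subset isClosed_closure (closure_mono (hcR R hR hRR)),
      (closure_mono (hcR R hR hRR)).trans hcc.2⟩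
  refine ⟨v, g, hvu, ⟨hvm, hgm, huP.lintegral_ne_top hP0 hcc hvu,
    fun i => (hG.memLpLoc_grad_p i).lintegral_ne_top (hp0 i) hcc (hgG i), hweak, ?_⟩,
    ⟨hvm.neg, fun i => (hgm i).neg, ?_, fun i => ?_, ?_, ?_⟩⟩
  · intro R hR hRR k ζ hζ
    have h := (hen x₀ t₀ R hR (hccR R hR hRR) k ζ hζ).1
    have hvR := ae_restrict_of_ae_restrict_of_subset (hcR R hR hRR) hvu
    refine h.congr_ae ?_ ?_ fun i => ?_
    · filter_upwards [hvR] with z hz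
      rw [hz]
    · filter_upwards [hvR] with z hz
      rw [hz]
    · filter_upwards [ae_restrict_of_ae_restrict_of_subset (hcR R hR hRR) (hgG i)] with z hz
      rw [hz]
  · simp_rw [enorm_neg]
    exact huP.lintegral_ne_top hP0 hcc hvu
  · simp_rw [enorm_neg]
    exact (hG.memLpLoc_grad_p i).lintegral_ne_top (hp0 i) hcc (hgG i)
  · filter_upwards [hweak] with t ht i φ hφ hφc hφs
    simp_rw [neg_mul, integral_neg]
    rw [ht i φ hφ hφc hφs]
  · intro R hR hRR k ζ hζ
    have h := (hen x₀ t₀ R hR (hccR R hR hRR) (-k) ζ hζ).2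
    have hvR := ae_restrict_of_ae_restrict_of_subset (hcR R hR hRR) hvu
    refine h.congr_ae ?_ ?_ fun i => ?_
    · filter_upwards [hvR] with z hz
      rw [hz]
      congr 1; ring
    · filter_upwards [hvR] with z hz
      rw [hz, lt_neg]
    · filter_upwards [ae_restrict_of_ae_restrict_of_subset (hcR R hR hRR) (hgG i)] with z hz
      rw [hz, abs_neg]

end Representative
end AnisoDG

/-! ### The main theorem -/

theorem theorem2 (n : ℕ) (hn : 2 ≤ n) (p : Fin n → ℝ)
    (hp : ∀ i, 1 < p i ∧ p i < AnisoDG.pbar p * (1 + 2 / (n : ℝ)))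
    (hpn : AnisoDG.pbar p < n)
    (hsuper : 2 * (n : ℝ) / ((n : ℝ) + 2) < AnisoDG.pbar p)
    (C₀ : ℝ) (hC₀ : 0 < C₀) (D : ℝ)
    (ν : ℝ) (hν : ν ∈ Set.Ioc (AnisoDG.omega p) (AnisoDG.bigP p)) :
    ∃ C : ℝ, 0 < C ∧
      ∀ δ : Fin n → ℝ, (∀ i, 0 ≤ δ i) → (⨆ i, δ i) = D →
      ∀ Ω : Set (Fin n → ℝ), IsOpen Ω → IsConnected Ω → Bornology.IsBounded Ω →
      ∀ T : ℝ, 0 < T →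
      ∀ u : (Fin n → ℝ) × ℝ → ℝ, AnisoDG.DeGiorgiClass p δ Ω T C₀ u →
      ∀ (x₀ : Fin n → ℝ) (t₀ ρ : ℝ), 0 < ρ →
        AnisoDG.CompactlyContained (AnisoDG.cyl p x₀ t₀ (2 * ρ)) (AnisoDG.spaceTime Ω T) →
        essSup (fun z => ‖u z‖ₑ) (MeasureTheory.volume.restrict (AnisoDG.cyl p x₀ t₀ ρ)) ≤
          ENNReal.ofReal (C *
            ((⨍ z in AnisoDG.cyl p x₀ t₀ (2 * ρ), |u z| ^ ν) ^ (1 / (ν - AnisoDG.omega p))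
              + 1 + ρ ^ (1 / AnisoDG.bigP p))) := by
  open AnisoDG MeasureTheory in
  have hn0 : (0 : ℝ) < n := by exact_mod_cast (by omega : 0 < n)
  have : Nonempty (Fin n) := ⟨⟨0, by omega⟩⟩
  have hp0 : ∀ i, 0 < p i := fun i => by linarith [(hp i).1]
  set σ := ∑ i, 1 / p i with hσdef
  have hσ0 : 0 < σ := Finset.sum_pos (fun i _ => one_div_pos.2 (hp0 i)) Finset.univ_nonempty
  -- In terms of σ the hypotheses read σ > 1, p i * σ < n + 2 and 2 * σ < n + 2. As P is 2 or one of
  -- the p i, the last two give P * σ < n + 2.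
  have hpbar : pbar p = n / σ := by
    rw [pbar, ← hσdef]; field_simp
  have hσ1 : 1 < σ := by
    rw [hpbar, div_lt_iff₀ hσ0] at hpn
    nlinarith
  have hub : ∀ i, p i * σ < n + 2 := fun i => by
    have h := (hp i).2
    have e : pbar p * (1 + 2 / (n : ℝ)) = (n + 2) / σ := by rw [hpbar]; field_simp
    rwa [e, lt_div_iff₀ hσ0] at h
  have h2σ : 2 * σ < n + 2 := by
    rw [hpbar, div_lt_div_iff₀ (by positivity) hσ0] at hsuper
    nlinarith
  have hpP : ∀ i, p i ≤ bigP p := fun i =>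
    (le_ciSup (Set.finite_range p).bddAbove i).trans (le_max_right _ _)
  have hPσ : bigP p * σ < n + 2 := by
    obtain ⟨j, hj⟩ := exists_eq_ciSup_of_finite (f := p)
    rcases max_choice (2 : ℝ) (⨆ i, p i) with h | h
    · rw [bigP, h]; exact h2σ
    · rw [bigP, h, ← hj]; exact hub j
  have hω : omega p = bigP p - 2 + bigP p * σ - n := by
    rw [omega, hpbar]; field_simp; ring
  obtain ⟨C, hC, hmain⟩ := abs_le_average hn (fun i => (hp i).1) hσ1 hpP (le_max_left _ _) hPσ C₀ D
    hω hν.1 hν.2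
  refine ⟨C, hC, fun δ hδ hδD Ω hΩ _ _ T _ u hu x₀ t₀ ρ hρ hcc => ?_⟩
  obtain ⟨v, g, hvu, hv, hv'⟩ := hu.exists_localDG (fun i => (hp i).1) hΩ (by linarith) hcc
  have hb := hmain δ hδ (fun i => hδD ▸ le_ciSup (Set.finite_range δ).bddAbove i) x₀ t₀ ρ v g hρ
    hv hv'
  have havg : (⨍ z in cyl p x₀ t₀ (2 * ρ), |v z| ^ ν) = ⨍ z in cyl p x₀ t₀ (2 * ρ), |u z| ^ ν := by
    refine average_congr ?_
    filter_upwards [hvu] with z hz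
    rw [hz]
  rw [havg] at hb
  refine essSup_le_of_ae_le _ ?_
  have hvu' := ae_restrict_of_ae_restrict_of_subset
    (cyl_subset_cyl hp0 x₀ t₀ hρ.le (by linarith : ρ ≤ 2 * ρ)) hvu
  filter_upwards [hb, hvu'] with z hz hzu
  rw [hzu] at hz
  rw [Real.enorm_eq_ofReal_abs]
  exact ENNReal.ofReal_le_ofReal hz
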